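/- Let $n\ge 1$, $s\in(0,n)$, $\alpha>0$ and $\gamma\ge 0$. For $N\in\mathbb N$ and $\beta>0$ consider the Gibbs measure on $(\mathbb R^n)^N$ $$\mathbb P_N(d\mathbf x)=\frac{1}{Z_N}\exp\Big(-\beta\sum_{1\le i<j\le N}|x_i-x_j|^{-s}-\sum_{j=1}^N|x_j|^\alpha\Big)\,dx_1\cdots dx_N ,$$ where $Z_N$ is the normalizing constant. Let $\nu_0(dx)=C_0^{-1}e^{-|x|^\alpha}dx$ be the probability measure on $\mathbb R^n$ with density proportional to $e^{-|x|^\alpha}$, and let $\mathrm H(\mu|\nu_0)$ denote the relative entropy. The free energy $$\mathscr F_\gamma(\mu)=\frac{\gamma}{2}\iint |x-z|^{-s}\mu(dz)\mu(dx)+\mathrm H(\mu|\nu_0)$$ has a unique minimizer $\mu_\gamma$ among the probability measures on $\mathbb R^n$, and there is a constant $\mathrm L_\gamma>0$ with $$\mu_\gamma(dx)=\mathrm L_\gamma^{-1}e^{-\gamma\,\mathscr U^{\mu_\gamma}(x)-|x|^\alpha}dx,\qquad \mathscr U^{\mu_\gamma}(x)=\int|x-z|^{-s}\mu_\gamma(dz).$$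 Let $$\eta_N=(\log N)^{1/\alpha}\Big(1-\frac{n(\alpha-1)}{\alpha^2}\frac{\log\log N}{\log N}-\frac{\log(\alpha^n\mathrm L_\gamma)}{\alpha\log N}\Big).$$ Let $\upsilon\in\mathbb S^{n-1}$, let $\psi$ be any orthogonal map of $\mathbb R^n$ with $\psi(e_1)=\upsilon$ (for instance, when $n\ge2$, one in $SO(n)$), and set $\varphi_N(x)=\eta_N\big(\upsilon+\alpha^{-1}\eta_N^{-\alpha}\psi(x)\big)$, which is a bijection of $\mathbb R^n$ for large $N$. Then, for every sequence $\beta=\beta_N>0$ with $N\beta_N\to\gamma$ as $N\to\infty$, the point process $\Xi_N=\sum_{j=1}^N\boldsymbol\delta_{\varphi_N^{-1}(x_j)}$, with $\mathbf x=(x_1,\dots,x_N)$ distributed according to $\mathbb P_N$, converges in distribution as $N\to\infty$ to a Poisson point process on $\mathbb R^n$ with intensity $\theta(x)=e^{-e_1\cdot x}$ with respect to Lebesgue measure. Here convergence in distribution means that $\mathbb E[e^{-\Xi_N(f)}]\to\exp\big(\int(e^{-f(x)}-1)\,\theta(x)\,dx\big)$, the Laplace functional of that Poisson process, for every continuous $f:\mathbb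 R^n\to[0,\infty)$ with compact support. -/

import Mathlib

open MeasureTheory Filter Topology
open scoped ENNReal NNReal

namespace RieszGas

noncomputable section

/-- Euclidean space `ℝⁿ` with its Euclidean norm and Lebesgue measure. -/
abbrev Space (n : ℕ) : Type := EuclideanSpace ℝ (Fin n)

/-- `e^{-t}` for `t ∈ [0, ∞]`, with `e^{-∞} = 0`. -/
def expNeg (t : ℝ≥0∞) : ℝ≥0∞ := EReal.exp (-(t : EReal))

/-! ### The gas -/

/-- The Riesz kernel `|x - u|^{-s}`, equal to `∞` on the diagonal when `s > 0`. -/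
def rieszKernel {n : ℕ} (s : ℝ) (u x : Space n) : ℝ≥0∞ := ‖x - u‖ₑ ^ (-s)

/-- The confining potential `V(x) = |x|^α`. -/
def potential {n : ℕ} (α : ℝ) (x : Space n) : ℝ≥0∞ := ENNReal.ofReal (‖x‖ ^ α)

/-- The energy `β ∑_{i<j} |x_i - x_j|^{-s} + ∑_j |x_j|^α` of a configuration. -/
def energy {n : ℕ} (s α β : ℝ) {N : ℕ} (x : Fin N → Space n) : ℝ≥0∞ :=
  ENNReal.ofReal β * (∑ i, ∑ j ∈ Finset.Ioi i, rieszKernel s (x i) (x j))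
    + ∑ j, potential α (x j)

/-- The partition function `Z_N`. -/
def partitionFunction (n : ℕ) (s α β : ℝ) (N : ℕ) : ℝ≥0∞ :=
  ∫⁻ x : Fin N → Space n, expNeg (energy s α β x)

/-- The Gibbs measure `Z_N⁻¹ e^{-H_N(x)} dx` on `(ℝⁿ)^N`. -/
def gibbsMeasure (n : ℕ) (s α β : ℝ) (N : ℕ) : Measure (Fin N → Space n) :=
  (partitionFunction n s α β N)⁻¹ •
    (volume : Measure (Fin N → Space n)).withDensity (fun x => expNeg (energy s α β x))

/-! ### The equilibrium measure -/

/-- The energy functional `∬ g(x, z) μ(dz) μ(dx)`. -/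
def interactionEnergy {n : ℕ} (s : ℝ) (μ : Measure (Space n)) : ℝ≥0∞ :=
  ∫⁻ x, ∫⁻ z, rieszKernel s x z ∂μ ∂μ

/-- The potential `U^μ(x) = ∫ g(x, z) μ(dz)` generated by `μ`. -/
def generatedPotential {n : ℕ} (s : ℝ) (μ : Measure (Space n)) (x : Space n) : ℝ≥0∞ :=
  ∫⁻ z, rieszKernel s x z ∂μ

/-- The reference probability measure `ν₀(dx) = C₀⁻¹ e^{-|x|^α} dx`. -/
def referenceMeasure (n : ℕ) (α : ℝ) : Measure (Space n) :=
  (∫⁻ x : Space n, expNeg (potential α x))⁻¹ •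
    (volume : Measure (Space n)).withDensity (fun x => expNeg (potential α x))

/-- The free energy `F_γ(μ) = (γ/2) ∬ g dμ dμ + H(μ | ν₀)` of a probability measure. For
probability measures Mathlib's `klDiv` is the relative entropy `∫ log (dμ/dν₀) dμ`, equal to `∞`
when `μ` is not absolutely continuous. -/
def freeEnergy {n : ℕ} (s α γ : ℝ) (μ : ProbabilityMeasure (Space n)) : ℝ≥0∞ :=
  ENNReal.ofReal (γ / 2) * interactionEnergy s (μ : Measure (Space n))
    + InformationTheory.klDiv (μ : Measure (Space n)) (referenceMeasure n α)

/-- `μ` is the unique minimizer of the free energy over all probability measures on `ℝⁿ`. -/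
def IsEquilibriumMeasure {n : ℕ} (s α γ : ℝ) (μ : ProbabilityMeasure (Space n)) : Prop :=
  ∀ ν : ProbabilityMeasure (Space n), ν ≠ μ → freeEnergy s α γ μ < freeEnergy s α γ ν

/-- The self-consistent equation `μ(dx) = L⁻¹ e^{-γ U^μ(x) - |x|^α} dx` with `L > 0`. -/
def SelfConsistent {n : ℕ} (s α γ : ℝ) (μ : ProbabilityMeasure (Space n)) (L : ℝ) : Prop :=
  0 < L ∧
    (μ : Measure (Space n)) = (ENNReal.ofReal L)⁻¹ •
      (volume : Measure (Space n)).withDensity (fun x =>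
        expNeg (ENNReal.ofReal γ * generatedPotential s (μ : Measure (Space n)) x
          + potential α x))

/-! ### Point processes -/

/-- A point process on `ℝⁿ`: a random measure which almost surely takes finite integer values on
bounded Borel sets. -/
def IsPointProcess {n : ℕ} {Ω : Type*} [MeasurableSpace Ω] (P : Measure Ω)
    (Ξ : Ω → Measure (Space n)) : Prop :=
  Measurable Ξ ∧ ∀ᵐ ω ∂P, ∀ B : Set (Space n), MeasurableSet B → Bornology.IsBounded B →
    ∃ k : ℕ, Ξ ω B = k

/-- The Laplace functional `E[e^{-Ξ(f)}]` of a random measure `Ξ`, for `f ≥ 0`. -/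
def laplaceFunctional {n : ℕ} {Ω : Type*} [MeasurableSpace Ω] (P : Measure Ω)
    (Ξ : Ω → Measure (Space n)) (f : Space n → ℝ≥0) : ℝ≥0∞ :=
  ∫⁻ ω, expNeg (∫⁻ x, (f x : ℝ≥0∞) ∂(Ξ ω)) ∂P

/-- A Poisson point process with intensity measure `θ`, characterized by its Laplace functional
`exp (∫ (e^{-f} - 1) dθ)`, `f ≥ 0` Borel. -/
def IsPoissonPointProcess {n : ℕ} {Ω : Type*} [MeasurableSpace Ω] (P : Measure Ω)
    (Ξ : Ω → Measure (Space n)) (θ : Measure (Space n)) : Prop :=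
  IsProbabilityMeasure P ∧ IsPointProcess P Ξ ∧
    ∀ f : Space n → ℝ≥0, Measurable f →
      laplaceFunctional P Ξ f = expNeg (∫⁻ x, (1 - expNeg (f x)) ∂θ)

/-- Convergence in distribution of random measures `Ξ_N` (under `P_N`) to `Ξ` (under `P`):
convergence of the Laplace functionals on nonnegative continuous functions with compact support. -/
def ConvergesInDistribution {n : ℕ} {ΩN : ℕ → Type*} [∀ N, MeasurableSpace (ΩN N)]
    (PN : ∀ N, Measure (ΩN N)) (ΞN : ∀ N, ΩN N → Measure (Space n))
    {Ω : Type*} [MeasurableSpace Ω] (P : Measure Ω) (Ξ : Ω → Measure (Space n)) : Prop :=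
  ∀ f : Space n → ℝ≥0, Continuous f → HasCompactSupport f →
    Tendsto (fun N => laplaceFunctional (PN N) (ΞN N) f) atTop (𝓝 (laplaceFunctional P Ξ f))

/-! ### Zooming at the boundary -/

/-- The radius `η_N`. -/
def edgeRadius (n : ℕ) (α L : ℝ) (N : ℕ) : ℝ :=
  Real.log N ^ (1 / α) *
    (1 - (n * (α - 1) / α ^ 2) * (Real.log (Real.log N) / Real.log N)
      - Real.log (α ^ n * L) / (α * Real.log N))

/-- The map `φ_N(x) = η (υ + α⁻¹ η^{-α} ψ(x))` with `η = η_N`. -/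
def edgeMap {n : ℕ} (α η : ℝ) (υ : Space n) (ψ : Space n ≃ₗᵢ[ℝ] Space n) (x : Space n) :
    Space n :=
  η • (υ + (α⁻¹ * η ^ (-α)) • ψ x)

/-- The rescaled process `∑_j δ_{φ⁻¹(x_j)}`. The map `φ` is a bijection of `ℝⁿ` as soon as
`η > 0`, and `Function.invFun` is then its inverse. -/
def edgeProcess {n : ℕ} (φ : Space n → Space n) {N : ℕ} (x : Fin N → Space n) :
    Measure (Space n) :=
  ∑ j, Measure.dirac (Function.invFun φ (x j))

/-- The first basis vector `e₁`. -/
def e₁ (n : ℕ) [NeZero n] : Space n := EuclideanSpace.single (0 : Fin n) (1 : ℝ)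

/-- The measure with density `e^{-e₁ · x}` with respect to Lebesgue measure. -/
def edgeIntensity (n : ℕ) [NeZero n] : Measure (Space n) :=
  (volume : Measure (Space n)).withDensity
    (fun x => ENNReal.ofReal (Real.exp (-(inner ℝ (e₁ n) x))))

end

end RieszGas

namespace RieszGas

/-! ### The function `e^{-t}` on `[0, ∞]` -/

/-! Since `N β_N → γ`, each particle feels an interaction of order one, produced by the bulk, which
follows a law of large numbers. Far out, where the bulk generates almost no potential, a particle
does not feel the gas, so edge particles are nearly independent with density proportional to
`e^{-|x|^α}`. The interaction survives only in the normalisation: the density is divided by `Z_N /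
Z_{N-1}`, which tends to `L_γ`. The radius `η_N` is tuned so that `N e^{-|x|^α} dx`, seen through
`φ_N`, converges to `L_γ e^{-y₁} dy` (`tendsto_integral_edgeMapInv`), and the two factors `L_γ`
cancel.

No correlation functions are needed for the independence. With `p = 1 - e^{-f ∘ φ_N⁻¹}`, the
function `Λ(t) = E ∏_j (1 - t p(x_j))` goes from `1` at `t = 0` to the Laplace functional at `t =
1`. Integrating out one particle expresses both `Λ` and `Λ'` through the gas of the remaining
particles and gives `Λ' ≈ -Θ Λ` with `Θ = ∫ (1 - e^{-f}) e^{-y₁} dy`; a Gronwall estimate then gives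
`Λ(1) ≈ e^{-Θ}` (`SelfConsistent.abs_integral_thinProd_sub_le`, `abs_sub_exp_neg_le`).

The input is a mean-field limit: the Boltzmann factor of an extra particle at `x` converges in mean
to `e^{-γ U(x)}`, uniformly in `x` (`SelfConsistent.eventually_integral_fieldFactor_sub_le`). The
kernel is a positive mixture of Gaussians `e^{-t|x-z|²}`, each a Gram kernel. Its part with `t ≤ T`
is bounded and positive definite; the rest has small integral in `z` because `s < n`. Comparing the
gas with independent particles of law `μ_γ` bounds the mean truncated energy of the difference
between the empirical measure and `M μ_γ` (`SelfConsistent.integral_discrepancy_le`), and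
Cauchy–Schwarz turns this into a bound on the field at `x`. The scales `t > T` are controlled by a
domination of one-particle marginals (`lintegral_gibbsMeasure_apply_le`), which follows from a
Jensen lower bound on ratios of partition functions.

For the equilibrium measure, the same Gram representation makes the interaction convex, and the
entropy is convex with an explicit Hellinger gap. Minimising sequences are therefore Cauchy after
taking square roots of densities, which gives existence and uniqueness. First-order optimality
tested against the Gibbs density of the minimiser's own potential makes a Bregman divergence vanish,
which is the self-consistent equation (`exists_minimizer_eq_exp`). The limiting process is built as
a superposition of finite Poisson clusters. -/

@[simp] lemma expNeg_zero : expNeg 0 = 1 := by simp [expNeg]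

@[simp] lemma expNeg_top : expNeg ⊤ = 0 := by simp [expNeg]

lemma expNeg_coe (t : ℝ≥0) : expNeg t = ENNReal.ofReal (Real.exp (-t)) := by
  have : (-((t : ℝ≥0∞) : EReal)) = ((-(t : ℝ) : ℝ) : EReal) := by
    rw [EReal.coe_neg]; rfl
  rw [expNeg, this, EReal.exp_coe]

lemma expNeg_of_ne_top {t : ℝ≥0∞} (ht : t ≠ ⊤) :
    expNeg t = ENNReal.ofReal (Real.exp (-t.toReal)) := by
  lift t to ℝ≥0 using ht
  exact expNeg_coe t

lemma expNeg_ofReal {t : ℝ} (ht : 0 ≤ t) :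
    expNeg (ENNReal.ofReal t) = ENNReal.ofReal (Real.exp (-t)) := by
  rw [expNeg_of_ne_top ENNReal.ofReal_ne_top, ENNReal.toReal_ofReal ht]

lemma expNeg_antitone : Antitone expNeg := fun _ _ h =>
  EReal.exp_monotone (EReal.neg_le_neg_iff.2 (EReal.coe_ennreal_le_coe_ennreal_iff.2 h))

lemma expNeg_le_one (t : ℝ≥0∞) : expNeg t ≤ 1 := by
  simpa using expNeg_antitone (zero_le (a := t))

lemma expNeg_ne_top (t : ℝ≥0∞) : expNeg t ≠ ⊤ := ((expNeg_le_one t).trans_lt (by simp)).ne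

lemma expNeg_add (a b : ℝ≥0∞) : expNeg (a + b) = expNeg a * expNeg b := by
  rcases eq_or_ne a ⊤ with rfl | ha
  · simp
  rcases eq_or_ne b ⊤ with rfl | hb
  · simp
  rw [expNeg_of_ne_top ha, expNeg_of_ne_top hb, expNeg_of_ne_top (by simp [ha, hb]),
    ENNReal.toReal_add ha hb, neg_add, Real.exp_add, ENNReal.ofReal_mul (Real.exp_nonneg _)]

lemma expNeg_sum {ι : Type*} (S : Finset ι) (f : ι → ℝ≥0∞) :
    expNeg (∑ i ∈ S, f i) = ∏ i ∈ S, expNeg (f i) := by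
  classical
  induction S using Finset.induction_on with
  | empty => simp
  | insert i S hi ih => rw [Finset.sum_insert hi, Finset.prod_insert hi, expNeg_add, ih]

lemma continuous_expNeg : Continuous expNeg :=
  ENNReal.continuous_exp.comp (continuous_neg.comp continuous_coe_ennreal_ereal)

lemma measurable_expNeg : Measurable expNeg := continuous_expNeg.measurable

lemma toReal_expNeg {t : ℝ≥0∞} (ht : t ≠ ⊤) : (expNeg t).toReal = Real.exp (-t.toReal) := by
  rw [expNeg_of_ne_top ht, ENNReal.toReal_ofReal (Real.exp_nonneg _)]

lemma expNeg_pos {t : ℝ≥0∞} (ht : t ≠ ⊤) : 0 < expNeg t := by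
  rw [expNeg_of_ne_top ht]; simp [Real.exp_pos]

/-- The inequality `1 - e^{-t} ≤ t` without subtraction in `[0, ∞]`; it later bounds the effect of
the gas on a remote particle by the mean field there. -/
lemma one_le_expNeg_add (t : ℝ≥0∞) : 1 ≤ expNeg t + t := by
  rcases eq_or_ne t ⊤ with rfl | ht
  · simp
  lift t to ℝ≥0 using ht
  rw [expNeg_coe, ← ENNReal.ofReal_coe_nnreal, ← ENNReal.ofReal_add (Real.exp_nonneg _) (by simp),
    ENNReal.one_le_ofReal]
  linarith [Real.add_one_le_exp (-(t : ℝ))]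

/-! ### The Riesz kernel as a Gaussian mixture -/

section Kernel

variable {n : ℕ}

/-- The feature `e^{-2t|x-w|²}` of the point `x`, for `p = (t, w)`. -/
noncomputable def feature (p : ℝ × Space n) (x : Space n) : ℝ≥0∞ :=
  ENNReal.ofReal (Real.exp (-(2 * p.1 * ‖x - p.2‖ ^ 2)))

/-- The measure for which the Riesz kernel is the Gram kernel of the features. -/
noncomputable def featureMeasure (n : ℕ) (s : ℝ) : Measure (ℝ × Space n) :=
  ((volume.restrict (Set.Ioi (0 : ℝ))).prod volume).withDensity (fun p =>
    ENNReal.ofReal ((Real.Gamma (s / 2))⁻¹ * p.1 ^ (s / 2 - 1) * (4 * p.1 / Real.pi) ^ (n / 2 : ℝ)))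

instance (s : ℝ) : SFinite (featureMeasure n s) := by unfold featureMeasure; infer_instance

@[fun_prop] lemma measurable_feature :
    Measurable (fun q : (ℝ × Space n) × Space n => feature q.1 q.2) := by
  unfold feature; fun_prop

@[fun_prop] lemma measurable_feature_left (x : Space n) :
    Measurable (fun p : ℝ × Space n => feature p x) := by
  unfold feature; fun_prop

@[fun_prop] lemma measurable_feature_right (p : ℝ × Space n) :
    Measurable (fun x : Space n => feature p x) := by
  unfold feature; fun_prop

lemma lintegral_gaussian {b : ℝ} (hb : 0 < b) (a : Space n) :
    ∫⁻ w : Space n, ENNReal.ofReal (Real.exp (-(b * ‖w - a‖ ^ 2)))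
      = ENNReal.ofReal ((Real.pi / b) ^ (n / 2 : ℝ)) := by
  rw [lintegral_sub_right_eq_self (fun w : Space n => ENNReal.ofReal (Real.exp (-(b * ‖w‖ ^ 2)))) a]
  have h := GaussianFourier.integral_rexp_neg_mul_sq_norm (V := Space n) hb
  simp only [finrank_euclideanSpace, Fintype.card_fin, neg_mul] at h
  have hi : Integrable (fun w : Space n => Real.exp (-(b * ‖w‖ ^ 2))) := by
    by_contra hc
    rw [integral_undef hc] at h
    have : (0 : ℝ) < (Real.pi / b) ^ (n / 2 : ℝ) := by positivity
    linarith
  rw [← h, ofReal_integral_eq_lintegral_ofReal hi (ae_of_all _ fun _ => Real.exp_nonneg _)]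

/-- The Gaussian mixture kernel over the scales `t ∈ S`. -/
noncomputable def scaleKernel (s : ℝ) (S : Set ℝ) (x z : Space n) : ℝ≥0∞ :=
  ∫⁻ t in S, ENNReal.ofReal ((Real.Gamma (s / 2))⁻¹ * t ^ (s / 2 - 1)) *
    ENNReal.ofReal (Real.exp (-(t * ‖x - z‖ ^ 2))) ∂(volume.restrict (Set.Ioi 0))

/-- The parallelogram law at `p.2` separates the midpoint: `2(|x-w|² + |z-w|²) = |x-z|² + 4|w -
(x+z)/2|²`. The coefficient `2t` in the feature is what leaves exactly `t|x-z|²`. -/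
lemma feature_mul_feature (p : ℝ × Space n) (x z : Space n) :
    feature p x * feature p z = ENNReal.ofReal (Real.exp (-(p.1 * ‖x - z‖ ^ 2))) *
      ENNReal.ofReal (Real.exp (-(4 * p.1 * ‖p.2 - (2⁻¹ : ℝ) • (x + z)‖ ^ 2))) := by
  rw [feature, feature, ← ENNReal.ofReal_mul (Real.exp_nonneg _),
    ← ENNReal.ofReal_mul (Real.exp_nonneg _), ← Real.exp_add, ← Real.exp_add]
  congr 2
  have h := parallelogram_law_with_norm ℝ (x - p.2) (z - p.2)
  have h1 : x - p.2 + (z - p.2) = (-2 : ℝ) • (p.2 - (2⁻¹ : ℝ) • (x + z)) := by module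
  have h2 : x - p.2 - (z - p.2) = x - z := by abel
  rw [h1, h2, norm_smul] at h
  rw [mul_pow, Real.norm_eq_abs, sq_abs] at h
  linear_combination p.1 * h

/-- Integrating out the centre `w` produces `(π/4t)^{n/2}`, which the factor `(4t/π)^{n/2}` in
`featureMeasure` cancels. This exhibits each `scaleKernel` as a Gram kernel, hence positive
definite. -/
lemma lintegral_feature_mul_feature (s : ℝ) (hs : 0 < s) {S : Set ℝ} (hS : MeasurableSet S)
    (x z : Space n) :
    ∫⁻ p in S ×ˢ Set.univ, feature p x * feature p z ∂(featureMeasure n s)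
      = scaleKernel s S x z := by
  rw [featureMeasure, restrict_withDensity (hS.prod .univ),
    lintegral_withDensity_eq_lintegral_mul _ (by fun_prop) (by fun_prop),
    ← Measure.prod_restrict, Measure.restrict_univ, lintegral_prod _ (by fun_prop), scaleKernel,
    Measure.restrict_restrict hS]
  refine setLIntegral_congr_fun (hS.inter measurableSet_Ioi) fun t ht => ?_
  have ht0 : 0 < t := ht.2
  have hΓ : 0 < Real.Gamma (s / 2) := Real.Gamma_pos_of_pos (by linarith)
  simp only [Pi.mul_apply, feature_mul_feature]
  rw [lintegral_const_mul _ (by fun_prop), lintegral_const_mul _ (by fun_prop),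
    lintegral_gaussian (by linarith), ENNReal.ofReal_mul (by positivity)]
  have : ENNReal.ofReal ((4 * t / Real.pi) ^ (n / 2 : ℝ)) *
      ENNReal.ofReal ((Real.pi / (4 * t)) ^ (n / 2 : ℝ)) = 1 := by
    rw [← ENNReal.ofReal_mul (by positivity), ← Real.mul_rpow (by positivity) (by positivity)]
    rw [div_mul_div_cancel₀ Real.pi_pos.ne', div_self (by positivity)]; simp
  calc _ = ENNReal.ofReal ((Real.Gamma (s / 2))⁻¹ * t ^ (s / 2 - 1)) *
      ENNReal.ofReal (Real.exp (-(t * ‖x - z‖ ^ 2))) * (ENNReal.ofReal ((4 * t / Real.pi) ^ (n / 2 : ℝ)) *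
      ENNReal.ofReal ((Real.pi / (4 * t)) ^ (n / 2 : ℝ))) := by ring
    _ = _ := by rw [this, mul_one]

/-- Euler's integral for `Γ(s/2)` after rescaling by `|x-z|²`. -/
lemma scaleKernel_univ_of_ne (s : ℝ) (hs : 0 < s) {x z : Space n} (h : x ≠ z) :
    scaleKernel s Set.univ x z = rieszKernel s x z := by
  have hr : 0 < ‖x - z‖ := norm_pos_iff.2 (sub_ne_zero.2 h)
  have hΓ : 0 < Real.Gamma (s / 2) := Real.Gamma_pos_of_pos (by linarith)
  have hI := Real.integral_rpow_mul_exp_neg_mul_Ioi (a := s / 2) (r := ‖x - z‖ ^ 2)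
    (by linarith) (by positivity)
  have hval : (1 / ‖x - z‖ ^ 2) ^ (s / 2) = ‖x - z‖ ^ (-s) := by
    rw [one_div, Real.inv_rpow (by positivity), ← Real.rpow_natCast, ← Real.rpow_mul hr.le,
      Real.rpow_neg hr.le]
    congr 2; push_cast; ring
  have hint : IntegrableOn (fun t : ℝ => t ^ (s / 2 - 1) * Real.exp (-(‖x - z‖ ^ 2 * t)))
      (Set.Ioi 0) := by
    by_contra hc
    rw [integral_undef hc] at hI
    have : (0 : ℝ) < (1 / ‖x - z‖ ^ 2) ^ (s / 2) * Real.Gamma (s / 2) := by positivity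
    linarith
  rw [scaleKernel, Measure.restrict_univ, rieszKernel, ← ofReal_norm,
    norm_sub_rev z x, ENNReal.ofReal_rpow_of_pos hr]
  have : ‖x - z‖ ^ (-s) = ∫ t in Set.Ioi (0 : ℝ), (Real.Gamma (s / 2))⁻¹ *
      (t ^ (s / 2 - 1) * Real.exp (-(‖x - z‖ ^ 2 * t))) := by
    rw [integral_const_mul, hI, hval]; field_simp
  rw [this, ofReal_integral_eq_lintegral_ofReal (hint.const_mul _)]
  · refine setLIntegral_congr_fun measurableSet_Ioi fun t ht => ?_
    have ht0 : 0 < t := ht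
    rw [← ENNReal.ofReal_mul (by positivity), mul_comm t, mul_assoc]
  · refine (ae_restrict_iff' measurableSet_Ioi).2 (ae_of_all _ fun t ht => ?_)
    have ht0 : 0 < t := ht
    simp only [Pi.zero_apply]; positivity

lemma scaleKernel_le_self (s : ℝ) {S : Set ℝ} (hS : MeasurableSet S) (x z y : Space n) :
    scaleKernel s S x z ≤ scaleKernel s S y y := by
  unfold scaleKernel
  rw [Measure.restrict_restrict hS]
  refine setLIntegral_mono' (hS.inter measurableSet_Ioi) fun t ht => ?_
  have ht0 : 0 < t := ht.2
  gcongr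
  simp

/-- The diagonal value dominates every off-diagonal one, and those are unbounded. With the diagonal
included, the mixture formula holds at every pair of points and no null sets have to be removed. -/
lemma scaleKernel_univ_self [NeZero n] (s : ℝ) (hs : 0 < s) (x : Space n) :
    scaleKernel s Set.univ x x = ⊤ := by
  refine ENNReal.eq_top_of_forall_nnreal_le fun M => ?_
  have hM : (0 : ℝ) < M + 1 := by positivity
  -- The distance at which the Riesz kernel equals `M + 1`.
  set d : ℝ := (M + 1 : ℝ) ^ (-(1 / s)) with hd
  have hd0 : 0 < d := by positivity
  set z : Space n := x - d • e₁ n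
  have hxz : ‖x - z‖ = d := by
    simp [z, norm_smul, e₁, abs_of_pos hd0]
  have hne : x ≠ z := by
    intro h
    rw [← h] at hxz
    simp at hxz; linarith
  calc (M : ℝ≥0∞) ≤ rieszKernel s x z := by
        rw [rieszKernel, ← ofReal_norm, norm_sub_rev, hxz, ENNReal.ofReal_rpow_of_pos hd0, hd,
          ← Real.rpow_mul hM.le]
        have : -(1 / s) * -s = 1 := by field_simp
        rw [this, Real.rpow_one, ← ENNReal.ofReal_coe_nnreal]
        exact ENNReal.ofReal_le_ofReal (by linarith)
    _ = scaleKernel s Set.univ x z := (scaleKernel_univ_of_ne s hs hne).symm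
    _ ≤ _ := scaleKernel_le_self s .univ x z x

lemma rieszKernel_eq_scaleKernel [NeZero n] (s : ℝ) (hs : 0 < s) (x z : Space n) :
    rieszKernel s x z = scaleKernel s Set.univ x z := by
  by_cases h : x = z
  · subst h
    rw [scaleKernel_univ_self s hs]
    simp [rieszKernel, hs]
  · exact (scaleKernel_univ_of_ne s hs h).symm

lemma rieszKernel_eq_lintegral_feature [NeZero n] (s : ℝ) (hs : 0 < s) (x z : Space n) :
    rieszKernel s x z = ∫⁻ p, feature p x * feature p z ∂(featureMeasure n s) := by
  rw [rieszKernel_eq_scaleKernel s hs, ← lintegral_feature_mul_feature s hs .univ]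
  simp

lemma measurable_rieszKernel (s : ℝ) :
    Measurable (fun q : Space n × Space n => rieszKernel s q.1 q.2) := by
  unfold rieszKernel; fun_prop

lemma rieszKernel_comm (s : ℝ) (x z : Space n) : rieszKernel s x z = rieszKernel s z x := by
  rw [rieszKernel, rieszKernel, ← ofReal_norm, ← ofReal_norm, norm_sub_rev]

/-- The part of the Riesz kernel with scales `t ≤ T`. -/
noncomputable def truncKernel (s T : ℝ) (x z : Space n) : ℝ≥0∞ :=
  scaleKernel s (Set.Iic T) x z

/-- The part of the Riesz kernel with scales `t > T`. -/
noncomputable def tailKernel (s T : ℝ) (x z : Space n) : ℝ≥0∞ :=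
  scaleKernel s (Set.Ioi T) x z

lemma rieszKernel_eq_trunc_add_tail [NeZero n] (s : ℝ) (hs : 0 < s) (T : ℝ) (x z : Space n) :
    rieszKernel s x z = truncKernel s T x z + tailKernel s T x z := by
  rw [rieszKernel_eq_scaleKernel s hs, truncKernel, tailKernel, scaleKernel, scaleKernel,
    scaleKernel, ← lintegral_add_compl _ (measurableSet_Iic (a := T)), Set.compl_Iic,
    Measure.restrict_univ]

lemma truncKernel_le [NeZero n] (s : ℝ) (hs : 0 < s) (T : ℝ) (x z : Space n) :
    truncKernel s T x z ≤ rieszKernel s x z := by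
  rw [rieszKernel_eq_trunc_add_tail s hs T]; exact le_self_add

lemma truncKernel_eq_lintegral_feature (s : ℝ) (hs : 0 < s) (T : ℝ) (x z : Space n) :
    truncKernel s T x z = ∫⁻ p, feature p x * feature p z
      ∂((featureMeasure n s).restrict (Set.Iic T ×ˢ Set.univ)) :=
  (lintegral_feature_mul_feature s hs measurableSet_Iic x z).symm

@[fun_prop] lemma measurable_scaleKernel (s : ℝ) (S : Set ℝ) :
    Measurable (fun q : Space n × Space n => scaleKernel s S q.1 q.2) := by
  unfold scaleKernel
  refine Measurable.lintegral_prod_right' (f := fun q : (Space n × Space n) × ℝ =>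
    ENNReal.ofReal ((Real.Gamma (s / 2))⁻¹ * q.2 ^ (s / 2 - 1)) *
    ENNReal.ofReal (Real.exp (-(q.2 * ‖q.1.1 - q.1.2‖ ^ 2)))) ?_
  fun_prop

@[fun_prop] lemma measurable_scaleKernel_right (s : ℝ) (S : Set ℝ) (x : Space n) :
    Measurable (fun z : Space n => scaleKernel s S x z) :=
  Measurable.of_uncurry_left (f := fun x z : Space n => scaleKernel s S x z)
    (measurable_scaleKernel s S)

@[fun_prop] lemma measurable_truncKernel_right (s T : ℝ) (x : Space n) :
    Measurable (fun z : Space n => truncKernel s T x z) := measurable_scaleKernel_right s _ x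

@[fun_prop] lemma measurable_tailKernel_right (s T : ℝ) (x : Space n) :
    Measurable (fun z : Space n => tailKernel s T x z) := measurable_scaleKernel_right s _ x

/-- A uniform bound for the truncated kernel. -/
noncomputable def truncBound (n : ℕ) (s T : ℝ) : ℝ≥0∞ := truncKernel s T (0 : Space n) 0

lemma truncKernel_le_bound (s T : ℝ) (x z : Space n) :
    truncKernel s T x z ≤ truncBound n s T :=
  scaleKernel_le_self s measurableSet_Iic x z 0

lemma truncKernel_self (s T : ℝ) (x : Space n) : truncKernel s T x x = truncBound n s T := by
  simp [truncBound, truncKernel, scaleKernel]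

lemma truncBound_ne_top (s : ℝ) (hs : 0 < s) (T : ℝ) : truncBound n s T ≠ ⊤ := by
  simp only [truncBound, truncKernel, scaleKernel, sub_self, norm_zero]
  rw [Measure.restrict_restrict measurableSet_Iic, Set.Iic_inter_Ioi]
  have hi : IntegrableOn (fun t : ℝ => (Real.Gamma (s / 2))⁻¹ * t ^ (s / 2 - 1)) (Set.Ioc 0 T) := by
    rcases le_total 0 T with hT | hT
    · have := intervalIntegral.intervalIntegrable_rpow' (a := 0) (b := T) (r := s / 2 - 1)
        (by linarith)
      exact ((intervalIntegrable_iff_integrableOn_Ioc_of_le hT).1 this).const_mul _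
    · simp [hT]
  have := hi.lintegral_lt_top
  simpa using this.ne

/-- The mass `∫ (g - g_T)(x, z) dz`, which does not depend on `x`. -/
noncomputable def tailMass (n : ℕ) (s T : ℝ) : ℝ≥0∞ := ∫⁻ z : Space n, tailKernel s T 0 z

lemma lintegral_tailKernel (s T : ℝ) (x : Space n) :
    ∫⁻ z, tailKernel s T x z = tailMass n s T := by
  rw [tailMass, ← lintegral_sub_right_eq_self (fun z => tailKernel s T 0 z) x]
  refine lintegral_congr fun z => ?_
  simp only [tailKernel, scaleKernel, zero_sub, norm_neg, norm_sub_rev x z]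

/-- Integrating the Gaussians over space first gives `(π/t)^{n/2}`; the remaining `∫_T^∞ t^{(s-n)/2
- 1} dt` converges exactly because `s < n`. -/
lemma tailMass_le (s : ℝ) (hs : 0 < s) (hsn : s < n) {T : ℝ} (hT : 0 < T) :
    tailMass n s T ≤ ENNReal.ofReal ((Real.Gamma (s / 2))⁻¹ * Real.pi ^ (n / 2 : ℝ) *
      (T ^ ((s - n) / 2) / ((n - s) / 2))) := by
  have hΓ : 0 < Real.Gamma (s / 2) := Real.Gamma_pos_of_pos (by linarith)
  have ha : (s - n) / 2 - 1 < -1 := by linarith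
  unfold tailMass tailKernel scaleKernel
  rw [lintegral_lintegral_swap (by fun_prop), Measure.restrict_restrict measurableSet_Ioi,
    Set.Ioi_inter_Ioi, max_eq_left hT.le]
  have hI := integral_Ioi_rpow_of_lt ha hT
  rw [sub_add_cancel] at hI
  have hval : T ^ ((s - n) / 2) / ((n - s) / 2) = -T ^ ((s - n) / 2) / ((s - n) / 2) := by
    rw [neg_div, ← div_neg]; congr 1; ring
  rw [hval, ← hI, ← integral_const_mul, ofReal_integral_eq_lintegral_ofReal
    ((integrableOn_Ioi_rpow_of_lt ha hT).const_mul _)]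
  · refine (setLIntegral_congr_fun measurableSet_Ioi fun t ht => ?_).le
    have ht0 : 0 < t := hT.trans ht
    simp only [zero_sub, norm_neg]
    rw [lintegral_const_mul _ (by fun_prop)]
    have := lintegral_gaussian ht0 (0 : Space n)
    simp only [sub_zero] at this
    rw [this, ← ENNReal.ofReal_mul (by positivity), Real.div_rpow Real.pi_pos.le ht0.le]
    congr 1
    have : t ^ ((s - n) / 2 - 1) = t ^ (s / 2 - 1) / t ^ (n / 2 : ℝ) := by
      rw [← Real.rpow_sub ht0]; congr 1; ring
    rw [this]; ring
  · refine (ae_restrict_iff' measurableSet_Ioi).2 (ae_of_all _ fun t ht => ?_)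
    have ht0 : 0 < t := hT.trans ht
    simp only [Pi.zero_apply]; positivity

lemma tailMass_ne_top (s : ℝ) (hs : 0 < s) (hsn : s < n) {T : ℝ} (hT : 0 < T) :
    tailMass n s T ≠ ⊤ := ((tailMass_le s hs hsn hT).trans_lt ENNReal.ofReal_lt_top).ne

lemma tendsto_tailMass (s : ℝ) (hs : 0 < s) (hsn : s < n) :
    Tendsto (tailMass n s) atTop (𝓝 0) := by
  have h1 : Tendsto (fun T : ℝ => T ^ ((s - n) / 2)) atTop (𝓝 0) := by
    have := tendsto_rpow_neg_atTop (y := (n - s) / 2) (by linarith)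
    refine this.congr fun T => ?_
    congr 1; ring
  have h2 : Tendsto (fun T : ℝ => ENNReal.ofReal ((Real.Gamma (s / 2))⁻¹ * Real.pi ^ (n / 2 : ℝ) *
      (T ^ ((s - n) / 2) / ((n - s) / 2)))) atTop (𝓝 0) := by
    have := ENNReal.tendsto_ofReal ((h1.div_const ((n - s) / 2)).const_mul
      ((Real.Gamma (s / 2))⁻¹ * Real.pi ^ (n / 2 : ℝ)))
    simpa using this
  refine tendsto_of_tendsto_of_tendsto_of_le_of_le' tendsto_const_nhds h2
    (Eventually.of_forall fun _ => zero_le) ?_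
  filter_upwards [eventually_gt_atTop 0] with T hT
  exact tailMass_le s hs hsn hT

/-! ### Potentials generated by measures with bounded density -/

lemma lintegral_tailKernel_le (s T : ℝ) (x : Space n) {μ : Measure (Space n)} {c : ℝ≥0∞}
    (hμ : μ ≤ c • volume) : ∫⁻ z, tailKernel s T x z ∂μ ≤ c * tailMass n s T := by
  calc ∫⁻ z, tailKernel s T x z ∂μ ≤ ∫⁻ z, tailKernel s T x z ∂(c • volume) :=
        lintegral_mono' hμ le_rfl
    _ = _ := by rw [lintegral_smul_measure, lintegral_tailKernel, smul_eq_mul]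

lemma generatedPotential_eq_trunc_add_tail [NeZero n] (s : ℝ) (hs : 0 < s) (T : ℝ)
    (μ : Measure (Space n)) (x : Space n) :
    generatedPotential s μ x = ∫⁻ z, truncKernel s T x z ∂μ + ∫⁻ z, tailKernel s T x z ∂μ := by
  unfold generatedPotential
  rw [← lintegral_add_left]
  · simp_rw [rieszKernel_eq_trunc_add_tail s hs T]
  · fun_prop

lemma lintegral_truncKernel_le (s T : ℝ) (μ : Measure (Space n)) (x : Space n) :
    ∫⁻ z, truncKernel s T x z ∂μ ≤ truncBound n s T * μ Set.univ :=
  (lintegral_mono fun z => truncKernel_le_bound s T x z).trans (by simp)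

/-- Split at `T = 1`: the long-range part is bounded by the total mass, the singular part by the
bound on the density. -/
lemma generatedPotential_le [NeZero n] (s : ℝ) (hs : 0 < s) {μ : Measure (Space n)} {c : ℝ≥0∞}
    (hμ : μ ≤ c • volume) (x : Space n) :
    generatedPotential s μ x ≤ truncBound n s 1 * μ Set.univ + c * tailMass n s 1 := by
  rw [generatedPotential_eq_trunc_add_tail s hs 1]
  exact add_le_add (lintegral_truncKernel_le s 1 μ x) (lintegral_tailKernel_le s 1 x hμ)

@[fun_prop] lemma measurable_generatedPotential (s : ℝ) (μ : Measure (Space n)) [SFinite μ] :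
    Measurable (generatedPotential s μ) :=
  (measurable_rieszKernel s).lintegral_prod_right'

lemma tendsto_rieszKernel_cocompact (s : ℝ) (hs : 0 < s) (z : Space n) :
    Tendsto (fun x => rieszKernel s x z) (cocompact (Space n)) (𝓝 0) := by
  have h1 : Tendsto (fun x : Space n => ‖z - x‖) (cocompact _) atTop :=
    (tendsto_norm_cocompact_atTop (E := Space n)).comp
      ((Homeomorph.subLeft z).isClosedEmbedding.tendsto_cocompact)
  have h2 := ENNReal.tendsto_ofReal ((tendsto_rpow_neg_atTop hs).comp h1)
  rw [ENNReal.ofReal_zero] at h2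
  refine h2.congr' ?_
  filter_upwards [h1.eventually_gt_atTop 0] with x hx
  simp only [Function.comp_apply]
  rw [rieszKernel, ← ofReal_norm, ENNReal.ofReal_rpow_of_pos hx]

/-- The truncated part vanishes at infinity by dominated convergence, with a constant bound
integrable against a finite measure; the tail is small uniformly in `x` by the density bound. -/
lemma tendsto_generatedPotential_cocompact [NeZero n] (s : ℝ) (hs : 0 < s) (hsn : s < n)
    {μ : Measure (Space n)} [IsFiniteMeasure μ] {c : ℝ≥0∞} (hc : c ≠ ⊤) (hμ : μ ≤ c • volume) :
    Tendsto (generatedPotential s μ) (cocompact (Space n)) (𝓝 0) := by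
  have htr : ∀ T, Tendsto (fun x => ∫⁻ z, truncKernel s T x z ∂μ) (cocompact (Space n)) (𝓝 0) := by
    intro T
    have : (cocompact (Space n)).IsCountablyGenerated := by
      rw [← Metric.cobounded_eq_cocompact, ← comap_norm_atTop]; infer_instance
    have := tendsto_lintegral_filter_of_dominated_convergence (μ := μ) (l := cocompact (Space n))
      (F := fun x z => truncKernel s T x z) (f := fun _ => 0) (fun _ => truncBound n s T)
      (Eventually.of_forall fun x => measurable_truncKernel_right s T x)
      (Eventually.of_forall fun x => ae_of_all _ fun z => truncKernel_le_bound s T x z)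
      (by simpa using ENNReal.mul_ne_top (truncBound_ne_top s hs T) (measure_ne_top μ _))
      (ae_of_all _ fun z => tendsto_of_tendsto_of_tendsto_of_le_of_le tendsto_const_nhds
        (tendsto_rieszKernel_cocompact s hs z) (fun _ => zero_le)
        (fun x => truncKernel_le s hs T x z))
    simpa using this
  rw [ENNReal.tendsto_nhds_zero]
  intro ε hε
  have h2 : Tendsto (fun T => c * tailMass n s T) atTop (𝓝 0) := by
    simpa using ENNReal.Tendsto.const_mul (tendsto_tailMass s hs hsn) (Or.inr hc)
  obtain ⟨T, hT⟩ := (ENNReal.tendsto_nhds_zero.1 h2 (ε / 2) (ENNReal.half_pos hε.ne')).exists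
  filter_upwards [ENNReal.tendsto_nhds_zero.1 (htr T) (ε / 2) (ENNReal.half_pos hε.ne')] with x hx
  rw [generatedPotential_eq_trunc_add_tail s hs T, ← ENNReal.add_halves ε]
  exact add_le_add hx ((lintegral_tailKernel_le s T x hμ).trans hT)

/-- An integral of squares of linear functionals of `μ`: this is the convexity of the interaction.
-/
lemma interactionEnergy_eq_lintegral_feature [NeZero n] (s : ℝ) (hs : 0 < s)
    (μ : Measure (Space n)) [SFinite μ] :
    interactionEnergy s μ = ∫⁻ p, (∫⁻ x, feature p x ∂μ) ^ 2 ∂(featureMeasure n s) := by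
  unfold interactionEnergy
  simp_rw [rieszKernel_eq_lintegral_feature s hs]
  calc ∫⁻ x, ∫⁻ z, ∫⁻ p, feature p x * feature p z ∂(featureMeasure n s) ∂μ ∂μ
      = ∫⁻ x, ∫⁻ p, feature p x * ∫⁻ z, feature p z ∂μ ∂(featureMeasure n s) ∂μ := by
        refine lintegral_congr fun x => ?_
        rw [lintegral_lintegral_swap (by fun_prop)]
        refine lintegral_congr fun p => ?_
        rw [lintegral_const_mul _ (by fun_prop)]
    _ = ∫⁻ p, ∫⁻ x, feature p x * ∫⁻ z, feature p z ∂μ ∂μ ∂(featureMeasure n s) := by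
        rw [lintegral_lintegral_swap]
        have : Measurable fun p : ℝ × Space n => ∫⁻ z, feature p z ∂μ :=
          measurable_feature.lintegral_prod_right'
        have h2 : Measurable fun q : Space n × (ℝ × Space n) => feature q.2 q.1 :=
          measurable_feature.comp measurable_swap
        exact (h2.mul (this.comp measurable_snd)).aemeasurable
    _ = _ := by
        refine lintegral_congr fun p => ?_
        rw [lintegral_mul_const _ (by fun_prop), sq]

/-! ### The reference measures -/

/-- The measure `e^{-|x|^α} dx`. -/
noncomputable def weightMeasure (n : ℕ) (α : ℝ) : Measure (Space n) :=
  (volume : Measure (Space n)).withDensity (fun x => expNeg (potential α x))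

lemma expNeg_potential (α : ℝ) (x : Space n) :
    expNeg (potential α x) = ENNReal.ofReal (Real.exp (-‖x‖ ^ α)) :=
  expNeg_ofReal (by positivity)

@[fun_prop] lemma measurable_potential (α : ℝ) : Measurable (potential (n := n) α) := by
  unfold potential; fun_prop

@[fun_prop] lemma measurable_expNeg_potential (α : ℝ) :
    Measurable (fun x : Space n => expNeg (potential α x)) :=
  measurable_expNeg.comp (measurable_potential α)

lemma weightMeasure_le (α : ℝ) : weightMeasure n α ≤ (1 : ℝ≥0∞) • volume := by
  rw [one_smul, weightMeasure]
  calc _ ≤ (volume : Measure (Space n)).withDensity 1 :=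
        withDensity_mono (ae_of_all _ fun x => expNeg_le_one _)
    _ = _ := withDensity_one

/-- Comparison with `(1 + ‖x‖)^{-(n+1)}`, since the exponential beats every power. -/
lemma integrable_exp_neg_norm_rpow {α : ℝ} (hα : 0 < α) :
    Integrable (fun x : Space n => Real.exp (-‖x‖ ^ α)) := by
  have h1 : Tendsto (fun t : ℝ => (1 + t) ^ ((n + 1 : ℕ) : ℝ) * Real.exp (-t ^ α)) atTop (𝓝 0) := by
    have h2 : Tendsto (fun u : ℝ => u ^ ((n + 1) / α) * Real.exp (-1 * u)) atTop (𝓝 0) :=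
      tendsto_rpow_mul_exp_neg_mul_atTop_nhds_zero _ _ one_pos
    have h3 := (h2.comp (tendsto_rpow_atTop hα)).const_mul ((2 : ℝ) ^ (n + 1 : ℕ))
    rw [mul_zero] at h3
    refine squeeze_zero' ?_ ?_ h3
    · filter_upwards [eventually_ge_atTop 0] with t ht; positivity
    · filter_upwards [eventually_ge_atTop 1] with t ht
      have ht0 : 0 ≤ t := by linarith
      simp only [Function.comp_apply]
      rw [← Real.rpow_mul ht0, neg_one_mul, ← mul_assoc, Real.rpow_natCast]
      gcongr
      have : α * ((n + 1) / α) = ((n + 1 : ℕ) : ℝ) := by push_cast; field_simp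
      rw [this, Real.rpow_natCast, ← mul_pow]
      gcongr; linarith
  have hcont : Continuous fun t : ℝ => (1 + |t|) ^ ((n + 1 : ℕ) : ℝ) * Real.exp (-|t| ^ α) := by
    refine Continuous.mul ?_ ?_
    · exact (Continuous.rpow_const (by fun_prop) fun _ => Or.inr (by positivity))
    · exact Real.continuous_exp.comp ((continuous_abs.rpow_const fun _ => Or.inr hα.le).neg)
  obtain ⟨R, hR⟩ := eventually_atTop.1 (h1.eventually_le_const one_pos)
  obtain ⟨C, hC⟩ := isCompact_Icc.exists_bound_of_continuousOn (s := Set.Icc 0 R) hcont.continuousOn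
  have hbound : ∀ t : ℝ, 0 ≤ t → (1 + t) ^ ((n + 1 : ℕ) : ℝ) * Real.exp (-t ^ α) ≤ max C 1 := by
    intro t ht
    rcases le_total t R with h | h
    · have := hC t ⟨ht, h⟩
      rw [abs_of_nonneg ht, Real.norm_of_nonneg (by positivity)] at this
      exact this.trans (le_max_left _ _)
    · exact (hR t h).trans (le_max_right _ _)
  refine ((integrable_one_add_norm (E := Space n) (μ := volume) (r := ((n + 1 : ℕ) : ℝ))
    (by simp)).const_mul (max C 1)).mono' ?_ (ae_of_all _ fun x => ?_)
  · exact (Continuous.aestronglyMeasurable (Real.continuous_exp.comp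
      ((continuous_norm.rpow_const fun _ => Or.inr hα.le).neg)))
  · have hx := hbound ‖x‖ (norm_nonneg x)
    have hp : 0 < (1 + ‖x‖) ^ ((n + 1 : ℕ) : ℝ) := by positivity
    rw [Real.norm_of_nonneg (Real.exp_nonneg _), Real.rpow_neg (by positivity), ← div_eq_mul_inv,
      le_div_iff₀ hp]
    linarith

lemma weightMeasure_univ (α : ℝ) :
    weightMeasure n α Set.univ = ∫⁻ x : Space n, expNeg (potential α x) := by
  simp [weightMeasure]

lemma weightMeasure_univ_ne_top {α : ℝ} (hα : 0 < α) : weightMeasure n α Set.univ ≠ ⊤ := by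
  rw [weightMeasure_univ]
  simp_rw [expNeg_potential]
  exact (integrable_exp_neg_norm_rpow hα).lintegral_lt_top.ne

lemma weightMeasure_univ_ne_zero (α : ℝ) : weightMeasure n α Set.univ ≠ 0 := by
  rw [weightMeasure_univ, Ne, lintegral_eq_zero_iff (by fun_prop)]
  intro h
  have : (∀ᵐ _ : Space n, False) := h.mono fun x hx =>
    (expNeg_pos (t := potential α x) ENNReal.ofReal_ne_top).ne' hx
  simp only [eventually_false_iff_eq_bot, ae_eq_bot] at this
  exact NeZero.ne _ this

lemma isFiniteMeasure_weightMeasure {α : ℝ} (hα : 0 < α) : IsFiniteMeasure (weightMeasure n α) :=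
  ⟨(weightMeasure_univ_ne_top hα).lt_top⟩

instance (α : ℝ) : SigmaFinite (weightMeasure n α) := by
  unfold weightMeasure
  exact SigmaFinite.withDensity_of_ne_top' fun x => expNeg_ne_top _

lemma referenceMeasure_eq (α : ℝ) :
    referenceMeasure n α = (weightMeasure n α Set.univ)⁻¹ • weightMeasure n α := by
  rw [referenceMeasure, weightMeasure_univ, weightMeasure]

lemma isProbabilityMeasure_referenceMeasure {α : ℝ} (hα : 0 < α) :
    IsProbabilityMeasure (referenceMeasure n α) := by
  constructor
  rw [referenceMeasure_eq, Measure.smul_apply, smul_eq_mul,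
    ENNReal.inv_mul_cancel (weightMeasure_univ_ne_zero α) (weightMeasure_univ_ne_top hα)]

lemma referenceMeasure_le (α : ℝ) :
    referenceMeasure n α ≤ (weightMeasure n α Set.univ)⁻¹ • volume := by
  rw [referenceMeasure_eq]
  have := weightMeasure_le (n := n) α
  rw [one_smul] at this
  gcongr

end Kernel

/-! ### Convexity of the free energy -/

section Equilibrium

open InformationTheory

/-- With `m = (a+b)/2`, the bound `log y ≤ y - 1` at `y = √(m/c)` gives `c log (c/m) ≥ 2(c - √(cm))`
for `c = a, b`. The sum of the two right sides is at least a multiple of `(√a - √b)²`. This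
quantitative gap makes the square roots of a minimising sequence Cauchy in `L²`. -/
lemma two_mul_klFun_midpoint_add_le {a b : ℝ} (ha : 0 ≤ a) (hb : 0 ≤ b) :
    2 * klFun ((a + b) / 2) + 1 / 2 * (√a - √b) ^ 2 ≤ klFun a + klFun b := by
  rcases (add_nonneg ha hb).eq_or_lt with h0 | h0
  · have ha0 : a = 0 := by linarith
    have hb0 : b = 0 := by linarith
    subst ha0 hb0
    simp [klFun_zero]; norm_num
  set m := (a + b) / 2 with hm
  have hm0 : 0 < m := by positivity
  have key : ∀ c : ℝ, 0 ≤ c → c * Real.log m + 2 * (c - √c * √m) ≤ c * Real.log c := by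
    intro c hc
    rcases hc.eq_or_lt with rfl | hc
    · simp
    have hq : 0 < √m / √c := by positivity
    have h1 := Real.log_le_sub_one_of_pos hq
    rw [Real.log_div (by positivity) (by positivity), Real.log_sqrt hm0.le, Real.log_sqrt hc.le] at h1
    have h2 : c * (√m / √c) = √c * √m := by
      rw [mul_div_assoc', div_eq_iff (by positivity)]
      linear_combination (-√m) * Real.mul_self_sqrt hc.le
    nlinarith
  have hka := key a ha
  have hkb := key b hb
  have hsm := Real.sq_sqrt hm0.le
  have hsa := Real.sq_sqrt ha
  have hsb := Real.sq_sqrt hb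
  have hpm : 0 < √m := Real.sqrt_pos.2 hm0
  have hpa : 0 ≤ √a := Real.sqrt_nonneg a
  have hpb : 0 ≤ √b := Real.sqrt_nonneg b
  simp only [klFun_apply]
  have hsum : a + b = 2 * m := by rw [hm]; ring
  -- `a + b - √m (√a + √b) ≥ (√a - √b)² / 4`
  have h4 : √a + √b ≤ 2 * √m := by
    apply abs_le_of_sq_le_sq' _ (by positivity) |>.2
    nlinarith [sq_nonneg (√a - √b)]
  have h5 : (2 * √m - (√a + √b)) * (2 * √m + (√a + √b)) = (√a - √b) ^ 2 := by
    nlinarith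
  have h6 : (√a - √b) ^ 2 ≤ (2 * √m - (√a + √b)) * (4 * √m) := by
    rw [← h5]
    exact mul_le_mul_of_nonneg_left (by linarith) (by linarith)
  have h7 : a * Real.log m + b * Real.log m = 2 * (m * Real.log m) := by
    rw [← add_mul, hsum]; ring
  have h8 : (2 * √m - (√a + √b)) * (4 * √m) = 8 * m - 4 * (√a * √m) - 4 * (√b * √m) := by
    linear_combination 8 * hsm
  linarith

lemma ENNReal.two_mul_sq_half_add_le (a b : ℝ≥0∞) :
    2 * (2⁻¹ * a + 2⁻¹ * b) ^ 2 ≤ a ^ 2 + b ^ 2 := by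
  rcases eq_or_ne a ⊤ with rfl | ha
  · simp
  rcases eq_or_ne b ⊤ with rfl | hb
  · simp
  lift a to ℝ≥0 using ha
  lift b to ℝ≥0 using hb
  have h : (2⁻¹ : ℝ≥0∞) = ((2⁻¹ : ℝ≥0) : ℝ≥0∞) := by simp
  rw [h]
  norm_cast
  rw [← NNReal.coe_le_coe]
  push_cast
  nlinarith [sq_nonneg ((a : ℝ) - b)]

variable {n : ℕ}

/-- The measure with density `f` with respect to `ν`. -/
noncomputable def densMeasure (ν : Measure (Space n)) (f : Space n → ℝ) : Measure (Space n) :=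
  ν.withDensity fun x => ENNReal.ofReal (f x)

/-- The free energy as a function of the density with respect to the reference measure `ν`. -/
noncomputable def densEnergy (s γ : ℝ) (ν : Measure (Space n)) (f : Space n → ℝ) : ℝ≥0∞ :=
  ENNReal.ofReal (γ / 2) * interactionEnergy s (densMeasure ν f)
    + ∫⁻ x, ENNReal.ofReal (klFun (f x)) ∂ν

/-- Probability densities with respect to `ν`. -/
structure IsDensity (ν : Measure (Space n)) (f : Space n → ℝ) : Prop where
  measurable : Measurable f
  nonneg : ∀ x, 0 ≤ f x
  lintegral_eq : ∫⁻ x, ENNReal.ofReal (f x) ∂ν = 1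

instance (ν : Measure (Space n)) [SFinite ν] (f : Space n → ℝ) : SFinite (densMeasure ν f) := by
  unfold densMeasure; infer_instance

lemma IsDensity.isProbabilityMeasure {ν : Measure (Space n)} {f : Space n → ℝ}
    (hf : IsDensity ν f) : IsProbabilityMeasure (densMeasure ν f) :=
  ⟨by rw [densMeasure, withDensity_apply _ .univ, Measure.restrict_univ, hf.lintegral_eq]⟩

lemma densMeasure_combination (ν : Measure (Space n)) {f h : Space n → ℝ} (hf : IsDensity ν f)
    (hh : IsDensity ν h) {a b : ℝ} (ha : 0 ≤ a) (hb : 0 ≤ b) :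
    densMeasure ν (fun x => a * f x + b * h x)
      = ENNReal.ofReal a • densMeasure ν f + ENNReal.ofReal b • densMeasure ν h := by
  have := hf.measurable
  have := hh.measurable
  unfold densMeasure
  rw [← withDensity_smul _ (by fun_prop), ← withDensity_smul _ (by fun_prop),
    ← withDensity_add_left (by fun_prop)]
  congr 1
  ext x
  have := hf.nonneg x
  have := hh.nonneg x
  simp only [Pi.add_apply, Pi.smul_apply, smul_eq_mul]
  rw [ENNReal.ofReal_add (by positivity) (by positivity), ENNReal.ofReal_mul ha,
    ENNReal.ofReal_mul hb]

lemma IsDensity.combination {ν : Measure (Space n)} {f h : Space n → ℝ} (hf : IsDensity ν f)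
    (hh : IsDensity ν h) {a b : ℝ} (ha : 0 ≤ a) (hb : 0 ≤ b) (hab : a + b = 1) :
    IsDensity ν (fun x => a * f x + b * h x) := by
  refine ⟨(hf.measurable.const_mul a).add (hh.measurable.const_mul b), fun x => ?_, ?_⟩
  · have := hf.nonneg x
    have := hh.nonneg x
    positivity
  · have h1 := hf.isProbabilityMeasure
    have h2 := hh.isProbabilityMeasure
    have := densMeasure_combination ν hf hh ha hb
    have h3 := congrArg (fun m => m Set.univ) this
    simp only [Measure.coe_add, Measure.coe_smul, Pi.add_apply, Pi.smul_apply, measure_univ,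
      smul_eq_mul, mul_one, ← ENNReal.ofReal_add ha hb, hab, ENNReal.ofReal_one] at h3
    rw [← h3, densMeasure, withDensity_apply _ .univ, Measure.restrict_univ]

/-- The mean feature is affine in the density, so the interaction is midpoint convex; the Hellinger
gain comes from the entropy alone. -/
lemma densEnergy_midpoint [NeZero n] {s : ℝ} (hs : 0 < s) (γ : ℝ) (ν : Measure (Space n))
    [SFinite ν] {f h : Space n → ℝ} (hf : IsDensity ν f) (hh : IsDensity ν h) :
    2 * densEnergy s γ ν (fun x => 1 / 2 * f x + 1 / 2 * h x)
      + 2⁻¹ * ∫⁻ x, ENNReal.ofReal ((√(f x) - √(h x)) ^ 2) ∂ν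
      ≤ densEnergy s γ ν f + densEnergy s γ ν h := by
  have hfm := hf.measurable
  have hhm := hh.measurable
  have hk := measurable_klFun
  have hI : 2 * interactionEnergy s (densMeasure ν (fun x => 1 / 2 * f x + 1 / 2 * h x))
      ≤ interactionEnergy s (densMeasure ν f) + interactionEnergy s (densMeasure ν h) := by
    have hm : ∀ k, Measurable fun p => ∫⁻ x, feature p x ∂(densMeasure ν k) := fun k =>
      measurable_feature.lintegral_prod_right'
    rw [interactionEnergy_eq_lintegral_feature s hs, interactionEnergy_eq_lintegral_feature s hs,
      interactionEnergy_eq_lintegral_feature s hs, ← lintegral_const_mul _ ((hm _).pow_const 2),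
      ← lintegral_add_left ((hm _).pow_const 2)]
    refine lintegral_mono fun p => ?_
    rw [densMeasure_combination ν hf hh (by norm_num) (by norm_num), lintegral_add_measure,
      lintegral_smul_measure, lintegral_smul_measure]
    have : ENNReal.ofReal (1 / 2) = 2⁻¹ := by
      rw [one_div, ENNReal.ofReal_inv_of_pos (by norm_num)]; simp
    rw [this]
    exact ENNReal.two_mul_sq_half_add_le _ _
  have hE : 2 * ∫⁻ x, ENNReal.ofReal (klFun (1 / 2 * f x + 1 / 2 * h x)) ∂ν
      + 2⁻¹ * ∫⁻ x, ENNReal.ofReal ((√(f x) - √(h x)) ^ 2) ∂ν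
      ≤ ∫⁻ x, ENNReal.ofReal (klFun (f x)) ∂ν + ∫⁻ x, ENNReal.ofReal (klFun (h x)) ∂ν := by
    rw [← lintegral_const_mul _ (by fun_prop), ← lintegral_const_mul _ (by fun_prop),
      ← lintegral_add_left (by fun_prop), ← lintegral_add_left (by fun_prop)]
    refine lintegral_mono fun x => ?_
    have h1 := hf.nonneg x
    have h2 := hh.nonneg x
    have h3 : 0 ≤ klFun (1 / 2 * f x + 1 / 2 * h x) := klFun_nonneg (by positivity)
    have e1 : (2 : ℝ≥0∞) = ENNReal.ofReal 2 := by simp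
    have e2 : (2⁻¹ : ℝ≥0∞) = ENNReal.ofReal (1 / 2) := by
      rw [one_div, ENNReal.ofReal_inv_of_pos (by norm_num)]; simp
    rw [e2, e1, ← ENNReal.ofReal_mul (by norm_num), ← ENNReal.ofReal_mul (by norm_num),
      ← ENNReal.ofReal_add (by positivity) (by positivity),
      ← ENNReal.ofReal_add (klFun_nonneg h1) (klFun_nonneg h2)]
    refine ENNReal.ofReal_le_ofReal ?_
    have := two_mul_klFun_midpoint_add_le h1 h2
    rwa [show (f x + h x) / 2 = 1 / 2 * f x + 1 / 2 * h x by ring] at this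
  unfold densEnergy
  calc _ = ENNReal.ofReal (γ / 2) * (2 * interactionEnergy s (densMeasure ν
        (fun x => 1 / 2 * f x + 1 / 2 * h x)))
        + (2 * ∫⁻ x, ENNReal.ofReal (klFun (1 / 2 * f x + 1 / 2 * h x)) ∂ν
        + 2⁻¹ * ∫⁻ x, ENNReal.ofReal ((√(f x) - √(h x)) ^ 2) ∂ν) := by ring
    _ ≤ ENNReal.ofReal (γ / 2) * (interactionEnergy s (densMeasure ν f)
        + interactionEnergy s (densMeasure ν h))
        + (∫⁻ x, ENNReal.ofReal (klFun (f x)) ∂ν + ∫⁻ x, ENNReal.ofReal (klFun (h x)) ∂ν) := by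
        gcongr
    _ = _ := by ring

lemma interactionEnergy_densMeasure (s : ℝ) (ν : Measure (Space n)) [SFinite ν] {f : Space n → ℝ}
    (hf : Measurable f) :
    interactionEnergy s (densMeasure ν f)
      = ∫⁻ q, rieszKernel s q.1 q.2 * (ENNReal.ofReal (f q.1) * ENNReal.ofReal (f q.2))
        ∂(ν.prod ν) := by
  have hg := measurable_rieszKernel (n := n) s
  rw [lintegral_prod _ (by fun_prop)]
  change ∫⁻ x, generatedPotential s (densMeasure ν f) x ∂(ν.withDensity _) = _
  rw [lintegral_withDensity_eq_lintegral_mul _ (by fun_prop)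
      (measurable_generatedPotential s (densMeasure ν f))]
  refine lintegral_congr fun x => ?_
  have hgx : Measurable fun z => rieszKernel s x z :=
    Measurable.of_uncurry_left (f := fun x z => rieszKernel s x z) hg
  rw [Pi.mul_apply, generatedPotential, densMeasure, lintegral_withDensity_eq_lintegral_mul _ (by fun_prop) hgx,
    ← lintegral_const_mul _ (by fun_prop)]
  refine lintegral_congr fun z => ?_
  simp only [Pi.mul_apply]; ring

/-- The free energy is lower semicontinuous along almost everywhere convergent densities. -/
lemma densEnergy_le_liminf (s γ : ℝ) (ν : Measure (Space n)) [IsProbabilityMeasure ν]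
    {f : ℕ → Space n → ℝ} {f₀ : Space n → ℝ} (hf : ∀ k, Measurable (f k)) (hf₀ : Measurable f₀)
    (h : ∀ᵐ x ∂ν, Tendsto (fun k => f k x) atTop (𝓝 (f₀ x))) :
    densEnergy s γ ν f₀ ≤ liminf (fun k => densEnergy s γ ν (f k)) atTop := by
  have hg := measurable_rieszKernel (n := n) s
  have hk := measurable_klFun
  have key : ∀ f : Space n → ℝ, Measurable f → densEnergy s γ ν f = ∫⁻ q,
      (ENNReal.ofReal (γ / 2) * (rieszKernel s q.1 q.2 *
        (ENNReal.ofReal (f q.1) * ENNReal.ofReal (f q.2))) + ENNReal.ofReal (klFun (f q.1)))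
        ∂(ν.prod ν) := by
    intro f hf
    rw [lintegral_add_right _ (by fun_prop), lintegral_const_mul _ (by fun_prop), densEnergy,
      interactionEnergy_densMeasure s ν hf]
    congr 1
    rw [lintegral_prod _ (by fun_prop)]
    simp
  simp_rw [key _ (hf _)]
  rw [key _ hf₀]
  refine le_trans ?_ (lintegral_liminf_le fun k => ?_)
  · refine lintegral_mono_ae ?_
    filter_upwards [Measure.quasiMeasurePreserving_fst.ae h,
      Measure.quasiMeasurePreserving_snd.ae h] with q h1 h2
    have hkl : Tendsto (fun k => ENNReal.ofReal (klFun (f k q.1))) atTop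
        (𝓝 (ENNReal.ofReal (klFun (f₀ q.1)))) :=
      ENNReal.tendsto_ofReal ((continuous_klFun.tendsto _).comp h1)
    have hprod : Tendsto (fun k => ENNReal.ofReal (f k q.1) * ENNReal.ofReal (f k q.2)) atTop
        (𝓝 (ENNReal.ofReal (f₀ q.1) * ENNReal.ofReal (f₀ q.2))) :=
      ENNReal.Tendsto.mul (ENNReal.tendsto_ofReal h1) (Or.inr ENNReal.ofReal_ne_top)
        (ENNReal.tendsto_ofReal h2) (Or.inr ENNReal.ofReal_ne_top)
    -- The kernel may be infinite. If the limiting product of densities is zero, the convention `0 ·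
    -- ∞ = 0` leaves only the entropy and the interaction along the sequence is dropped; otherwise
    -- multiplication by the kernel is continuous at the limit.
    by_cases h0 : ENNReal.ofReal (f₀ q.1) * ENNReal.ofReal (f₀ q.2) = 0
    · rw [h0, mul_zero, mul_zero, zero_add, ← hkl.liminf_eq]
      exact liminf_le_liminf (Eventually.of_forall fun k => le_add_self)
    · refine (Tendsto.liminf_eq ?_).ge
      exact ((ENNReal.Tendsto.const_mul (ENNReal.Tendsto.const_mul hprod (Or.inl h0))
        (Or.inr ENNReal.ofReal_ne_top))).add hkl
  · have := hf k
    fun_prop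

end Equilibrium

/-! ### Existence and uniqueness of the minimising density. -/

section Minimizer

open InformationTheory

variable {n : ℕ}

lemma eLpNorm_two_pow_two (ν : Measure (Space n)) (f : Space n → ℝ) :
    eLpNorm f 2 ν ^ 2 = ∫⁻ x, ENNReal.ofReal (f x ^ 2) ∂ν := by
  have h := eLpNorm_nnreal_pow_eq_lintegral (f := f) (μ := ν) (p := 2) (by norm_num)
  simp only [NNReal.coe_ofNat, ENNReal.rpow_ofNat, ENNReal.coe_ofNat] at h
  rw [h]
  refine lintegral_congr fun x => ?_
  rw [Real.enorm_eq_ofReal_abs, ← ENNReal.ofReal_pow (abs_nonneg _), sq_abs]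

lemma IsDensity.eLpNorm_sqrt {ν : Measure (Space n)} {f : Space n → ℝ} (hf : IsDensity ν f) :
    eLpNorm (fun x => √(f x)) 2 ν = 1 := by
  have h := eLpNorm_two_pow_two ν (fun x => √(f x))
  simp_rw [Real.sq_sqrt (hf.nonneg _)] at h
  rw [hf.lintegral_eq] at h
  exact (ENNReal.pow_right_strictMono two_ne_zero).injective (by simpa using h)

/-- Near-minimisers are close in Hellinger distance by `densEnergy_midpoint`, so their square roots
converge in `L²(ν)` and, at a geometric rate, almost everywhere without passing to a subsequence.
The `L²` limit keeps norm one, so no mass is lost, and lower semicontinuity along the a.e. limit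
concludes. -/
lemma exists_minimizer [NeZero n] {s : ℝ} (hs : 0 < s) (γ : ℝ) (ν : Measure (Space n))
    [IsProbabilityMeasure ν] (hν : interactionEnergy s ν ≠ ⊤) :
    ∃ f, IsDensity ν f ∧ densEnergy s γ ν f ≠ ⊤ ∧
      ∀ h, IsDensity ν h → densEnergy s γ ν f ≤ densEnergy s γ ν h := by
  set m : ℝ≥0∞ := ⨅ f : {f // IsDensity ν f}, densEnergy s γ ν f with hm
  have hone : IsDensity ν (fun _ => 1) := ⟨measurable_const, fun _ => zero_le_one, by simp⟩
  have hle : ∀ h, IsDensity ν h → m ≤ densEnergy s γ ν h := fun h hh =>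
    iInf_le (fun f : {f // IsDensity ν f} => densEnergy s γ ν f) ⟨h, hh⟩
  have hmtop : m ≠ ⊤ := by
    refine ((hle _ hone).trans_lt ?_).ne
    simp only [densEnergy, densMeasure, klFun_one, ENNReal.ofReal_zero, ENNReal.ofReal_one,
      lintegral_zero, add_zero]
    rw [show (fun _ : Space n => (1 : ℝ≥0∞)) = 1 from rfl, withDensity_one]
    exact ENNReal.mul_lt_top ENNReal.ofReal_lt_top hν.lt_top
  -- Two competitors with excess at most `2^{-(2N+3)}` have squared distance at most four times
  -- this, `2^{-(2N+1)}`, which is below `(2^{-N})²`.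
  have hex : ∀ k : ℕ, ∃ f, IsDensity ν f ∧ densEnergy s γ ν f ≤ m + 2⁻¹ ^ (2 * k + 3) := by
    intro k
    have : m < m + 2⁻¹ ^ (2 * k + 3) := ENNReal.lt_add_right hmtop (by simp)
    obtain ⟨⟨f, hf⟩, h⟩ := iInf_lt_iff.1 this
    exact ⟨f, hf, h.le⟩
  choose f hf hfm using hex
  have hsq : ∀ k, Measurable fun x => √(f k x) := fun k => (hf k).measurable.sqrt
  have hL : ∀ k, MemLp (fun x => √(f k x)) 2 ν := fun k =>
    ⟨(hsq k).aestronglyMeasurable, by simp [(hf k).eLpNorm_sqrt]⟩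
  have hB : ∑' k : ℕ, (2⁻¹ : ℝ≥0∞) ^ k ≠ ⊤ := by
    rw [ENNReal.tsum_geometric]; simp
  have hcau : ∀ N k l : ℕ, N ≤ k → N ≤ l →
      eLpNorm ((fun x => √(f k x)) - fun x => √(f l x)) 2 ν < 2⁻¹ ^ N := by
    intro N k l hk hl
    have hmono : ∀ j, N ≤ j → densEnergy s γ ν (f j) ≤ m + 2⁻¹ ^ (2 * N + 3) := fun j hj =>
      (hfm j).trans (add_le_add le_rfl (pow_le_pow_right_of_le_one' (by simp) (by omega)))
    have h1 := densEnergy_midpoint hs γ ν (hf k) (hf l)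
    have h2 := hle _ ((hf k).combination (hf l) (a := 1 / 2) (b := 1 / 2) (by norm_num)
      (by norm_num) (by norm_num))
    set D := ∫⁻ x, ENNReal.ofReal ((√(f k x) - √(f l x)) ^ 2) ∂ν with hD
    have h3 : 2 * m + 2⁻¹ * D ≤ 2 * m + 2 * 2⁻¹ ^ (2 * N + 3) :=
      calc 2 * m + 2⁻¹ * D ≤ _ := add_le_add (mul_le_mul_right h2 2) le_rfl
        _ ≤ _ := h1
        _ ≤ (m + 2⁻¹ ^ (2 * N + 3)) + (m + 2⁻¹ ^ (2 * N + 3)) := add_le_add (hmono k hk) (hmono l hl)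
        _ = _ := by ring
    have h4 : 2⁻¹ * D ≤ 2 * 2⁻¹ ^ (2 * N + 3) :=
      (ENNReal.add_le_add_iff_left (ENNReal.mul_ne_top (by simp) hmtop)).1 h3
    have h22 : (2 : ℝ≥0∞) * 2⁻¹ = 1 := ENNReal.mul_inv_cancel (by simp) (by simp)
    have h5 : D ≤ 2⁻¹ ^ (2 * N + 1) := by
      calc D = 2 * (2⁻¹ * D) := by rw [← mul_assoc, h22, one_mul]
        _ ≤ 2 * (2 * 2⁻¹ ^ (2 * N + 3)) := mul_le_mul_right h4 2
        _ = (2 * 2⁻¹) * (2 * 2⁻¹) * 2⁻¹ ^ (2 * N + 1) := by ring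
        _ = _ := by rw [h22]; simp
    have h6 : eLpNorm ((fun x => √(f k x)) - fun x => √(f l x)) 2 ν ^ 2 < (2⁻¹ ^ N) ^ 2 := by
      rw [eLpNorm_two_pow_two]
      refine lt_of_le_of_lt h5 ?_
      rw [← pow_mul, mul_comm N 2, pow_succ]
      conv_rhs => rw [← mul_one (2⁻¹ ^ (2 * N))]
      exact ENNReal.mul_lt_mul_right (by simp) (by simp) (by simp)
    exact lt_of_pow_lt_pow_left' 2 h6
  have hae := Lp.ae_tendsto_of_cauchy_eLpNorm (fun k => (hL k).1) (by norm_num) hB hcau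
  obtain ⟨r, hr, hlim⟩ := exists_stronglyMeasurable_limit_of_tendsto_ae (fun k => (hL k).1) hae
  have hLp := Lp.cauchy_tendsto_of_tendsto (fun k => (hL k).1) r hB hcau hlim
  have hnorm : eLpNorm r 2 ν = 1 := by
    apply le_antisymm
    · have : ∀ k, eLpNorm r 2 ν ≤ eLpNorm ((fun x => √(f k x)) - r) 2 ν + 1 := by
        intro k
        calc eLpNorm r 2 ν = eLpNorm ((fun x => √(f k x)) - ((fun x => √(f k x)) - r)) 2 ν := by
              rw [sub_sub_cancel]
          _ ≤ _ := eLpNorm_sub_le (hL k).1 ((hL k).1.sub hr.aestronglyMeasurable) (by norm_num)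
          _ = _ := by rw [(hf k).eLpNorm_sqrt, add_comm]
      simpa using ge_of_tendsto' (hLp.add_const 1) this
    · have : ∀ k, 1 ≤ eLpNorm ((fun x => √(f k x)) - r) 2 ν + eLpNorm r 2 ν := by
        intro k
        rw [← (hf k).eLpNorm_sqrt]
        conv_lhs => rw [show (fun x => √(f k x)) = ((fun x => √(f k x)) - r) + r by simp]
        exact eLpNorm_add_le ((hL k).1.sub hr.aestronglyMeasurable) hr.aestronglyMeasurable
          (by norm_num)
      simpa using ge_of_tendsto' (hLp.add_const (eLpNorm r 2 ν)) this
  have hdens : IsDensity ν (fun x => r x ^ 2) :=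
    ⟨hr.measurable.pow_const 2, fun x => sq_nonneg _, by
      rw [← eLpNorm_two_pow_two, hnorm, one_pow]⟩
  have hlim2 : ∀ᵐ x ∂ν, Tendsto (fun k => f k x) atTop (𝓝 (r x ^ 2)) := by
    filter_upwards [hlim] with x hx
    refine (hx.pow 2).congr fun k => Real.sq_sqrt ((hf k).nonneg x)
  have hfin : densEnergy s γ ν (fun x => r x ^ 2) ≤ m := by
    refine (densEnergy_le_liminf s γ ν (fun k => (hf k).measurable) hdens.measurable hlim2).trans ?_
    have h1 : Tendsto (fun k : ℕ => m + (2⁻¹ : ℝ≥0∞) ^ (2 * k + 3)) atTop (𝓝 (m + 0)) := by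
      refine tendsto_const_nhds.add ?_
      refine (ENNReal.tendsto_pow_atTop_nhds_zero_of_lt_one (r := 2⁻¹) (by simp)).comp ?_
      exact tendsto_atTop_mono (fun k => show k ≤ 2 * k + 3 by omega) tendsto_id
    rw [add_zero] at h1
    rw [← h1.liminf_eq]
    exact liminf_le_liminf (Eventually.of_forall hfm)
  exact ⟨_, hdens, (hfin.trans_lt hmtop.lt_top).ne, fun h hh => hfin.trans (hle h hh)⟩

/-- The midpoint of two minimisers cannot have smaller energy, so the Hellinger gap is zero;
finiteness of the energy allows it to be cancelled. -/
lemma IsDensity.ae_eq_of_minimizer [NeZero n] {s : ℝ} (hs : 0 < s) (γ : ℝ) (ν : Measure (Space n))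
    [IsProbabilityMeasure ν] {f h : Space n → ℝ} (hf : IsDensity ν f) (hh : IsDensity ν h)
    (hfin : densEnergy s γ ν f ≠ ⊤)
    (hmin : ∀ k, IsDensity ν k → densEnergy s γ ν f ≤ densEnergy s γ ν k)
    (hle : densEnergy s γ ν h ≤ densEnergy s γ ν f) : f =ᵐ[ν] h := by
  have h1 := densEnergy_midpoint hs γ ν hf hh
  have h2 := hmin _ (hf.combination hh (a := 1 / 2) (b := 1 / 2) (by norm_num)
      (by norm_num) (by norm_num))
  have h3 : 2 * densEnergy s γ ν f + 2⁻¹ * ∫⁻ x, ENNReal.ofReal ((√(f x) - √(h x)) ^ 2) ∂ν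
      ≤ 2 * densEnergy s γ ν f + 0 :=
    calc _ ≤ _ := add_le_add (mul_le_mul_right h2 2) le_rfl
      _ ≤ _ := h1
      _ ≤ densEnergy s γ ν f + densEnergy s γ ν f := add_le_add le_rfl hle
      _ = _ := by ring
  have h4 := (ENNReal.add_le_add_iff_left (ENNReal.mul_ne_top (by simp) hfin)).1 h3
  have h5 : ∫⁻ x, ENNReal.ofReal ((√(f x) - √(h x)) ^ 2) ∂ν = 0 := by simpa using h4
  have := hf.measurable
  have := hh.measurable
  rw [lintegral_eq_zero_iff (by fun_prop)] at h5
  filter_upwards [h5] with x hx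
  have hx' : (√(f x) - √(h x)) ^ 2 ≤ 0 := ENNReal.ofReal_eq_zero.1 hx
  have h6 : √(f x) = √(h x) :=
    sub_eq_zero.1 (pow_eq_zero_iff two_ne_zero |>.1 (le_antisymm hx' (sq_nonneg _)))
  exact (Real.sqrt_inj (hf.nonneg x) (hh.nonneg x)).1 h6

end Minimizer

/-! ### The self-consistent equation. -/

section EulerLagrange

open InformationTheory

variable {n : ℕ}

/-- The mutual energy `∬ g(x, z) μ(dz) ν(dx)`. -/
noncomputable def mutualEnergy (s : ℝ) (μ ν : Measure (Space n)) : ℝ≥0∞ :=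
  ∫⁻ x, generatedPotential s μ x ∂ν

lemma mutualEnergy_self (s : ℝ) (μ : Measure (Space n)) :
    mutualEnergy s μ μ = interactionEnergy s μ := rfl

lemma mutualEnergy_comm (s : ℝ) (μ ν : Measure (Space n)) [SFinite μ] [SFinite ν] :
    mutualEnergy s μ ν = mutualEnergy s ν μ := by
  unfold mutualEnergy generatedPotential
  rw [lintegral_lintegral_swap (measurable_rieszKernel s).aemeasurable]
  simp_rw [rieszKernel_comm s]

lemma interactionEnergy_combination (s : ℝ) (μ ν : Measure (Space n)) [SFinite μ] [SFinite ν]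
    (a b : ℝ≥0∞) :
    interactionEnergy s (a • μ + b • ν) = a ^ 2 * interactionEnergy s μ
      + 2 * a * b * mutualEnergy s μ ν + b ^ 2 * interactionEnergy s ν := by
  have h1 := measurable_generatedPotential (n := n) s μ
  have h2 := measurable_generatedPotential (n := n) s ν
  have h : ∀ x, generatedPotential s (a • μ + b • ν) x
      = a * generatedPotential s μ x + b * generatedPotential s ν x := fun x => by
    simp [generatedPotential, lintegral_add_measure, lintegral_smul_measure]
  rw [← mutualEnergy_self, mutualEnergy]
  simp_rw [h]
  rw [lintegral_add_measure, lintegral_smul_measure, lintegral_smul_measure,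
    lintegral_add_left (by fun_prop), lintegral_add_left (by fun_prop),
    lintegral_const_mul _ h1, lintegral_const_mul _ h2, lintegral_const_mul _ h1,
    lintegral_const_mul _ h2]
  change a • (a * mutualEnergy s μ μ + b * mutualEnergy s ν μ)
    + b • (a * mutualEnergy s μ ν + b * mutualEnergy s ν ν) = _
  rw [mutualEnergy_comm s ν μ, mutualEnergy_self, mutualEnergy_self, smul_eq_mul, smul_eq_mul]
  ring

lemma nonpos_of_forall_le_mul {X Y : ℝ} (h : ∀ t : ℝ, 0 < t → t < 1 → X ≤ t * Y) : X ≤ 0 := by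
  have h1 : Tendsto (fun t : ℝ => t * Y) (𝓝[>] 0) (𝓝 0) := by
    have : Tendsto (fun t : ℝ => t * Y) (𝓝 0) (𝓝 (0 * Y)) := tendsto_id.mul_const Y
    rw [zero_mul] at this
    exact this.mono_left nhdsWithin_le_nhds
  refine ge_of_tendsto h1 ?_
  filter_upwards [Ioo_mem_nhdsGT (zero_lt_one' ℝ)] with t ht using h t ht.1 ht.2

/-- First-order optimality of a minimiser of the free energy. -/
lemma optimality_of_minimizer {s γ : ℝ} (ν : Measure (Space n))
    [IsProbabilityMeasure ν] {f h : Space n → ℝ} (hf : IsDensity ν f) (hh : IsDensity ν h)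
    (hfin : densEnergy s γ ν f ≠ ⊤) (hhfin : densEnergy s γ ν h ≠ ⊤)
    (hmut : mutualEnergy s (densMeasure ν f) (densMeasure ν h) ≠ ⊤)
    (hmin : ∀ k, IsDensity ν k → densEnergy s γ ν f ≤ densEnergy s γ ν k) :
    (ENNReal.ofReal γ * interactionEnergy s (densMeasure ν f)).toReal
        + (∫⁻ x, ENNReal.ofReal (klFun (f x)) ∂ν).toReal
      ≤ (ENNReal.ofReal γ * mutualEnergy s (densMeasure ν f) (densMeasure ν h)).toReal
        + (∫⁻ x, ENNReal.ofReal (klFun (h x)) ∂ν).toReal := by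
  have hfm := hf.measurable
  have hhm := hh.measurable
  have hk := measurable_klFun
  set κ := ENNReal.ofReal (γ / 2) with hκ
  set A := interactionEnergy s (densMeasure ν f)
  set B := mutualEnergy s (densMeasure ν f) (densMeasure ν h)
  set C := interactionEnergy s (densMeasure ν h)
  set Hf := ∫⁻ x, ENNReal.ofReal (klFun (f x)) ∂ν
  set Hh := ∫⁻ x, ENNReal.ofReal (klFun (h x)) ∂ν
  have hA : κ * A ≠ ⊤ := fun h => hfin (by simp [densEnergy, A, κ] at h ⊢; tauto)
  have hC : κ * C ≠ ⊤ := fun h => hhfin (by simp [densEnergy, C, κ] at h ⊢; tauto)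
  have hB : κ * B ≠ ⊤ := ENNReal.mul_ne_top ENNReal.ofReal_ne_top hmut
  have hHf : Hf ≠ ⊤ := fun h => hfin (by simp [densEnergy, Hf] at h ⊢; tauto)
  have hHh : Hh ≠ ⊤ := fun h => hhfin (by simp [densEnergy, Hh] at h ⊢; tauto)
  have h2κ : ENNReal.ofReal γ = 2 * κ := by
    rw [hκ, ← ENNReal.ofReal_ofNat 2, ← ENNReal.ofReal_mul (by norm_num)]; congr 1; ring
  -- Along `(1-t) f + t h` the interaction is quadratic in `t` and the entropy lies below its chord.
  -- Dividing by `t` and letting `t → 0` retains the linear part of the interaction against the full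
  -- difference of entropies, which is the form needed for a Bregman divergence.
  have key : ∀ t : ℝ, 0 < t → t < 1 →
      2 * (κ * A).toReal + Hf.toReal - 2 * (κ * B).toReal - Hh.toReal
        ≤ t * ((κ * A).toReal - 2 * (κ * B).toReal + (κ * C).toReal) := by
    intro t ht0 ht1
    have h1t : 0 ≤ 1 - t := by linarith
    have hcomb := hf.combination hh h1t ht0.le (by ring)
    have h1 := hmin _ hcomb
    have hent : ∫⁻ x, ENNReal.ofReal (klFun ((1 - t) * f x + t * h x)) ∂ν
        ≤ ENNReal.ofReal (1 - t) * Hf + ENNReal.ofReal t * Hh := by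
      rw [← lintegral_const_mul _ (by fun_prop), ← lintegral_const_mul _ (by fun_prop),
        ← lintegral_add_left (by fun_prop)]
      refine lintegral_mono fun x => ?_
      have hc := convexOn_klFun.2 (hf.nonneg x) (hh.nonneg x) h1t ht0.le (by ring)
      have p1 := klFun_nonneg (hf.nonneg x)
      have p2 := klFun_nonneg (hh.nonneg x)
      rw [← ENNReal.ofReal_mul h1t, ← ENNReal.ofReal_mul ht0.le,
        ← ENNReal.ofReal_add (by positivity) (by positivity)]
      exact ENNReal.ofReal_le_ofReal (by simpa using hc)
    have h2 : κ * A + Hf ≤ ENNReal.ofReal (1 - t) ^ 2 * (κ * A)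
        + 2 * ENNReal.ofReal (1 - t) * ENNReal.ofReal t * (κ * B) + ENNReal.ofReal t ^ 2 * (κ * C)
        + (ENNReal.ofReal (1 - t) * Hf + ENNReal.ofReal t * Hh) := by
      calc κ * A + Hf ≤ _ := h1
        _ ≤ κ * (ENNReal.ofReal (1 - t) ^ 2 * A + 2 * ENNReal.ofReal (1 - t) * ENNReal.ofReal t * B
            + ENNReal.ofReal t ^ 2 * C) + (ENNReal.ofReal (1 - t) * Hf + ENNReal.ofReal t * Hh) := by
          rw [densEnergy, densMeasure_combination ν hf hh h1t ht0.le,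
            interactionEnergy_combination]
          gcongr
        _ = _ := by ring
    rw [← ENNReal.ofReal_toReal hA, ← ENNReal.ofReal_toReal hB, ← ENNReal.ofReal_toReal hC,
      ← ENNReal.ofReal_toReal hHf, ← ENNReal.ofReal_toReal hHh] at h2
    have a0 := ENNReal.toReal_nonneg (a := κ * A)
    have b0 := ENNReal.toReal_nonneg (a := κ * B)
    have c0 := ENNReal.toReal_nonneg (a := κ * C)
    have f0 := ENNReal.toReal_nonneg (a := Hf)
    have k0 := ENNReal.toReal_nonneg (a := Hh)
    generalize (κ * A).toReal = a at *
    generalize (κ * B).toReal = b at *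
    generalize (κ * C).toReal = c at *
    generalize Hf.toReal = p at *
    generalize Hh.toReal = q at *
    rw [← ENNReal.ofReal_ofNat 2, ← ENNReal.ofReal_pow h1t, ← ENNReal.ofReal_pow ht0.le,
      ← ENNReal.ofReal_mul (by positivity), ← ENNReal.ofReal_mul (by positivity),
      ← ENNReal.ofReal_mul (by positivity), ← ENNReal.ofReal_mul (by positivity),
      ← ENNReal.ofReal_mul (by positivity), ← ENNReal.ofReal_mul (by positivity),
      ← ENNReal.ofReal_mul (by positivity),
      ← ENNReal.ofReal_add (by positivity) (by positivity),
      ← ENNReal.ofReal_add (by positivity) (by positivity),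
      ← ENNReal.ofReal_add (by positivity) (by positivity),
      ← ENNReal.ofReal_add (by positivity) (by positivity),
      ← ENNReal.ofReal_add (by positivity) (by positivity),
      ENNReal.ofReal_le_ofReal_iff (by positivity)] at h2
    have h3 : t * (2 * a + p - 2 * b - q) ≤ t * (t * (a - 2 * b + c)) := by nlinarith
    exact le_of_mul_le_mul_left h3 ht0
  have := nonpos_of_forall_le_mul key
  rw [h2κ, mul_assoc, mul_assoc, ENNReal.toReal_mul, ENNReal.toReal_mul (b := κ * B)]
  simp only [ENNReal.toReal_ofNat]
  linarith

/-- The Bregman divergence of `klFun`. -/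
lemma bregman_klFun {a u L : ℝ} (hL : 0 < L) :
    klFun a - klFun (Real.exp (-u) / L)
      + (u + Real.log L) * (a - Real.exp (-u) / L)
      = Real.exp (-u) / L * klFun (a / (Real.exp (-u) / L)) := by
  set b := Real.exp (-u) / L with hb
  have hb0 : 0 < b := by positivity
  have hlog : Real.log b = -u - Real.log L := by
    rw [hb, Real.log_div (Real.exp_pos _).ne' hL.ne', Real.log_exp]
  simp only [klFun_apply]
  rcases eq_or_ne a 0 with rfl | ha
  · rw [hlog]; simp; ring
  · rw [Real.log_div ha hb0.ne', hlog]
    field_simp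
    ring

/-- A minimiser of the free energy has density `e^{-γU}/L` with respect to `ν`. -/
lemma exists_minimizer_eq_exp [NeZero n] {s : ℝ} (hs : 0 < s) (γ : ℝ)
    (ν : Measure (Space n)) [IsProbabilityMeasure ν] {B : ℝ≥0∞} (hB : B ≠ ⊤)
    (hν : ∀ x, generatedPotential s ν x ≤ B) :
    ∃ (f : Space n → ℝ) (L : ℝ), 0 < L ∧ IsDensity ν f ∧ densEnergy s γ ν f ≠ ⊤ ∧
      (∀ h, IsDensity ν h → densEnergy s γ ν f ≤ densEnergy s γ ν h) ∧
      ∀ᵐ x ∂ν, ENNReal.ofReal (f x) = (ENNReal.ofReal L)⁻¹ *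
        expNeg (ENNReal.ofReal γ * generatedPotential s (densMeasure ν f) x) := by
  have hk := measurable_klFun
  have hInu : interactionEnergy s ν ≠ ⊤ := by
    refine ((lintegral_mono hν).trans_lt ?_).ne
    simpa using hB.lt_top
  obtain ⟨f, hf, hfin, hmin⟩ := exists_minimizer hs γ ν hInu
  have hfm := hf.measurable
  have := hf.isProbabilityMeasure
  have hUm := measurable_generatedPotential s (densMeasure ν f)
  set u : Space n → ℝ≥0∞ := fun x => ENNReal.ofReal γ * generatedPotential s (densMeasure ν f) x
    with hu
  have hum : Measurable u := hUm.const_mul _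
  have hmut : mutualEnergy s (densMeasure ν f) ν ≤ B := by
    rw [mutualEnergy_comm]
    calc _ ≤ ∫⁻ _, B ∂(densMeasure ν f) := lintegral_mono hν
      _ = B := by simp
  have huint : ∫⁻ x, u x ∂ν ≠ ⊤ := by
    rw [lintegral_const_mul _ hUm]
    exact ENNReal.mul_ne_top ENNReal.ofReal_ne_top (hmut.trans_lt hB.lt_top).ne
  have hutop : ∀ᵐ x ∂ν, u x ≠ ⊤ := (ae_lt_top hum huint).mono fun x h => h.ne
  set e : Space n → ℝ := fun x => Real.exp (-(u x).toReal) with he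
  have hem : Measurable e := by fun_prop
  have hepos : ∀ x, 0 < e x := fun x => Real.exp_pos _
  have hele : ∀ x, e x ≤ 1 := fun x => by simp [e]
  have heint : Integrable e ν := Integrable.of_bound hem.aestronglyMeasurable 1
    (ae_of_all _ fun x => by rw [Real.norm_of_nonneg (hepos x).le]; exact hele x)
  set L := ∫ x, e x ∂ν with hL
  have hLpos : 0 < L := by
    rw [hL, integral_pos_iff_support_of_nonneg (fun x => (hepos x).le) heint]
    have : Function.support e = Set.univ := by
      ext x; simp [(hepos x).ne']
    simp [this]
  -- The competitor is the Gibbs density in the potential of the minimiser itself; the equation to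
  -- be proved is `f = h`.
  set h : Space n → ℝ := fun x => e x / L with hh
  have hhd : IsDensity ν h := by
    refine ⟨hem.div_const L, fun x => div_nonneg (hepos x).le hLpos.le, ?_⟩
    rw [← ofReal_integral_eq_lintegral_ofReal (heint.div_const L)
      (ae_of_all _ fun x => div_nonneg (hepos x).le hLpos.le), integral_div, div_self hLpos.ne']
    simp
  have hhle : ∀ x, h x ≤ 1 / L := fun x => by simp only [h]; gcongr; exact hele x
  have hmle : densMeasure ν h ≤ ENNReal.ofReal (1 / L) • ν := by
    rw [densMeasure, ← withDensity_const]
    exact withDensity_mono (ae_of_all _ fun x => ENNReal.ofReal_le_ofReal (hhle x))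
  have hmuth : mutualEnergy s (densMeasure ν f) (densMeasure ν h) ≠ ⊤ := by
    refine ((lintegral_mono' hmle le_rfl).trans_lt ?_).ne
    rw [lintegral_smul_measure]
    exact ENNReal.mul_lt_top ENNReal.ofReal_lt_top (hmut.trans_lt hB.lt_top)
  have hIh : interactionEnergy s (densMeasure ν h) ≠ ⊤ := by
    have h1 : ∀ x, generatedPotential s (densMeasure ν h) x ≤ ENNReal.ofReal (1 / L) * B := by
      intro x
      calc _ ≤ ∫⁻ z, rieszKernel s x z ∂(ENNReal.ofReal (1 / L) • ν) := lintegral_mono' hmle le_rfl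
        _ = ENNReal.ofReal (1 / L) * generatedPotential s ν x := by
          rw [lintegral_smul_measure]; rfl
        _ ≤ _ := mul_le_mul_right (hν x) _
    have := hhd.isProbabilityMeasure
    refine ((lintegral_mono h1).trans_lt ?_).ne
    simpa using ENNReal.mul_lt_top ENNReal.ofReal_lt_top hB.lt_top
  have hklh : Integrable (fun x => klFun (h x)) ν := by
    obtain ⟨C, hC⟩ := isCompact_Icc.exists_bound_of_continuousOn (s := Set.Icc 0 (1 / L))
      continuous_klFun.continuousOn
    exact Integrable.of_bound (by fun_prop) C
      (ae_of_all _ fun x => hC _ ⟨hhd.nonneg x, hhle x⟩)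
  have hklf : Integrable (fun x => klFun (f x)) ν := by
    refine ⟨by fun_prop, ?_⟩
    rw [hasFiniteIntegral_iff_ofReal (ae_of_all _ fun x => klFun_nonneg (hf.nonneg x))]
    refine lt_of_le_of_lt ?_ hfin.lt_top
    exact le_add_self
  have hhfin : densEnergy s γ ν h ≠ ⊤ := by
    refine ENNReal.add_ne_top.2 ⟨ENNReal.mul_ne_top ENNReal.ofReal_ne_top hIh, ?_⟩
    exact hklh.lintegral_lt_top.ne
  have hopt := optimality_of_minimizer ν hf hhd hfin hhfin hmuth hmin
  have hpair : ∀ k : Space n → ℝ, IsDensity ν k →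
      ENNReal.ofReal γ * mutualEnergy s (densMeasure ν f) (densMeasure ν k)
        = ∫⁻ x, ENNReal.ofReal (k x) * u x ∂ν := by
    intro k hkd
    have := hkd.measurable
    rw [mutualEnergy, densMeasure, lintegral_withDensity_eq_lintegral_mul _ (by fun_prop) hUm,
      ← lintegral_const_mul _ (by fun_prop)]
    refine lintegral_congr fun x => ?_
    simp only [Pi.mul_apply, hu]; ring
  have hpairR : ∀ k : Space n → ℝ, IsDensity ν k →
      ENNReal.ofReal γ * mutualEnergy s (densMeasure ν f) (densMeasure ν k) ≠ ⊤ →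
      Integrable (fun x => (u x).toReal * k x) ν ∧
      (ENNReal.ofReal γ * mutualEnergy s (densMeasure ν f) (densMeasure ν k)).toReal
        = ∫ x, (u x).toReal * k x ∂ν := by
    intro k hkd hfin
    have hkm := hkd.measurable
    rw [hpair k hkd] at hfin ⊢
    have hcongr : (fun x => (u x).toReal * k x) = fun x => (ENNReal.ofReal (k x) * u x).toReal := by
      ext x
      rw [ENNReal.toReal_mul (a := ENNReal.ofReal (k x)), ENNReal.toReal_ofReal (hkd.nonneg x),
        mul_comm]
    rw [hcongr]
    exact ⟨integrable_toReal_of_lintegral_ne_top (by fun_prop) hfin,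
      (integral_toReal (by fun_prop) (ae_lt_top (by fun_prop) hfin)).symm⟩
  have hIf : ENNReal.ofReal γ * mutualEnergy s (densMeasure ν f) (densMeasure ν f) ≠ ⊤ := by
    intro htop
    apply hfin
    rw [mutualEnergy_self] at htop
    have h2 : ENNReal.ofReal γ = 2 * ENNReal.ofReal (γ / 2) := by
      rw [← ENNReal.ofReal_ofNat 2, ← ENNReal.ofReal_mul (by norm_num)]; congr 1; ring
    rw [h2, mul_assoc] at htop
    have : ENNReal.ofReal (γ / 2) * interactionEnergy s (densMeasure ν f) = ⊤ := by
      by_contra hne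
      exact ENNReal.mul_ne_top (by simp) hne htop
    rw [densEnergy, this, top_add]
  obtain ⟨hi1, he1⟩ := hpairR f hf hIf
  obtain ⟨hi2, he2⟩ := hpairR h hhd (ENNReal.mul_ne_top ENNReal.ofReal_ne_top hmuth)
  have hdi : ∀ k : Space n → ℝ, IsDensity ν k → Integrable k ν ∧ ∫ x, k x ∂ν = 1 := by
    intro k hkd
    have hkm := hkd.measurable
    refine ⟨⟨by fun_prop, ?_⟩, ?_⟩
    · rw [hasFiniteIntegral_iff_ofReal (ae_of_all _ hkd.nonneg), hkd.lintegral_eq]; simp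
    · rw [integral_eq_lintegral_of_nonneg_ae (ae_of_all _ hkd.nonneg) (by fun_prop),
        hkd.lintegral_eq]; simp
  obtain ⟨hfi, hf1⟩ := hdi f hf
  obtain ⟨hhi, hh1⟩ := hdi h hhd
  set Breg : Space n → ℝ := fun x => klFun (f x) - klFun (h x)
      + ((u x).toReal + Real.log L) * (f x - h x) with hBreg
  have hBeq : ∀ x, Breg x = h x * klFun (f x / h x) := fun x => bregman_klFun hLpos
  have hhpos : ∀ x, 0 < h x := fun x => div_pos (hepos x) hLpos
  have hBnn : ∀ x, 0 ≤ Breg x := fun x => by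
    rw [hBeq]
    exact mul_nonneg (hhpos x).le (klFun_nonneg (div_nonneg (hf.nonneg x) (hhpos x).le))
  have hBsplit : Breg = fun x => klFun (f x) - klFun (h x)
      + (((u x).toReal * f x - (u x).toReal * h x) + Real.log L * (f x - h x)) := by
    ext x; simp only [Breg]; ring
  have e1 : Integrable (fun x => klFun (f x) - klFun (h x)) ν := hklf.sub hklh
  have e2 : Integrable (fun x => (u x).toReal * f x - (u x).toReal * h x) ν := hi1.sub hi2
  have e3 : Integrable (fun x => Real.log L * (f x - h x)) ν := (hfi.sub hhi).const_mul _
  have e23 : Integrable (fun x => ((u x).toReal * f x - (u x).toReal * h x)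
      + Real.log L * (f x - h x)) ν := e2.add e3
  have hBi : Integrable Breg ν := by
    rw [hBsplit]
    exact e1.add e23
  -- First-order optimality tested against `h` is this inequality: the `log L` term integrates to
  -- zero because both densities have mass one. By `bregman_klFun` the integrand is `h · klFun (f/h)
  -- ≥ 0`, so it vanishes almost everywhere.
  have hBint : ∫ x, Breg x ∂ν ≤ 0 := by
    rw [hBsplit]
    beta_reduce
    rw [integral_add e1 e23, integral_add e2 e3, integral_sub hklf hklh,
      integral_sub hi1 hi2, integral_const_mul, integral_sub hfi hhi, hf1, hh1, ← he1, ← he2,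
      mutualEnergy_self]
    rw [integral_eq_lintegral_of_nonneg_ae (ae_of_all _ fun x => klFun_nonneg (hf.nonneg x))
      hklf.1, integral_eq_lintegral_of_nonneg_ae
      (ae_of_all _ fun x => klFun_nonneg (hhd.nonneg x)) hklh.1]
    linarith
  have hB0 : Breg =ᵐ[ν] 0 :=
    (integral_eq_zero_iff_of_nonneg hBnn hBi).1 (le_antisymm hBint (integral_nonneg hBnn))
  refine ⟨f, L, hLpos, hf, hfin, hmin, ?_⟩
  filter_upwards [hB0, hutop] with x hx hux
  rw [hBeq, Pi.zero_apply] at hx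
  have h1 := (klFun_eq_zero_iff (div_nonneg (hf.nonneg x) (hhpos x).le)).1
    ((mul_eq_zero.1 hx).resolve_left (hhpos x).ne')
  have h2 : f x = h x := (div_eq_one_iff_eq (hhpos x).ne').1 h1
  rw [h2, expNeg_of_ne_top hux, ← ENNReal.ofReal_inv_of_pos hLpos,
    ← ENNReal.ofReal_mul (by positivity)]
  congr 1
  simp only [h, e]; ring

lemma freeEnergy_of_eq_densMeasure (s γ : ℝ) {α : ℝ} (hα : 0 < α) {μ : ProbabilityMeasure (Space n)}
    {f : Space n → ℝ} (hf : IsDensity (referenceMeasure n α) f)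
    (h : (μ : Measure (Space n)) = densMeasure (referenceMeasure n α) f) :
    freeEnergy s α γ μ = densEnergy s γ (referenceMeasure n α) f := by
  have hm := hf.measurable
  have := isProbabilityMeasure_referenceMeasure (n := n) hα
  have hp := hf.isProbabilityMeasure
  rw [freeEnergy, densEnergy, h]
  congr 1
  have hac : densMeasure (referenceMeasure n α) f ≪ referenceMeasure n α :=
    withDensity_absolutelyContinuous _ _
  rw [klDiv_eq_lintegral_klFun_of_ac hac]
  refine lintegral_congr_ae ?_
  have hr := Measure.rnDeriv_withDensity (referenceMeasure n α)
    (f := fun x => ENNReal.ofReal (f x)) (by fun_prop)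
  filter_upwards [hr] with x hx
  rw [densMeasure, hx, ENNReal.toReal_ofReal (hf.nonneg x)]

lemma exists_density_of_freeEnergy_ne_top {s γ α : ℝ} (hα : 0 < α)
    {μ : ProbabilityMeasure (Space n)} (h : freeEnergy s α γ μ ≠ ⊤) :
    ∃ f, IsDensity (referenceMeasure n α) f ∧
      (μ : Measure (Space n)) = densMeasure (referenceMeasure n α) f := by
  have := isProbabilityMeasure_referenceMeasure (n := n) hα
  have hac : (μ : Measure (Space n)) ≪ referenceMeasure n α :=
    (klDiv_ne_top_iff.1 (ENNReal.add_ne_top.1 h).2).1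
  have hm := Measure.measurable_rnDeriv (μ : Measure (Space n)) (referenceMeasure n α)
  have heq : (μ : Measure (Space n)) = densMeasure (referenceMeasure n α)
      fun x => ((μ : Measure (Space n)).rnDeriv (referenceMeasure n α) x).toReal := by
    have hd : (μ : Measure (Space n)).HaveLebesgueDecomposition (referenceMeasure n α) :=
      Measure.haveLebesgueDecomposition_of_sigmaFinite _ _
    have h0 := Measure.withDensity_rnDeriv_eq (μ : Measure (Space n)) (referenceMeasure n α) hac
    refine h0.symm.trans ?_
    refine withDensity_congr_ae ?_
    filter_upwards [Measure.rnDeriv_lt_top (μ : Measure (Space n)) (referenceMeasure n α)] with x hx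
    rw [ENNReal.ofReal_toReal hx.ne]
  refine ⟨_, ⟨hm.ennreal_toReal, fun x => ENNReal.toReal_nonneg, ?_⟩, heq⟩
  have h1 := congrArg (fun m => m Set.univ) heq
  simp only [measure_univ, densMeasure, withDensity_apply _ MeasurableSet.univ,
    Measure.restrict_univ] at h1
  exact h1.symm

/-- The free energy has a unique minimiser, which solves the self-consistent equation. -/
theorem exists_equilibriumMeasure (n : ℕ) [NeZero n] {s α : ℝ} (γ : ℝ) (hs : 0 < s) (hsn : s < n)
    (hα : 0 < α) :
    ∃ (μ : ProbabilityMeasure (Space n)) (L : ℝ),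
      IsEquilibriumMeasure s α γ μ ∧ SelfConsistent s α γ μ L := by
  have := isProbabilityMeasure_referenceMeasure (n := n) hα
  set ν := referenceMeasure n α with hν
  have hC0 := weightMeasure_univ_ne_zero (n := n) α
  have hCt := weightMeasure_univ_ne_top (n := n) hα
  have hB : truncBound n s 1 * ν Set.univ + (weightMeasure n α Set.univ)⁻¹ * tailMass n s 1 ≠ ⊤ :=
    ENNReal.add_ne_top.2 ⟨ENNReal.mul_ne_top (truncBound_ne_top s hs 1) (measure_ne_top _ _),
      ENNReal.mul_ne_top (by simpa using hC0) (tailMass_ne_top s hs hsn one_pos)⟩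
  obtain ⟨f, L, hL, hf, hfin, hmin, hexp⟩ := exists_minimizer_eq_exp hs γ ν hB
    (generatedPotential_le s hs (referenceMeasure_le α))
  have hfp := hf.isProbabilityMeasure
  -- The `L` obtained above normalises with respect to `ν₀`; multiplying by the mass of `e^{-|x|^α}
  -- dx` converts to Lebesgue measure.
  refine ⟨⟨densMeasure ν f, hfp⟩, L * (weightMeasure n α Set.univ).toReal, ?_, ?_, ?_⟩
  · intro μ' hne
    have hF := freeEnergy_of_eq_densMeasure s γ hα (μ := ⟨densMeasure ν f, hfp⟩) hf rfl
    rw [hF]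
    by_contra! hle
    obtain ⟨h, hh, heq⟩ := exists_density_of_freeEnergy_ne_top hα
      (ne_top_of_le_ne_top hfin hle)
    rw [freeEnergy_of_eq_densMeasure s γ hα hh heq] at hle
    have hae := hf.ae_eq_of_minimizer hs γ ν hh hfin hmin hle
    apply hne
    apply Subtype.ext
    change (μ' : Measure (Space n)) = densMeasure ν f
    rw [heq]
    refine withDensity_congr_ae (hae.mono fun x hx => ?_)
    change ENNReal.ofReal (h x) = ENNReal.ofReal (f x)
    rw [hx]
  · exact mul_pos hL (ENNReal.toReal_pos hC0 hCt)
  · change densMeasure ν f = _ • (volume : Measure (Space n)).withDensity fun x =>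
      expNeg (ENNReal.ofReal γ * generatedPotential s (densMeasure ν f) x + potential α x)
    have hm1 : Measurable fun x => expNeg (ENNReal.ofReal γ *
        generatedPotential s (densMeasure ν f) x) :=
      measurable_expNeg.comp ((measurable_generatedPotential s _).const_mul _)
    have hm2 := measurable_expNeg_potential (n := n) α
    have key : ∀ u : Space n → ℝ≥0∞, Measurable u →
        ν.withDensity (fun x => (ENNReal.ofReal L)⁻¹ * u x)
          = (ENNReal.ofReal (L * (weightMeasure n α Set.univ).toReal))⁻¹ •
            (volume : Measure (Space n)).withDensity fun x => u x * expNeg (potential α x) := by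
      intro u hu
      rw [ENNReal.ofReal_mul hL.le, ENNReal.ofReal_toReal hCt,
        ENNReal.mul_inv (Or.inr hCt) (Or.inr hC0), hν, referenceMeasure_eq,
        withDensity_smul_measure, mul_comm, mul_smul]
      congr 1
      rw [weightMeasure]
      change ((volume : Measure (Space n)).withDensity _).withDensity ((ENNReal.ofReal L)⁻¹ • u) = _
      rw [withDensity_smul _ hu, ← withDensity_mul _ hm2 hu]
      congr 2
      ext x
      simp [mul_comm]
    conv_lhs => rw [densMeasure, withDensity_congr_ae hexp]
    simp_rw [expNeg_add]
    exact key _ hm1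

end EulerLagrange

/-! ### Removing a particle from the gas -/

section Peeling

variable {n : ℕ}

/-- Jensen's inequality for `expNeg`. -/
lemma expNeg_le_lintegral_expNeg {Ω : Type*} [MeasurableSpace Ω] (P : Measure Ω)
    [IsProbabilityMeasure P] {t : Ω → ℝ≥0∞} (ht : Measurable t) {a : ℝ≥0∞} (ha : ∫⁻ x, t x ∂P ≤ a) :
    expNeg a ≤ ∫⁻ x, expNeg (t x) ∂P := by
  rcases eq_or_ne a ⊤ with rfl | hatop
  · simp
  -- The tangent of `e^{-t}` at `a`, `e^{-t} ≥ e^{-a}(1 + a - t)`, arranged without subtraction.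
  have hpt : ∀ x, expNeg a * (1 + a) ≤ expNeg (t x) + expNeg a * t x := by
    intro x
    rcases eq_or_ne (t x) ⊤ with h | h
    · simp [h, ENNReal.mul_top (expNeg_pos hatop).ne']
    · lift a to ℝ≥0 using hatop
      generalize t x = b at *
      lift b to ℝ≥0 using h
      rw [expNeg_coe, expNeg_coe, ← ENNReal.ofReal_coe_nnreal, ← ENNReal.ofReal_coe_nnreal,
        ← ENNReal.ofReal_one, ← ENNReal.ofReal_add (by positivity) (by positivity),
        ← ENNReal.ofReal_mul (by positivity), ← ENNReal.ofReal_mul (by positivity),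
        ← ENNReal.ofReal_add (by positivity) (by positivity)]
      refine ENNReal.ofReal_le_ofReal ?_
      have h1 := Real.add_one_le_exp ((a : ℝ) - b)
      have h2 : Real.exp (-(b : ℝ)) = Real.exp (-(a : ℝ)) * Real.exp ((a : ℝ) - b) := by
        rw [← Real.exp_add]; congr 1; ring
      have h3 := Real.exp_pos (-(a : ℝ))
      rw [h2]; nlinarith
  have hint := lintegral_mono (μ := P) hpt
  have hm : Measurable fun x => expNeg (t x) := measurable_expNeg.comp ht
  rw [lintegral_const, measure_univ, mul_one, lintegral_add_left hm,
    lintegral_const_mul _ ht] at hint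
  have h2 : expNeg a + expNeg a * a ≤ ∫⁻ x, expNeg (t x) ∂P + expNeg a * a := by
    calc expNeg a + expNeg a * a = expNeg a * (1 + a) := by ring
      _ ≤ _ := hint
      _ ≤ _ := by gcongr
  exact (ENNReal.add_le_add_iff_right (ENNReal.mul_ne_top (expNeg_ne_top a) hatop)).1 h2

/-- The pair interaction `∑_{i<j} g(x_i, x_j)`. -/
noncomputable def pairEnergy (s : ℝ) {M : ℕ} (x : Fin M → Space n) : ℝ≥0∞ :=
  ∑ i, ∑ j ∈ Finset.Ioi i, rieszKernel s (x i) (x j)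

/-- The symmetric double sum does not depend on the order of indices, so a particle can be inserted
at any position. -/
lemma two_mul_pairEnergy (s : ℝ) {M : ℕ} (x : Fin M → Space n) :
    2 * pairEnergy s x = ∑ i, ∑ j, if i = j then 0 else rieszKernel s (x i) (x j) := by
  have h := Finset.sum_sum_Ioi_add_eq_sum_sum_off_diag (fun i j => rieszKernel s (x i) (x j))
  have h1 : ∑ i, ∑ j, (if i = j then 0 else rieszKernel s (x i) (x j))
      = ∑ i, ∑ j ∈ {i}ᶜ, rieszKernel s (x j) (x i) := by
    refine Finset.sum_congr rfl fun i _ => ?_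
    rw [← Finset.sum_subset (Finset.subset_univ ({i}ᶜ : Finset (Fin M)))]
    · refine Finset.sum_congr rfl fun j hj => ?_
      have : i ≠ j := fun h => by simp [h] at hj
      rw [if_neg this, rieszKernel_comm]
    · intro j _ hj
      have : i = j := by simpa [eq_comm] using hj
      simp [this]
  rw [h1, ← h, pairEnergy, Finset.mul_sum]
  refine Finset.sum_congr rfl fun i _ => ?_
  rw [Finset.mul_sum]
  refine Finset.sum_congr rfl fun j _ => ?_
  rw [rieszKernel_comm s (x j) (x i), two_mul]

lemma pairEnergy_insertNth (s : ℝ) {M : ℕ} (i : Fin (M + 1)) (x : Space n) (y : Fin M → Space n) :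
    pairEnergy s (i.insertNth x y : Fin (M + 1) → Space n)
      = pairEnergy s y + ∑ j, rieszKernel s x (y j) := by
  have h : 2 * pairEnergy s (i.insertNth x y : Fin (M + 1) → Space n)
      = 2 * (pairEnergy s y + ∑ j, rieszKernel s x (y j)) := by
    rw [mul_add, two_mul_pairEnergy, two_mul_pairEnergy, Fin.sum_univ_succAbove _ i]
    simp only [Fin.sum_univ_succAbove _ i, Fin.insertNth_apply_same, Fin.insertNth_apply_succAbove,
      if_true, zero_add, Fin.succAbove_ne, (Fin.succAbove_ne i _).symm, if_false,
      Finset.sum_add_distrib, Fin.succAbove_right_inj]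
    rw [two_mul]
    simp_rw [rieszKernel_comm s (y _) x]
    ring
  exact (ENNReal.mul_right_inj (by simp) (by simp)).1 h

/-- The factor `e^{-β ∑_j g(x, y_j)}`. -/
noncomputable def fieldFactor (s β : ℝ) {M : ℕ} (x : Space n) (y : Fin M → Space n) : ℝ≥0∞ :=
  expNeg (ENNReal.ofReal β * ∑ j, rieszKernel s x (y j))

lemma expNeg_energy_insertNth (s α β : ℝ) {M : ℕ} (i : Fin (M + 1)) (x : Space n)
    (y : Fin M → Space n) :
    expNeg (energy s α β (i.insertNth x y : Fin (M + 1) → Space n))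
      = expNeg (potential α x) * (fieldFactor s β x y * expNeg (energy s α β y)) := by
  have h : energy s α β (i.insertNth x y : Fin (M + 1) → Space n)
      = potential α x + (ENNReal.ofReal β * ∑ j, rieszKernel s x (y j) + energy s α β y) := by
    have := pairEnergy_insertNth s i x y
    unfold pairEnergy at this
    rw [energy, this, energy, Fin.sum_univ_succAbove _ i]
    simp only [Fin.insertNth_apply_same, Fin.insertNth_apply_succAbove]
    ring
  rw [h, expNeg_add, expNeg_add, fieldFactor]

lemma _root_.Measurable.rieszKernel {Ω : Type*} [MeasurableSpace Ω] (s : ℝ) {f g : Ω → Space n}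
    (hf : Measurable f) (hg : Measurable g) : Measurable fun ω => rieszKernel s (f ω) (g ω) := by
  unfold RieszGas.rieszKernel; fun_prop

@[fun_prop] lemma measurable_pairEnergy (s : ℝ) {M : ℕ} :
    Measurable (pairEnergy (n := n) s (M := M)) := by
  have h : ∀ i j : Fin M, Measurable fun x : Fin M → Space n => rieszKernel s (x i) (x j) :=
    fun i j => (measurable_pi_apply i).rieszKernel s (measurable_pi_apply j)
  unfold pairEnergy
  fun_prop

@[fun_prop] lemma measurable_energy (s α β : ℝ) {M : ℕ} :
    Measurable (energy (n := n) s α β (N := M)) := by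
  have := measurable_pairEnergy (n := n) s (M := M)
  unfold pairEnergy at this
  unfold energy
  fun_prop

@[fun_prop] lemma measurable_fieldFactor (s β : ℝ) {M : ℕ} :
    Measurable fun q : Space n × (Fin M → Space n) => fieldFactor s β q.1 q.2 := by
  have h : ∀ j : Fin M, Measurable fun q : Space n × (Fin M → Space n) =>
      rieszKernel s q.1 (q.2 j) := fun j =>
    measurable_fst.rieszKernel s ((measurable_pi_apply j).comp measurable_snd)
  unfold fieldFactor
  exact measurable_expNeg.comp (by fun_prop)

lemma fieldFactor_le_one (s β : ℝ) {M : ℕ} (x : Space n) (y : Fin M → Space n) :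
    fieldFactor s β x y ≤ 1 := expNeg_le_one _

/-- The unnormalised Gibbs measure. -/
noncomputable def boltzmannMeasure (n : ℕ) (s α β : ℝ) (M : ℕ) : Measure (Fin M → Space n) :=
  (volume : Measure (Fin M → Space n)).withDensity fun x => expNeg (energy s α β x)

lemma measurable_expNeg_energy (s α β : ℝ) (M : ℕ) :
    Measurable fun x : Fin M → Space n => expNeg (energy s α β x) :=
  measurable_expNeg.comp (measurable_energy s α β)

instance (s α β : ℝ) (M : ℕ) : SFinite (boltzmannMeasure n s α β M) := by
  unfold boltzmannMeasure; infer_instance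

lemma boltzmannMeasure_univ (s α β : ℝ) (M : ℕ) :
    boltzmannMeasure n s α β M Set.univ = partitionFunction n s α β M := by
  simp [boltzmannMeasure, partitionFunction]

lemma gibbsMeasure_eq (s α β : ℝ) (M : ℕ) :
    gibbsMeasure n s α β M = (partitionFunction n s α β M)⁻¹ • boltzmannMeasure n s α β M := rfl

lemma measurable_insertNth {M : ℕ} (i : Fin (M + 1)) :
    Measurable fun q : Space n × (Fin M → Space n) =>
      (i.insertNth q.1 q.2 : Fin (M + 1) → Space n) :=
  (MeasurableEquiv.piFinSuccAbove (fun _ => Space n) i).symm.measurable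

/-- Disintegration along particle `i`: its weight is `e^{-|x|^α} dx` times its interaction with the
others, which form a gas of one particle fewer at the same `β`. -/
lemma lintegral_boltzmannMeasure_succ (s α β : ℝ) {M : ℕ} (i : Fin (M + 1))
    {F : (Fin (M + 1) → Space n) → ℝ≥0∞} (hF : Measurable F) :
    ∫⁻ z, F z ∂(boltzmannMeasure n s α β (M + 1))
      = ∫⁻ x, ∫⁻ y, fieldFactor s β x y * F (i.insertNth x y) ∂(boltzmannMeasure n s α β M)
        ∂(weightMeasure n α) := by
  have hE := measurable_expNeg_energy (n := n) s α β
  have hins := measurable_insertNth (n := n) i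
  have hFi : Measurable fun q : Space n × (Fin M → Space n) =>
    F (i.insertNth q.1 q.2 : Fin (M + 1) → Space n) := hF.comp hins
  rw [boltzmannMeasure, lintegral_withDensity_eq_lintegral_mul _ (hE _) hF,
    ← (volume_preserving_piFinSuccAbove (fun _ : Fin (M + 1) => Space n) i).symm.lintegral_comp
      ((hE _).mul hF)]
  have hcomp : Measurable fun q => ((fun x : Fin (M + 1) → Space n => expNeg (energy s α β x)) * F)
      ((MeasurableEquiv.piFinSuccAbove (fun _ : Fin (M + 1) => Space n) i).symm q) :=
    ((hE _).mul hF).comp (MeasurableEquiv.measurable _)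
  rw [Measure.volume_eq_prod, lintegral_prod _ hcomp.aemeasurable, weightMeasure,
    lintegral_withDensity_eq_lintegral_mul _ (measurable_expNeg_potential α)]
  · refine lintegral_congr fun x => ?_
    have hm : Measurable fun y : Fin M → Space n =>
      fieldFactor s β x y * F (i.insertNth x y : Fin (M + 1) → Space n) :=
      Measurable.of_uncurry_left (f := fun x (y : Fin M → Space n) => fieldFactor s β x y *
        F (i.insertNth x y : Fin (M + 1) → Space n)) ((measurable_fieldFactor s β).mul hFi)
    rw [Pi.mul_apply, boltzmannMeasure, lintegral_withDensity_eq_lintegral_mul _ (hE _) hm,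
      ← lintegral_const_mul _ ((hE _).mul hm)]
    refine lintegral_congr fun y => ?_
    simp only [Pi.mul_apply]
    change expNeg (energy s α β (i.insertNth x y : Fin (M + 1) → Space n)) * F (i.insertNth x y) = _
    rw [expNeg_energy_insertNth]
    ring
  · exact ((measurable_fieldFactor s β).mul hFi).lintegral_prod_right'

/-- A bound for the potential generated by `ν₀`. -/
noncomputable def potentialBound (n : ℕ) (s α : ℝ) : ℝ≥0∞ :=
  truncBound n s 1 * referenceMeasure n α Set.univ
    + (weightMeasure n α Set.univ)⁻¹ * tailMass n s 1

lemma potentialBound_ne_top {s α : ℝ} (hs : 0 < s) (hsn : s < n) (hα : 0 < α) :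
    potentialBound n s α ≠ ⊤ := by
  have := isProbabilityMeasure_referenceMeasure (n := n) hα
  exact ENNReal.add_ne_top.2 ⟨ENNReal.mul_ne_top (truncBound_ne_top s hs 1) (measure_ne_top _ _),
    ENNReal.mul_ne_top (by simpa using weightMeasure_univ_ne_zero α)
      (tailMass_ne_top s hs hsn one_pos)⟩

lemma generatedPotential_referenceMeasure_le [NeZero n] {s α : ℝ} (hs : 0 < s) (x : Space n) :
    generatedPotential s (referenceMeasure n α) x ≤ potentialBound n s α :=
  generatedPotential_le s hs (referenceMeasure_le α) x

/-- The lower bound for the ratio of consecutive partition functions. -/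
noncomputable def ratioBound (n : ℕ) (s α : ℝ) (b : ℝ≥0∞) : ℝ≥0∞ :=
  weightMeasure n α Set.univ * expNeg (b * potentialBound n s α)

lemma lintegral_weightMeasure_eq {α : ℝ} (hα : 0 < α) (F : Space n → ℝ≥0∞) :
    ∫⁻ x, F x ∂(weightMeasure n α)
      = weightMeasure n α Set.univ * ∫⁻ x, F x ∂(referenceMeasure n α) := by
  rw [referenceMeasure_eq, lintegral_smul_measure, smul_eq_mul, ← mul_assoc,
    ENNReal.mul_inv_cancel (weightMeasure_univ_ne_zero α) (weightMeasure_univ_ne_top hα), one_mul]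

/-- Jensen's inequality with the inserted particle drawn from `ν₀`, whose potential at each `y j` is
at most `potentialBound`. The bound depends on the gas only through `β M`. -/
lemma ratioBound_le_lintegral_fieldFactor [NeZero n] {s α β : ℝ} (hs : 0 < s) (hα : 0 < α)
    {M : ℕ} {b : ℝ≥0∞} (hb : ENNReal.ofReal β * M ≤ b) (y : Fin M → Space n) :
    ratioBound n s α b ≤ ∫⁻ x, fieldFactor s β x y ∂(weightMeasure n α) := by
  have := isProbabilityMeasure_referenceMeasure (n := n) hα
  have hg : ∀ j, Measurable fun x : Space n => rieszKernel s x (y j) := fun j =>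
    measurable_id.rieszKernel s measurable_const
  rw [lintegral_weightMeasure_eq hα, ratioBound]
  refine mul_le_mul_right (expNeg_le_lintegral_expNeg _ (by fun_prop) ?_) _
  rw [lintegral_const_mul _ (by fun_prop), lintegral_finsetSum _ fun j _ => hg j]
  calc _ ≤ ENNReal.ofReal β * ∑ _j : Fin M, potentialBound n s α := by
        gcongr with j
        have := generatedPotential_referenceMeasure_le (α := α) hs (y j)
        unfold generatedPotential at this
        simp_rw [rieszKernel_comm s (y j)] at this
        exact this
    _ = ENNReal.ofReal β * M * potentialBound n s α := by simp [mul_assoc]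
    _ ≤ _ := by gcongr

lemma partitionFunction_succ (s α β : ℝ) (M : ℕ) :
    partitionFunction n s α β (M + 1) = ∫⁻ x, ∫⁻ y, fieldFactor s β x y
      ∂(boltzmannMeasure n s α β M) ∂(weightMeasure n α) := by
  rw [← boltzmannMeasure_univ, ← lintegral_one,
    lintegral_boltzmannMeasure_succ s α β 0 measurable_const]
  simp

lemma ratioBound_mul_le [NeZero n] {s α β : ℝ} (hs : 0 < s) (hα : 0 < α) {M : ℕ} {b : ℝ≥0∞}
    (hb : ENNReal.ofReal β * M ≤ b) :
    ratioBound n s α b * partitionFunction n s α β M ≤ partitionFunction n s α β (M + 1) := by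
  rw [partitionFunction_succ, lintegral_lintegral_swap (measurable_fieldFactor s β).aemeasurable,
    ← boltzmannMeasure_univ, ← lintegral_const]
  exact lintegral_mono fun y => ratioBound_le_lintegral_fieldFactor hs hα hb y

lemma partitionFunction_succ_le (s α β : ℝ) (M : ℕ) :
    partitionFunction n s α β (M + 1)
      ≤ weightMeasure n α Set.univ * partitionFunction n s α β M := by
  rw [partitionFunction_succ]
  calc _ ≤ ∫⁻ _x : Space n, ∫⁻ _y, 1 ∂(boltzmannMeasure n s α β M) ∂(weightMeasure n α) :=
        lintegral_mono fun x => lintegral_mono fun y => fieldFactor_le_one s β x y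
    _ = _ := by simp [boltzmannMeasure_univ, mul_comm]

lemma ratioBound_ne_zero {s α : ℝ} (hs : 0 < s) (hsn : s < n) (hα : 0 < α) {b : ℝ≥0∞}
    (hb : b ≠ ⊤) : ratioBound n s α b ≠ 0 :=
  mul_ne_zero (weightMeasure_univ_ne_zero α)
    (expNeg_pos (ENNReal.mul_ne_top hb (potentialBound_ne_top hs hsn hα))).ne'

lemma partitionFunction_ne_zero_and_ne_top [NeZero n] {s α : ℝ} (β : ℝ) (hs : 0 < s) (hsn : s < n)
    (hα : 0 < α) (M : ℕ) :
    partitionFunction n s α β M ≠ 0 ∧ partitionFunction n s α β M ≠ ⊤ := by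
  induction M with
  | zero => simp [partitionFunction, energy, NeZero.ne]
  | succ M ih =>
    constructor
    · have h := ratioBound_mul_le (n := n) hs hα (M := M) (le_refl (ENNReal.ofReal β * M))
      intro h0
      rw [h0, nonpos_iff_eq_zero, mul_eq_zero] at h
      exact h.elim (ratioBound_ne_zero hs hsn hα (by finiteness)) ih.1
    · exact ((partitionFunction_succ_le s α β M).trans_lt (ENNReal.mul_lt_top
        (weightMeasure_univ_ne_top hα).lt_top ih.2.lt_top)).ne

lemma isProbabilityMeasure_gibbsMeasure [NeZero n] {s α : ℝ} (β : ℝ) (hs : 0 < s) (hsn : s < n)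
    (hα : 0 < α) (M : ℕ) : IsProbabilityMeasure (gibbsMeasure n s α β M) := by
  obtain ⟨h0, ht⟩ := partitionFunction_ne_zero_and_ne_top (n := n) β hs hsn hα M
  exact ⟨by rw [gibbsMeasure_eq, Measure.smul_apply, boltzmannMeasure_univ, smul_eq_mul,
    ENNReal.inv_mul_cancel h0 ht]⟩

instance (s α β : ℝ) (M : ℕ) : SFinite (gibbsMeasure n s α β M) := by
  rw [gibbsMeasure_eq]; infer_instance

/-- The ratio `Z_{M+1} / Z_M`. -/
noncomputable def partitionRatio (n : ℕ) (s α β : ℝ) (M : ℕ) : ℝ≥0∞ :=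
  partitionFunction n s α β (M + 1) / partitionFunction n s α β M

lemma lintegral_gibbsMeasure_succ [NeZero n] {s α : ℝ} (β : ℝ) (hs : 0 < s) (hsn : s < n)
    (hα : 0 < α) {M : ℕ} (i : Fin (M + 1))
    {F : (Fin (M + 1) → Space n) → ℝ≥0∞} (hF : Measurable F) :
    ∫⁻ z, F z ∂(gibbsMeasure n s α β (M + 1))
      = (partitionRatio n s α β M)⁻¹ * ∫⁻ x, ∫⁻ y, fieldFactor s β x y * F (i.insertNth x y)
        ∂(gibbsMeasure n s α β M) ∂(weightMeasure n α) := by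
  obtain ⟨h0, ht⟩ := partitionFunction_ne_zero_and_ne_top (n := n) β hs hsn hα M
  have hFi : Measurable fun q : Space n × (Fin M → Space n) => fieldFactor s β q.1 q.2 *
    F (i.insertNth q.1 q.2 : Fin (M + 1) → Space n) :=
    (measurable_fieldFactor s β).mul (hF.comp (measurable_insertNth i))
  simp_rw [gibbsMeasure_eq, lintegral_smul_measure, smul_eq_mul]
  rw [lintegral_boltzmannMeasure_succ s α β i hF,
    lintegral_const_mul _ hFi.lintegral_prod_right', ← mul_assoc]
  congr 1
  rw [partitionRatio, ENNReal.inv_div (Or.inl ht) (Or.inl h0), div_eq_mul_inv, mul_right_comm,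
    ENNReal.mul_inv_cancel h0 ht, one_mul]

lemma partitionRatio_eq_lintegral [NeZero n] {s α : ℝ} (β : ℝ) (M : ℕ) :
    partitionRatio n s α β M = ∫⁻ x, ∫⁻ y, fieldFactor s β x y
        ∂(gibbsMeasure n s α β M) ∂(weightMeasure n α) := by
  simp_rw [gibbsMeasure_eq, lintegral_smul_measure, smul_eq_mul]
  rw [lintegral_const_mul _ (measurable_fieldFactor s β).lintegral_prod_right',
    ← partitionFunction_succ, partitionRatio, div_eq_mul_inv, mul_comm]

lemma ratioBound_le_partitionRatio [NeZero n] {s α β : ℝ} (hs : 0 < s) (hsn : s < n) (hα : 0 < α)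
    {M : ℕ} {b : ℝ≥0∞} (hb : ENNReal.ofReal β * M ≤ b) :
    ratioBound n s α b ≤ partitionRatio n s α β M := by
  obtain ⟨h0, ht⟩ := partitionFunction_ne_zero_and_ne_top (n := n) β hs hsn hα M
  rw [partitionRatio, ENNReal.le_div_iff_mul_le (Or.inl h0) (Or.inl ht)]
  exact ratioBound_mul_le hs hα hb

/-- The one-particle marginals of the Gibbs measure are bounded by a multiple of
`e^{-|x|^α} dx`. -/
lemma lintegral_gibbsMeasure_apply_le [NeZero n] {s α β : ℝ} (hs : 0 < s) (hsn : s < n)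
    (hα : 0 < α) {M : ℕ} {b : ℝ≥0∞} (hb : ENNReal.ofReal β * M ≤ b) (i : Fin M)
    {F : Space n → ℝ≥0∞} (hF : Measurable F) :
    ∫⁻ y, F (y i) ∂(gibbsMeasure n s α β M)
      ≤ (ratioBound n s α b)⁻¹ * ∫⁻ x, F x ∂(weightMeasure n α) := by
  cases M with
  | zero => exact i.elim0
  | succ M =>
    have hbM : ENNReal.ofReal β * M ≤ b := by
      refine le_trans ?_ hb
      gcongr; simp
    have := isProbabilityMeasure_gibbsMeasure (n := n) β hs hsn hα M
    rw [lintegral_gibbsMeasure_succ β hs hsn hα i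
      (F := fun z => F (z i)) (hF.comp (measurable_pi_apply i))]
    -- The interaction is repulsive, so the field factor is dropped in the numerator; only the ratio
    -- of partition functions has to be bounded from below.
    refine mul_le_mul' (ENNReal.inv_le_inv.2 (ratioBound_le_partitionRatio hs hsn hα hbM)) ?_
    refine lintegral_mono fun x => ?_
    calc _ ≤ ∫⁻ _y, F x ∂(gibbsMeasure n s α β M) := lintegral_mono fun y => by
          simpa using mul_le_mul_left (fieldFactor_le_one s β x y) (F x)
      _ = F x := by simp

end Peeling

/-! ### The truncated energy as a positive definite form -/

section Gram

variable {n : ℕ}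

/-- The mutual energy of two measures for the truncated kernel. -/
noncomputable def gram (s T : ℝ) (ρ τ : Measure (Space n)) : ℝ :=
  (∫⁻ x, ∫⁻ z, truncKernel s T x z ∂ρ ∂τ).toReal

/-- The feature measure restricted to the scales `t ≤ T`. -/
noncomputable def truncFeatureMeasure (n : ℕ) (s T : ℝ) : Measure (ℝ × Space n) :=
  (featureMeasure n s).restrict (Set.Iic T ×ˢ Set.univ)

instance (s T : ℝ) : SFinite (truncFeatureMeasure n s T) := by
  unfold truncFeatureMeasure; infer_instance

/-- The mean feature of a measure. -/
noncomputable def meanFeature (ρ : Measure (Space n)) (p : ℝ × Space n) : ℝ≥0∞ :=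
  ∫⁻ z, feature p z ∂ρ

@[fun_prop] lemma measurable_meanFeature (ρ : Measure (Space n)) [SFinite ρ] :
    Measurable (meanFeature ρ) := measurable_feature.lintegral_prod_right'

lemma lintegral_truncKernel (s : ℝ) (hs : 0 < s) (T : ℝ) (ρ τ : Measure (Space n)) [SFinite ρ]
    [SFinite τ] : ∫⁻ x, ∫⁻ z, truncKernel s T x z ∂ρ ∂τ
      = ∫⁻ p, meanFeature ρ p * meanFeature τ p ∂(truncFeatureMeasure n s T) := by
  simp_rw [truncKernel_eq_lintegral_feature s hs]
  change ∫⁻ x, ∫⁻ z, ∫⁻ p, feature p x * feature p z ∂(truncFeatureMeasure n s T) ∂ρ ∂τ = _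
  calc ∫⁻ x, ∫⁻ z, ∫⁻ p, feature p x * feature p z ∂(truncFeatureMeasure n s T) ∂ρ ∂τ
      = ∫⁻ x, ∫⁻ p, feature p x * meanFeature ρ p ∂(truncFeatureMeasure n s T) ∂τ := by
        refine lintegral_congr fun x => ?_
        rw [lintegral_lintegral_swap (by fun_prop)]
        refine lintegral_congr fun p => ?_
        rw [lintegral_const_mul _ (by fun_prop), meanFeature]
    _ = ∫⁻ p, ∫⁻ x, feature p x * meanFeature ρ p ∂τ ∂(truncFeatureMeasure n s T) := by
        rw [lintegral_lintegral_swap]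
        have h2 : Measurable fun q : Space n × (ℝ × Space n) => feature q.2 q.1 :=
          measurable_feature.comp measurable_swap
        exact (h2.mul ((measurable_meanFeature ρ).comp measurable_snd)).aemeasurable
    _ = _ := by
        refine lintegral_congr fun p => ?_
        rw [lintegral_mul_const _ (by fun_prop), mul_comm]
        rfl

lemma lintegral_truncKernel_ne_top (s : ℝ) (hs : 0 < s) (T : ℝ) (ρ τ : Measure (Space n))
    [IsFiniteMeasure ρ] [IsFiniteMeasure τ] : ∫⁻ x, ∫⁻ z, truncKernel s T x z ∂ρ ∂τ ≠ ⊤ := by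
  refine ((lintegral_mono fun x => lintegral_truncKernel_le s T ρ x).trans_lt ?_).ne
  rw [lintegral_const]
  exact ENNReal.mul_lt_top (ENNReal.mul_lt_top (truncBound_ne_top s hs T).lt_top
    (measure_lt_top ρ _)) (measure_lt_top τ _)

/-- The truncated energy is an `L²` inner product of mean features, finite because the truncated
kernel is bounded, so signed combinations of measures can be handled in `ℝ`. -/
lemma gram_eq_integral (s : ℝ) (hs : 0 < s) (T : ℝ) (ρ τ : Measure (Space n))
    [IsFiniteMeasure ρ] [IsFiniteMeasure τ] :
    Integrable (fun p => (meanFeature ρ p).toReal * (meanFeature τ p).toReal)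
        (truncFeatureMeasure n s T) ∧
      gram s T ρ τ = ∫ p, (meanFeature ρ p).toReal * (meanFeature τ p).toReal
        ∂(truncFeatureMeasure n s T) := by
  have hfin := lintegral_truncKernel_ne_top s hs T ρ τ
  have hm : Measurable fun p => meanFeature ρ p * meanFeature τ p := by fun_prop
  rw [lintegral_truncKernel s hs] at hfin
  simp_rw [← ENNReal.toReal_mul]
  refine ⟨integrable_toReal_of_lintegral_ne_top hm.aemeasurable hfin, ?_⟩
  rw [gram, lintegral_truncKernel s hs,
    integral_toReal hm.aemeasurable (ae_lt_top hm hfin)]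

/-- The truncated energy `g_T(ρ - Mμ, ρ - Mμ)`. -/
noncomputable def discrepancy (s T : ℝ) (ρ μ : Measure (Space n)) (M : ℝ) : ℝ :=
  gram s T ρ ρ - 2 * M * gram s T ρ μ + M ^ 2 * gram s T μ μ

lemma discrepancy_eq_integral (s : ℝ) (hs : 0 < s) (T : ℝ) (ρ μ : Measure (Space n))
    [IsFiniteMeasure ρ] [IsFiniteMeasure μ] (M : ℝ) :
    Integrable (fun p => ((meanFeature ρ p).toReal - M * (meanFeature μ p).toReal) ^ 2)
        (truncFeatureMeasure n s T) ∧
      discrepancy s T ρ μ M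
        = ∫ p, ((meanFeature ρ p).toReal - M * (meanFeature μ p).toReal) ^ 2
          ∂(truncFeatureMeasure n s T) := by
  obtain ⟨i1, e1⟩ := gram_eq_integral s hs T ρ ρ
  obtain ⟨i2, e2⟩ := gram_eq_integral s hs T ρ μ
  obtain ⟨i3, e3⟩ := gram_eq_integral s hs T μ μ
  have hsplit : (fun p => ((meanFeature ρ p).toReal - M * (meanFeature μ p).toReal) ^ 2)
      = fun p => ((meanFeature ρ p).toReal * (meanFeature ρ p).toReal
        - 2 * M * ((meanFeature ρ p).toReal * (meanFeature μ p).toReal))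
        + M ^ 2 * ((meanFeature μ p).toReal * (meanFeature μ p).toReal) := by
    ext p; ring
  have i4 : Integrable (fun p => (meanFeature ρ p).toReal * (meanFeature ρ p).toReal
        - 2 * M * ((meanFeature ρ p).toReal * (meanFeature μ p).toReal))
        (truncFeatureMeasure n s T) := i1.sub (i2.const_mul _)
  rw [hsplit]
  refine ⟨i4.add (i3.const_mul _), ?_⟩
  rw [integral_add i4 (i3.const_mul _), integral_sub i1 (i2.const_mul _), integral_const_mul,
    integral_const_mul, ← e1, ← e2, ← e3, discrepancy]

/-- More scales means integrating the same square over a larger set. -/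
lemma discrepancy_mono (s : ℝ) (hs : 0 < s) {T T' : ℝ} (hT : T ≤ T') (ρ μ : Measure (Space n))
    [IsFiniteMeasure ρ] [IsFiniteMeasure μ] (M : ℝ) :
    discrepancy s T ρ μ M ≤ discrepancy s T' ρ μ M := by
  rw [(discrepancy_eq_integral s hs T ρ μ M).2, (discrepancy_eq_integral s hs T' ρ μ M).2]
  refine integral_mono_measure ?_ (ae_of_all _ fun p => sq_nonneg _)
    (discrepancy_eq_integral s hs T' ρ μ M).1
  exact Measure.restrict_mono (Set.prod_mono (Set.Iic_subset_Iic.2 hT) le_rfl) le_rfl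

/-- The Cauchy–Schwarz inequality for the truncated energy. -/
lemma sq_gram_sub_le (s : ℝ) (hs : 0 < s) (T : ℝ) (τ ρ μ : Measure (Space n))
    [IsFiniteMeasure τ] [IsFiniteMeasure ρ] [IsFiniteMeasure μ] (M : ℝ) :
    (gram s T τ ρ - M * gram s T τ μ) ^ 2 ≤ gram s T τ τ * discrepancy s T ρ μ M := by
  obtain ⟨i1, e1⟩ := gram_eq_integral s hs T τ τ
  obtain ⟨i2, e2⟩ := gram_eq_integral s hs T τ ρ
  obtain ⟨i3, e3⟩ := gram_eq_integral s hs T τ μ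
  obtain ⟨i4, e4⟩ := discrepancy_eq_integral s hs T ρ μ M
  -- The energy of `tτ + ρ - Mμ` is nonnegative for every real `t`; Cauchy–Schwarz is its
  -- discriminant condition.
  have hq : ∀ t : ℝ, 0 ≤ gram s T τ τ * (t * t)
      + (2 * (gram s T τ ρ - M * gram s T τ μ)) * t + discrepancy s T ρ μ M := by
    intro t
    have hnn : 0 ≤ ∫ p, (t * (meanFeature τ p).toReal
        + ((meanFeature ρ p).toReal - M * (meanFeature μ p).toReal)) ^ 2
          ∂(truncFeatureMeasure n s T) := integral_nonneg fun p => sq_nonneg _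
    have hsplit : (fun p => (t * (meanFeature τ p).toReal
        + ((meanFeature ρ p).toReal - M * (meanFeature μ p).toReal)) ^ 2)
        = fun p => (t * t * ((meanFeature τ p).toReal * (meanFeature τ p).toReal)
          + (2 * t * ((meanFeature τ p).toReal * (meanFeature ρ p).toReal)
          - 2 * t * M * ((meanFeature τ p).toReal * (meanFeature μ p).toReal)))
          + ((meanFeature ρ p).toReal - M * (meanFeature μ p).toReal) ^ 2 := by
      ext p; ring
    have j1 : Integrable (fun p => 2 * t * ((meanFeature τ p).toReal * (meanFeature ρ p).toReal)
          - 2 * t * M * ((meanFeature τ p).toReal * (meanFeature μ p).toReal))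
          (truncFeatureMeasure n s T) := (i2.const_mul _).sub (i3.const_mul _)
    have j2 : Integrable (fun p => t * t * ((meanFeature τ p).toReal * (meanFeature τ p).toReal)
          + (2 * t * ((meanFeature τ p).toReal * (meanFeature ρ p).toReal)
          - 2 * t * M * ((meanFeature τ p).toReal * (meanFeature μ p).toReal)))
          (truncFeatureMeasure n s T) := (i1.const_mul _).add j1
    rw [hsplit, integral_add j2 i4, integral_add (i1.const_mul _) j1,
      integral_sub (i2.const_mul _) (i3.const_mul _), integral_const_mul, integral_const_mul,
      integral_const_mul, ← e1, ← e2, ← e3, ← e4] at hnn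
    linarith
  have := discrim_le_zero hq
  rw [discrim] at this
  nlinarith

/-- The empirical measure `∑_j δ_{y_j}`, without normalisation. -/
noncomputable def empirical {M : ℕ} (y : Fin M → Space n) : Measure (Space n) :=
  ∑ j, Measure.dirac (y j)

instance {M : ℕ} (y : Fin M → Space n) : IsFiniteMeasure (empirical y) := by
  unfold empirical; infer_instance

lemma lintegral_empirical {M : ℕ} (y : Fin M → Space n) (f : Space n → ℝ≥0∞) :
    ∫⁻ x, f x ∂(empirical y) = ∑ j, f (y j) := by
  simp [empirical, lintegral_finsetSum_measure]

lemma truncKernel_ne_top (s : ℝ) (hs : 0 < s) (T : ℝ) (x z : Space n) :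
    truncKernel s T x z ≠ ⊤ :=
  ((truncKernel_le_bound s T x z).trans_lt (truncBound_ne_top s hs T).lt_top).ne

lemma truncKernel_comm (s T : ℝ) (x z : Space n) : truncKernel s T x z = truncKernel s T z x := by
  simp only [truncKernel, scaleKernel, norm_sub_rev x z]

/-- The real potential generated by `μ` through the truncated kernel. -/
noncomputable def truncPotential (s T : ℝ) (μ : Measure (Space n)) (x : Space n) : ℝ :=
  (∫⁻ z, truncKernel s T x z ∂μ).toReal

lemma gram_empirical (s : ℝ) (hs : 0 < s) (T : ℝ) (μ : Measure (Space n)) [IsFiniteMeasure μ]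
    {M : ℕ} (y : Fin M → Space n) :
    gram s T (empirical y) μ = ∑ j, truncPotential s T μ (y j) := by
  have hfin : ∀ j, ∫⁻ z, truncKernel s T (y j) z ∂μ ≠ ⊤ := fun j =>
    ((lintegral_truncKernel_le s T μ _).trans_lt (ENNReal.mul_lt_top
      (truncBound_ne_top s hs T).lt_top (measure_lt_top μ _))).ne
  unfold gram truncPotential
  simp_rw [lintegral_empirical]
  rw [lintegral_finsetSum _ fun j _ => ?_, ENNReal.toReal_sum]
  · simp_rw [truncKernel_comm s T _ (y _)]
  · intro j _
    simp_rw [truncKernel_comm s T _ (y _)]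
    exact hfin j
  · simp_rw [truncKernel_comm s T _ (y _)]
    fun_prop

lemma gram_empirical_self (s : ℝ) (hs : 0 < s) (T : ℝ) {M : ℕ} (y : Fin M → Space n) :
    gram s T (empirical y) (empirical y) = ∑ i, ∑ j, (truncKernel s T (y i) (y j)).toReal := by
  rw [gram_empirical s hs]
  refine Finset.sum_congr rfl fun i _ => ?_
  rw [truncPotential, lintegral_empirical, ENNReal.toReal_sum fun j _ => truncKernel_ne_top s hs _ _ _]

lemma gram_dirac (s T : ℝ) (μ : Measure (Space n)) [SFinite μ] (x : Space n) :
    gram s T μ (Measure.dirac x) = truncPotential s T μ x := by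
  simp [gram, truncPotential]

lemma gram_comm (s T : ℝ) (ρ τ : Measure (Space n)) [SFinite ρ] [SFinite τ] :
    gram s T ρ τ = gram s T τ ρ := by
  unfold gram
  rw [lintegral_lintegral_swap (measurable_scaleKernel s _).aemeasurable]
  simp_rw [truncKernel_comm s T]

/-- Cauchy–Schwarz against `δ_x`, whose truncated self-energy is the same for all `x`: hence the
uniformity in `x`. The discrepancy may be taken at a finer scale `T' ≥ T`, which is needed to choose
the two scales one after the other. -/
lemma sq_sum_truncKernel_sub_le (s : ℝ) (hs : 0 < s) {T T' : ℝ} (hT : T ≤ T')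
    (μ : Measure (Space n)) [IsFiniteMeasure μ] {M : ℕ} (y : Fin M → Space n) (x : Space n) :
    (∑ j, (truncKernel s T x (y j)).toReal - M * truncPotential s T μ x) ^ 2
      ≤ (truncBound n s T).toReal * discrepancy s T' (empirical y) μ M := by
  have h := sq_gram_sub_le s hs T (Measure.dirac x) (empirical y) μ M
  rw [gram_comm s T _ (empirical y), gram_comm s T _ μ, gram_dirac, gram_dirac, gram_dirac] at h
  have h1 : truncPotential s T (Measure.dirac x) x = (truncBound n s T).toReal := by
    simp [truncPotential, truncKernel_self]
  have h2 : truncPotential s T (empirical y) x = ∑ j, (truncKernel s T x (y j)).toReal := by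
    rw [truncPotential, lintegral_empirical,
      ENNReal.toReal_sum fun j _ => truncKernel_ne_top s hs _ _ _]
  rw [h1, h2] at h
  exact h.trans (mul_le_mul_of_nonneg_left (discrepancy_mono s hs hT _ _ _) ENNReal.toReal_nonneg)

end Gram

/-! ### The law of large numbers -/

section MeanField

variable {n : ℕ}

lemma lintegral_pi_prod {E : Type*} [MeasurableSpace E] (ν : Measure E) [SigmaFinite ν] (M : ℕ)
    {f : Fin M → E → ℝ≥0∞} (hf : ∀ i, Measurable (f i)) :
    ∫⁻ y, ∏ i, f i (y i) ∂(Measure.pi fun _ : Fin M => ν) = ∏ i, ∫⁻ x, f i x ∂ν := by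
  induction M with
  | zero => simp
  | succ M ih =>
    have hm : Measurable fun y : Fin (M + 1) → E => ∏ i, f i (y i) := by
      have := fun i => (hf i).comp (measurable_pi_apply (X := fun _ => E) i)
      exact Finset.measurable_fun_prod _ fun i _ => this i
    have hm' : Measurable fun y : Fin M → E => ∏ i, f (Fin.succ i) (y i) := by
      have := fun i => (hf (Fin.succ i)).comp (measurable_pi_apply (X := fun _ => E) i)
      exact Finset.measurable_fun_prod _ fun i _ => this i
    rw [← (measurePreserving_piFinSuccAbove (fun _ : Fin (M + 1) => ν) 0).symm.lintegral_comp hm]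
    have h : ∀ q : E × (Fin M → E),
        ∏ i, f i ((MeasurableEquiv.piFinSuccAbove (fun _ : Fin (M + 1) => E) 0).symm q i)
          = f 0 q.1 * ∏ i, f (Fin.succ i) (q.2 i) := by
      intro q
      rw [Fin.prod_univ_succ]
      rfl
    simp_rw [h]
    rw [lintegral_prod_mul (hf 0).aemeasurable hm'.aemeasurable, ih fun i => hf _,
      Fin.prod_univ_succ]

lemma pi_withDensity {E : Type*} [MeasureSpace E] [SigmaFinite (volume : Measure E)] (M : ℕ)
    (μ : Measure E) [SigmaFinite μ] {m : E → ℝ≥0∞} (hm : Measurable m)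
    (h : μ = volume.withDensity m) :
    (Measure.pi fun _ : Fin M => μ) = volume.withDensity fun y => ∏ i, m (y i) := by
  refine Measure.pi_eq fun S hS => ?_
  rw [withDensity_apply _ (MeasurableSet.univ_pi hS), ← lintegral_indicator (MeasurableSet.univ_pi hS)]
  have h1 : ∀ y : Fin M → E, (Set.univ.pi S).indicator (fun y => ∏ i, m (y i)) y
      = ∏ i, (S i).indicator m (y i) := by
    intro y
    by_cases hy : y ∈ Set.univ.pi S
    · rw [Set.indicator_of_mem hy]
      exact Finset.prod_congr rfl fun i _ => (Set.indicator_of_mem (hy i trivial) _).symm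
    · rw [Set.indicator_of_notMem hy]
      simp only [Set.mem_pi, Set.mem_univ, true_implies, not_forall] at hy
      obtain ⟨i, hi⟩ := hy
      exact (Finset.prod_eq_zero (Finset.mem_univ i) (Set.indicator_of_notMem hi _)).symm
  simp_rw [h1]
  rw [volume_pi, lintegral_pi_prod _ _ fun i => hm.indicator (hS i)]
  refine Finset.prod_congr rfl fun i _ => ?_
  rw [lintegral_indicator (hS i), h, withDensity_apply _ (hS i)]

/-- A Gibbs measure with weight `e^D` gives to `D` a larger mean than the reference measure. -/
lemma integral_le_integral_of_gibbs {Ω : Type*} [MeasurableSpace Ω] (ρ P : Measure Ω)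
    [IsProbabilityMeasure ρ] [IsProbabilityMeasure P] {D : Ω → ℝ} (hDm : Measurable D)
    (hD : Integrable D ρ) (hDP : Integrable D P) {K : ℝ≥0∞} (hKt : K ≠ ⊤)
    (hK : P = K • ρ.withDensity fun x => ENNReal.ofReal (Real.exp (D x))) :
    ∫ x, D x ∂ρ ≤ ∫ x, D x ∂P := by
  set a := ∫ x, D x ∂ρ with ha
  have hm : Measurable fun x => ENNReal.ofReal (Real.exp (D x)) := by fun_prop
  have hK0 : K ≠ 0 := by
    rintro rfl
    have := congrArg (fun m => m Set.univ) hK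
    simp at this
  have hint : Integrable (fun x => (D x - a) * Real.exp (D x)) ρ := by
    have h1 : Integrable (fun x => D x - a) P := hDP.sub (integrable_const a)
    rw [hK, integrable_smul_measure hK0 hKt,
      integrable_withDensity_iff hm (ae_of_all _ fun x => ENNReal.ofReal_lt_top)] at h1
    simpa only [ENNReal.toReal_ofReal (Real.exp_nonneg _)] using h1
  have h2 : ∫ x, (D x - a) ∂P = K.toReal * ∫ x, (D x - a) * Real.exp (D x) ∂ρ := by
    conv_lhs => rw [hK]
    rw [integral_smul_measure, integral_withDensity_eq_integral_toReal_smul hm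
      (ae_of_all _ fun x => ENNReal.ofReal_lt_top), smul_eq_mul]
    congr 1
    refine integral_congr_ae (ae_of_all _ fun x => ?_)
    simp [ENNReal.toReal_ofReal (Real.exp_nonneg _), mul_comm]
  -- `(D - a)(e^D - e^a) ≥ 0` pointwise, and `D - a` has mean zero under `ρ`.
  have h3 : 0 ≤ ∫ x, (D x - a) * Real.exp (D x) ∂ρ := by
    have h4 : ∫ x, (D x - a) * Real.exp a ∂ρ = 0 := by
      rw [integral_mul_const, integral_sub hD (integrable_const a)]
      simp [ha]
    rw [← h4]
    refine integral_mono ((hD.sub (integrable_const a)).mul_const _) hint fun x => ?_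
    rcases le_total a (D x) with h | h
    · exact mul_le_mul_of_nonneg_left (Real.exp_le_exp.2 h) (by linarith)
    · exact mul_le_mul_of_nonpos_left (Real.exp_le_exp.2 h) (by linarith)
  have h5 : ∫ x, (D x - a) ∂P = ∫ x, D x ∂P - a := by
    rw [integral_sub hDP (integrable_const a)]; simp
  have : 0 ≤ ∫ x, D x ∂P - a := by
    rw [← h5, h2]; exact mul_nonneg ENNReal.toReal_nonneg h3
  linarith

lemma lintegral_pi_rieszKernel (s : ℝ) (μ : Measure (Space n)) [IsProbabilityMeasure μ] {M : ℕ}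
    {i j : Fin M} (hij : i ≠ j) :
    ∫⁻ y, rieszKernel s (y i) (y j) ∂(Measure.pi fun _ : Fin M => μ) = interactionEnergy s μ := by
  have hind : ProbabilityTheory.iIndepFun (fun (i : Fin M) (y : Fin M → Space n) => y i)
      (Measure.pi fun _ : Fin M => μ) :=
    ProbabilityTheory.iIndepFun_pi (X := fun _ x => x) fun _ => aemeasurable_id
  have h2 := (ProbabilityTheory.indepFun_iff_map_prod_eq_prod_map_map
    (measurable_pi_apply i).aemeasurable (measurable_pi_apply j).aemeasurable).1
    (hind.indepFun hij)
  have hmap : ∀ k : Fin M, (Measure.pi fun _ : Fin M => μ).map (fun y => y k) = μ := fun k =>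
    (measurePreserving_eval (fun _ : Fin M => μ) k).map_eq
  rw [hmap, hmap] at h2
  have hg := measurable_rieszKernel (n := n) s
  have h3 := lintegral_map (μ := Measure.pi fun _ : Fin M => μ)
    (f := fun q : Space n × Space n => rieszKernel s q.1 q.2) hg
    ((measurable_pi_apply i).prodMk (measurable_pi_apply j))
  rw [h2, lintegral_prod _ hg.aemeasurable] at h3
  exact h3.symm

end MeanField

/-! ### The gas compared with independent particles of law `μ_γ`. -/

section Discrepancy

variable {n : ℕ}

lemma SelfConsistent.le_smul_volume {s α γ : ℝ} {μ : ProbabilityMeasure (Space n)} {L : ℝ}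
    (h : SelfConsistent s α γ μ L) :
    (μ : Measure (Space n)) ≤ (ENNReal.ofReal L)⁻¹ • volume := by
  rw [h.2]
  gcongr
  calc _ ≤ (volume : Measure (Space n)).withDensity 1 :=
        withDensity_mono (ae_of_all _ fun x => expNeg_le_one _)
    _ = _ := withDensity_one

/-- A uniform bound for the potential of the equilibrium measure. -/
noncomputable def meanFieldBound (n : ℕ) (s L : ℝ) : ℝ≥0∞ :=
  truncBound n s 1 + (ENNReal.ofReal L)⁻¹ * tailMass n s 1

lemma meanFieldBound_ne_top {s L : ℝ} (hs : 0 < s) (hsn : s < n) (hL : 0 < L) :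
    meanFieldBound n s L ≠ ⊤ :=
  ENNReal.add_ne_top.2 ⟨truncBound_ne_top s hs 1,
    ENNReal.mul_ne_top (by simpa using hL) (tailMass_ne_top s hs hsn one_pos)⟩

lemma SelfConsistent.generatedPotential_le [NeZero n] {s α γ : ℝ} (hs : 0 < s)
    {μ : ProbabilityMeasure (Space n)} {L : ℝ} (h : SelfConsistent s α γ μ L) (x : Space n) :
    generatedPotential s (μ : Measure (Space n)) x ≤ meanFieldBound n s L := by
  have := RieszGas.generatedPotential_le s hs h.le_smul_volume x
  rwa [measure_univ, mul_one] at this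

lemma SelfConsistent.generatedPotential_ne_top [NeZero n] {s α γ : ℝ} (hs : 0 < s) (hsn : s < n)
    {μ : ProbabilityMeasure (Space n)} {L : ℝ} (h : SelfConsistent s α γ μ L) (x : Space n) :
    generatedPotential s (μ : Measure (Space n)) x ≠ ⊤ :=
  ((h.generatedPotential_le hs x).trans_lt (meanFieldBound_ne_top hs hsn h.1).lt_top).ne

/-- The real-valued potential of the equilibrium measure. -/
noncomputable def realPotential (s : ℝ) (μ : Measure (Space n)) (x : Space n) : ℝ :=
  (generatedPotential s μ x).toReal

@[fun_prop] lemma measurable_realPotential (s : ℝ) (μ : Measure (Space n)) [SFinite μ] :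
    Measurable (realPotential s μ) := (measurable_generatedPotential s μ).ennreal_toReal

@[fun_prop] lemma measurable_truncPotential (s T : ℝ) (μ : Measure (Space n)) [SFinite μ] :
    Measurable (truncPotential s T μ) :=
  (Measurable.lintegral_prod_right' (measurable_scaleKernel s _)).ennreal_toReal

/-- The tail of the potential of the equilibrium measure. -/
noncomputable def tailBound (n : ℕ) (s L T : ℝ) : ℝ :=
  ((ENNReal.ofReal L)⁻¹ * tailMass n s T).toReal

lemma tendsto_tailBound {s L : ℝ} (hs : 0 < s) (hsn : s < n) (hL : 0 < L) :
    Tendsto (tailBound n s L) atTop (𝓝 0) := by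
  have h2 : Tendsto (fun T => (ENNReal.ofReal L)⁻¹ * tailMass n s T) atTop (𝓝 0) := by
    simpa using ENNReal.Tendsto.const_mul (tendsto_tailMass s hs hsn)
      (Or.inr (show (ENNReal.ofReal L)⁻¹ ≠ ⊤ by simpa using hL))
  exact (ENNReal.tendsto_toReal (by simp)).comp h2

/-- The self-consistent equation bounds the density of `μ` by `1/L`, since the potential is
nonnegative; so truncation costs the potential at most `tailBound`, uniformly in `x`. -/
lemma SelfConsistent.potential_bounds [NeZero n] {s α γ : ℝ} (hs : 0 < s) (hsn : s < n)
    {μ : ProbabilityMeasure (Space n)} {L : ℝ} (h : SelfConsistent s α γ μ L) {T : ℝ} (hT : 0 < T)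
    (x : Space n) :
    0 ≤ truncPotential s T (μ : Measure (Space n)) x ∧
    truncPotential s T (μ : Measure (Space n)) x ≤ realPotential s (μ : Measure (Space n)) x ∧
    realPotential s (μ : Measure (Space n)) x ≤ truncPotential s T (μ : Measure (Space n)) x
      + tailBound n s L T ∧
    realPotential s (μ : Measure (Space n)) x ≤ (meanFieldBound n s L).toReal := by
  have hU := h.generatedPotential_ne_top hs hsn x
  have heq := generatedPotential_eq_trunc_add_tail s hs T (μ : Measure (Space n)) x
  have hsum := hU
  rw [heq] at hsum
  obtain ⟨h1, h2⟩ := ENNReal.add_ne_top.1 hsum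
  refine ⟨ENNReal.toReal_nonneg, ENNReal.toReal_mono hU (heq ▸ le_self_add), ?_,
    ENNReal.toReal_mono (meanFieldBound_ne_top hs hsn h.1) (h.generatedPotential_le hs x)⟩
  rw [realPotential, heq, ENNReal.toReal_add h1 h2]
  refine add_le_add le_rfl (ENNReal.toReal_mono ?_ (lintegral_tailKernel_le s T x h.le_smul_volume))
  exact ENNReal.mul_ne_top (by simpa using h.1) (tailMass_ne_top s hs hsn hT)

/-- The Gibbs measure has density proportional to `e^{-β W + γ ∑ U}` with respect to `μ^{⊗M}`. -/
lemma SelfConsistent.exists_gibbsMeasure_eq [NeZero n] {s α γ : ℝ} (hs : 0 < s) (hsn : s < n)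
    (hα : 0 < α) (hγ : 0 ≤ γ) {μ : ProbabilityMeasure (Space n)} {L : ℝ}
    (h : SelfConsistent s α γ μ L) (β : ℝ) (M : ℕ) :
    ∃ K : ℝ≥0∞, K ≠ ⊤ ∧ gibbsMeasure n s α β M
      = K • (Measure.pi fun _ : Fin M => (μ : Measure (Space n))).withDensity fun y =>
        expNeg (ENNReal.ofReal β * pairEnergy s y) *
          ENNReal.ofReal (Real.exp (∑ j, γ * realPotential s (μ : Measure (Space n)) (y j))) := by
  obtain ⟨h0, ht⟩ := partitionFunction_ne_zero_and_ne_top (n := n) β hs hsn hα M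
  have hLt : (ENNReal.ofReal L)⁻¹ ≠ ⊤ := by simpa using h.1
  have hL0 : (ENNReal.ofReal L)⁻¹ ≠ 0 := by simp
  set U := generatedPotential s (μ : Measure (Space n)) with hU
  have hUm : Measurable U := measurable_generatedPotential s _
  have hV := measurable_potential (n := n) α
  set m : Space n → ℝ≥0∞ := fun x => (ENNReal.ofReal L)⁻¹ *
    expNeg (ENNReal.ofReal γ * U x + potential α x) with hm
  have hm0 : Measurable fun x => expNeg (ENNReal.ofReal γ * U x + potential α x) :=
    measurable_expNeg.comp (by fun_prop)
  have hmm : Measurable m := hm0.const_mul _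
  have hμ : (μ : Measure (Space n)) = volume.withDensity m := by
    refine h.2.trans ?_
    rw [← withDensity_smul _ hm0]; rfl
  have hpi := pi_withDensity M (μ : Measure (Space n)) hmm hμ
  have hdm : Measurable fun y : Fin M → Space n => expNeg (ENNReal.ofReal β * pairEnergy s y) *
      ENNReal.ofReal (Real.exp (∑ j, γ * realPotential s (μ : Measure (Space n)) (y j))) := by
    have := measurable_realPotential s (μ : Measure (Space n))
    exact (measurable_expNeg.comp (by fun_prop)).mul (by fun_prop)
  have hprod : Measurable fun y : Fin M → Space n => ∏ i, m (y i) :=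
    Finset.measurable_fun_prod _ fun i _ => hmm.comp (measurable_pi_apply i)
  refine ⟨(partitionFunction n s α β M)⁻¹ * (((ENNReal.ofReal L)⁻¹) ^ M)⁻¹,
    ENNReal.mul_ne_top (by simpa using h0) (by simp [hL0]), ?_⟩
  rw [gibbsMeasure_eq, mul_smul, hpi, ← withDensity_mul _ hprod hdm, boltzmannMeasure,
    ← withDensity_smul _ (hprod.mul hdm)]
  congr 2
  ext y
  simp only [Pi.smul_apply, Pi.mul_apply, smul_eq_mul, m]
  have hpt : ∀ x, expNeg (ENNReal.ofReal γ * U x)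
      * ENNReal.ofReal (Real.exp (γ * realPotential s (μ : Measure (Space n)) x)) = 1 := by
    intro x
    have hUt : U x ≠ ⊤ := h.generatedPotential_ne_top hs hsn x
    rw [expNeg_of_ne_top (ENNReal.mul_ne_top ENNReal.ofReal_ne_top hUt), ENNReal.toReal_mul,
      ENNReal.toReal_ofReal hγ, realPotential, ← ENNReal.ofReal_mul (Real.exp_nonneg _),
      ← Real.exp_add]
    simp [U]
  rw [Real.exp_sum, ENNReal.ofReal_prod_of_nonneg fun _ _ => Real.exp_nonneg _,
    Finset.prod_mul_distrib, Finset.prod_const, Finset.card_univ, Fintype.card_fin]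
  simp_rw [expNeg_add]
  rw [Finset.prod_mul_distrib]
  have hp1 : (∏ i, expNeg (ENNReal.ofReal γ * U (y i))) *
      ∏ i, ENNReal.ofReal (Real.exp (γ * realPotential s (μ : Measure (Space n)) (y i))) = 1 := by
    rw [← Finset.prod_mul_distrib]
    exact Finset.prod_eq_one fun i _ => hpt (y i)
  have hp2 : ((ENNReal.ofReal L)⁻¹ ^ M)⁻¹ * (ENNReal.ofReal L)⁻¹ ^ M = 1 :=
    ENNReal.inv_mul_cancel (pow_ne_zero _ hL0) (ENNReal.pow_ne_top hLt)
  have hen : expNeg (energy s α β y) = expNeg (ENNReal.ofReal β * pairEnergy s y)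
      * ∏ i, expNeg (potential α (y i)) := by
    rw [energy, expNeg_add, expNeg_sum]; rfl
  rw [hen]
  generalize (∏ i, expNeg (ENNReal.ofReal γ * U (y i))) = a at *
  generalize (∏ i, ENNReal.ofReal (Real.exp (γ * realPotential s (μ : Measure (Space n)) (y i)))) = b
    at *
  generalize (ENNReal.ofReal L)⁻¹ ^ M = c at *
  calc _ = 1 * 1 * (expNeg (ENNReal.ofReal β * pairEnergy s y)
      * ∏ i, expNeg (potential α (y i))) := by ring
    _ = (c⁻¹ * c) * (a * b) * (expNeg (ENNReal.ofReal β * pairEnergy s y)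
      * ∏ i, expNeg (potential α (y i))) := by rw [hp1, hp2]
    _ = _ := by ring

lemma lintegral_pi_pairEnergy_le (s : ℝ) (μ : Measure (Space n)) [IsProbabilityMeasure μ] (M : ℕ) :
    2 * ∫⁻ y, pairEnergy s y ∂(Measure.pi fun _ : Fin M => μ)
      ≤ (M : ℝ≥0∞) ^ 2 * interactionEnergy s μ := by
  have hm : ∀ i j : Fin M, Measurable fun y : Fin M → Space n =>
      if i = j then (0 : ℝ≥0∞) else rieszKernel s (y i) (y j) := by
    intro i j
    split_ifs
    · exact measurable_const
    · exact (measurable_pi_apply i).rieszKernel s (measurable_pi_apply j)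
  rw [← lintegral_const_mul _ (measurable_pairEnergy s)]
  simp_rw [two_mul_pairEnergy]
  rw [lintegral_finsetSum _ fun i _ => Finset.measurable_fun_sum _ fun j _ => hm i j]
  simp_rw [lintegral_finsetSum _ fun j (_ : j ∈ Finset.univ) => hm _ j]
  calc _ ≤ ∑ _i : Fin M, ∑ _j : Fin M, interactionEnergy s μ := by
        refine Finset.sum_le_sum fun i _ => Finset.sum_le_sum fun j _ => ?_
        by_cases hij : i = j
        · simp [hij]
        · simp only [hij, if_false]
          exact (lintegral_pi_rieszKernel s μ hij).le
    _ = _ := by simp [sq, mul_assoc]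

/-- The pair energy dominates the truncated energy, up to the self-energies. -/
lemma discrepancy_le_pairEnergy [NeZero n] (s : ℝ) (hs : 0 < s) (T : ℝ) (μ : Measure (Space n))
    [IsFiniteMeasure μ] {M : ℕ} {y : Fin M → Space n} (hy : pairEnergy s y ≠ ⊤) :
    discrepancy s T (empirical y) μ M
        + 2 * M * ∑ j, truncPotential s T μ (y j) - (M : ℝ) ^ 2 * gram s T μ μ
        - M * (truncBound n s T).toReal
      ≤ 2 * (pairEnergy s y).toReal := by
  have h1 : ∑ i, ∑ j, truncKernel s T (y i) (y j)
      ≤ 2 * pairEnergy s y + M * truncBound n s T := by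
    have : (M : ℝ≥0∞) * truncBound n s T
        = ∑ i : Fin M, ∑ j : Fin M, if i = j then truncBound n s T else 0 := by
      simp
    rw [two_mul_pairEnergy, this, ← Finset.sum_add_distrib]
    refine Finset.sum_le_sum fun i _ => ?_
    rw [← Finset.sum_add_distrib]
    refine Finset.sum_le_sum fun j _ => ?_
    by_cases hij : i = j
    · simp only [hij, if_true, zero_add]; exact truncKernel_le_bound s T _ _
    · simp only [hij, if_false, add_zero]; exact truncKernel_le s hs T _ _
  have h2 := ENNReal.toReal_mono (ENNReal.add_ne_top.2 ⟨ENNReal.mul_ne_top (by simp) hy,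
    ENNReal.mul_ne_top (by simp) (truncBound_ne_top s hs T)⟩) h1
  rw [ENNReal.toReal_add (ENNReal.mul_ne_top (by simp) hy)
    (ENNReal.mul_ne_top (by simp) (truncBound_ne_top s hs T)), ENNReal.toReal_mul,
    ENNReal.toReal_mul, ENNReal.toReal_sum fun i _ => ENNReal.sum_ne_top.2 fun j _ =>
      truncKernel_ne_top s hs _ _ _] at h2
  simp_rw [ENNReal.toReal_sum fun j (_ : j ∈ Finset.univ) => truncKernel_ne_top s hs T _ (y j)] at h2
  rw [← gram_empirical_self s hs] at h2
  simp only [ENNReal.toReal_ofNat, ENNReal.toReal_natCast] at h2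
  rw [discrepancy, gram_empirical s hs T μ]
  linarith

end Discrepancy

/-! ### The mean discrepancy of the gas. -/

section Discrepancy

variable {n : ℕ}

lemma measurable_comp_eval {X : Type*} [MeasurableSpace X] {u : Space n → X} (hu : Measurable u)
    {M : ℕ} (j : Fin M) : Measurable fun y : Fin M → Space n => u (y j) := by
  fun_prop

lemma truncPotential_nonneg (s T : ℝ) (μ : Measure (Space n)) (x : Space n) :
    0 ≤ truncPotential s T μ x := ENNReal.toReal_nonneg

lemma truncPotential_le (s : ℝ) (hs : 0 < s) (T : ℝ) (μ : Measure (Space n)) [IsProbabilityMeasure μ]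
    (x : Space n) : truncPotential s T μ x ≤ (truncBound n s T).toReal := by
  refine ENNReal.toReal_mono (truncBound_ne_top s hs T) ?_
  simpa using lintegral_truncKernel_le s T μ x

lemma discrepancy_empirical (s : ℝ) (hs : 0 < s) (T : ℝ) (μ : Measure (Space n)) [IsFiniteMeasure μ]
    {M : ℕ} (y : Fin M → Space n) (c : ℝ) :
    discrepancy s T (empirical y) μ c = ∑ i, ∑ j, (truncKernel s T (y i) (y j)).toReal
      - 2 * c * ∑ j, truncPotential s T μ (y j) + c ^ 2 * gram s T μ μ := by
  rw [discrepancy, gram_empirical_self s hs, gram_empirical s hs]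

lemma measurable_truncKernel_comp {Ω : Type*} [MeasurableSpace Ω] (s T : ℝ) {f g : Ω → Space n}
    (hf : Measurable f) (hg : Measurable g) : Measurable fun ω => truncKernel s T (f ω) (g ω) := by
  unfold truncKernel scaleKernel
  refine Measurable.lintegral_prod_right' (f := fun q : Ω × ℝ =>
    ENNReal.ofReal ((Real.Gamma (s / 2))⁻¹ * q.2 ^ (s / 2 - 1)) *
    ENNReal.ofReal (Real.exp (-(q.2 * ‖f q.1 - g q.1‖ ^ 2)))) ?_
  fun_prop

lemma integrable_discrepancy (s : ℝ) (hs : 0 < s) (T : ℝ) (μ : Measure (Space n))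
    [IsProbabilityMeasure μ] (M : ℕ) (c : ℝ) (P : Measure (Fin M → Space n)) [IsFiniteMeasure P] :
    Integrable (fun y => discrepancy s T (empirical y) μ c) P := by
  simp_rw [discrepancy_empirical s hs]
  have h2 := measurable_truncPotential s T μ
  refine ((integrable_finsetSum _ fun i _ => integrable_finsetSum _ fun j _ => ?_).sub
    ((integrable_finsetSum _ fun j _ => ?_).const_mul _)).add (integrable_const _)
  · refine Integrable.of_bound (Measurable.aestronglyMeasurable ?_) (truncBound n s T).toReal
      (ae_of_all _ fun y => ?_)
    · exact (measurable_truncKernel_comp s T (measurable_pi_apply i)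
      (measurable_pi_apply j)).ennreal_toReal
    · rw [Real.norm_of_nonneg ENNReal.toReal_nonneg]
      exact ENNReal.toReal_mono (truncBound_ne_top s hs T) (truncKernel_le_bound s T _ _)
  · refine Integrable.of_bound (measurable_comp_eval h2 j).aestronglyMeasurable
      (truncBound n s T).toReal (ae_of_all _ fun y => ?_)
    rw [Real.norm_of_nonneg (truncPotential_nonneg s T μ _)]
    exact truncPotential_le s hs T μ _

lemma gram_self_le [NeZero n] (s : ℝ) (hs : 0 < s) (T : ℝ) (μ : Measure (Space n))
    (hμ : interactionEnergy s μ ≠ ⊤) : gram s T μ μ ≤ (interactionEnergy s μ).toReal :=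
  ENNReal.toReal_mono hμ (lintegral_mono fun x => lintegral_mono fun z => truncKernel_le s hs T x z)

/-- The mean discrepancy between the empirical measure of the gas and the equilibrium measure. -/
theorem SelfConsistent.integral_discrepancy_le [NeZero n] {s α γ : ℝ} (hs : 0 < s) (hsn : s < n)
    (hα : 0 < α) (hγ : 0 ≤ γ) {μ : ProbabilityMeasure (Space n)} {L : ℝ}
    (h : SelfConsistent s α γ μ L) {β : ℝ} (hβ : 0 ≤ β) (M : ℕ) {T : ℝ} (hT : 0 < T) :
    β ^ 2 * ∫ y, discrepancy s T (empirical y) (μ : Measure (Space n)) M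
        ∂(gibbsMeasure n s α β M)
      ≤ β * M * (4 * |γ - β * M| * (meanFieldBound n s L).toReal + 2 * (β * M) * tailBound n s L T
        + β * (truncBound n s T).toReal) := by
  obtain ⟨K, hK, hgibbs⟩ := h.exists_gibbsMeasure_eq hs hsn hα hγ β M
  have hP := isProbabilityMeasure_gibbsMeasure (n := n) β hs hsn hα M
  set P := gibbsMeasure n s α β M with hPdef
  set ν : Measure (Space n) := (μ : Measure (Space n)) with hν
  set π := Measure.pi fun _ : Fin M => ν with hπ
  set u : Space n → ℝ := realPotential s ν with hu
  have hum : Measurable u := measurable_realPotential s ν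
  have hu0 : ∀ x, 0 ≤ u x := fun x => ENNReal.toReal_nonneg
  set B := (meanFieldBound n s L).toReal with hB
  have huB : ∀ x, u x ≤ B := fun x => (h.potential_bounds hs hsn hT x).2.2.2
  set W : (Fin M → Space n) → ℝ := fun y => (pairEnergy s y).toReal with hW
  have hWm : Measurable W := (measurable_pairEnergy s).ennreal_toReal
  -- Up to a constant, the log-density of the gas with respect to `μ^{⊗M}`. Its mean under the gas
  -- is at least its mean under independence; expanding both sides leaves the discrepancy, because
  -- the leading terms, of order `M`, cancel when `βM = γ`.
  set D : (Fin M → Space n) → ℝ := fun y => -(β * W y) + ∑ j, γ * u (y j) with hD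
  have hDm : Measurable D := by fun_prop
  -- the energies of the equilibrium measure
  have hIle : interactionEnergy s ν ≤ meanFieldBound n s L :=
    (lintegral_mono fun x => h.generatedPotential_le hs x).trans (by simp [hν])
  have hBt := meanFieldBound_ne_top (n := n) hs hsn h.1
  have hIt : interactionEnergy s ν ≠ ⊤ := (hIle.trans_lt hBt.lt_top).ne
  set I := (interactionEnergy s ν).toReal with hI
  have hIB : I ≤ B := ENNReal.toReal_mono hBt hIle
  have hI0 : 0 ≤ I := ENNReal.toReal_nonneg
  have hIT : gram s T ν ν ≤ I := gram_self_le s hs T ν hIt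
  have hui : ∫ x, u x ∂ν = I := by
    rw [hu, hI]
    exact integral_toReal (measurable_generatedPotential s ν).aemeasurable
      (ae_of_all _ fun x => (h.generatedPotential_ne_top hs hsn x).lt_top)
  -- integrability of the pair energy
  have hpair := lintegral_pi_pairEnergy_le s ν M
  have hpairt : ∫⁻ y, pairEnergy s y ∂π ≠ ⊤ := by
    intro htop
    rw [htop, ENNReal.mul_top (by simp)] at hpair
    exact ENNReal.mul_ne_top (by simp) hIt (top_le_iff.1 hpair)
  have hWfin : ∀ᵐ y ∂π, pairEnergy s y ≠ ⊤ :=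
    (ae_lt_top (measurable_pairEnergy s) hpairt).mono fun y hy => hy.ne
  have hWi : Integrable W π :=
    integrable_toReal_of_lintegral_ne_top (measurable_pairEnergy s).aemeasurable hpairt
  have hWint : 2 * ∫ y, W y ∂π ≤ (M : ℝ) ^ 2 * I := by
    rw [integral_toReal (measurable_pairEnergy s).aemeasurable
      (ae_lt_top (measurable_pairEnergy s) hpairt)]
    have := ENNReal.toReal_mono (ENNReal.mul_ne_top (by simp) hIt) hpair
    simpa [ENNReal.toReal_mul] using this
  have hsum1 : ∀ (Q : Measure (Fin M → Space n)) [IsFiniteMeasure Q] (j : Fin M),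
      Integrable (fun y => γ * u (y j)) Q := fun Q _ j =>
    (Integrable.of_bound (measurable_comp_eval hum j).aestronglyMeasurable B
      (ae_of_all _ fun y => (Real.norm_of_nonneg (hu0 (y j))).trans_le (huB _))).const_mul γ
  have hsumi : ∀ (Q : Measure (Fin M → Space n)) [IsFiniteMeasure Q],
      Integrable (fun y => ∑ j, γ * u (y j)) Q := fun Q _ =>
    integrable_finsetSum _ fun j _ => hsum1 Q j
  have hDi : Integrable D π := (hWi.const_mul β).neg.add (hsumi π)
  -- the density in real form
  have hgibbs' : P = K • π.withDensity fun y => ENNReal.ofReal (Real.exp (D y)) := by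
    rw [hgibbs]
    congr 1
    refine withDensity_congr_ae ?_
    filter_upwards [hWfin] with y hy
    rw [expNeg_of_ne_top (ENNReal.mul_ne_top ENNReal.ofReal_ne_top hy), ENNReal.toReal_mul,
      ENNReal.toReal_ofReal hβ, ← ENNReal.ofReal_mul (Real.exp_nonneg _), ← Real.exp_add]
  have hPac : P ≪ π := by
    rw [hgibbs']
    exact (withDensity_absolutelyContinuous _ _).smul_left _
  have hWP : Integrable W P := by
    rw [hgibbs']
    refine Integrable.smul_measure ?_ hK
    rw [integrable_withDensity_iff (by fun_prop) (ae_of_all _ fun x => ENNReal.ofReal_lt_top)]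
    simp only [ENNReal.toReal_ofReal (Real.exp_nonneg _)]
    refine (hWi.mul_const (Real.exp (M * (γ * B)))).mono' (by fun_prop) (ae_of_all _ fun y => ?_)
    have hW0 : 0 ≤ W y := ENNReal.toReal_nonneg
    rw [Real.norm_of_nonneg (mul_nonneg hW0 (Real.exp_nonneg _))]
    refine mul_le_mul_of_nonneg_left (Real.exp_le_exp.2 ?_) hW0
    have h1 : ∑ j, γ * u (y j) ≤ ∑ _j : Fin M, γ * B :=
      Finset.sum_le_sum fun j _ => mul_le_mul_of_nonneg_left (huB _) hγ
    have h2 : 0 ≤ β * W y := mul_nonneg hβ hW0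
    simp only [Finset.sum_const, Finset.card_univ, Fintype.card_fin, nsmul_eq_mul] at h1
    simp only [D]; linarith
  have hDP : Integrable D P := (hWP.const_mul β).neg.add (hsumi P)
  have hineq := integral_le_integral_of_gibbs π P hDm hDi hDP hK hgibbs'
  -- the mean of `D` under the product measure
  have hleft : -(β * ((M : ℝ) ^ 2 * I / 2)) + M * (γ * I) ≤ ∫ y, D y ∂π := by
    have e1 : ∫ y, D y ∂π = -(β * ∫ y, W y ∂π) + M * (γ * I) := by
      have hWn : Integrable (fun y => -(β * W y)) π := (hWi.const_mul β).neg
      rw [hD, integral_add hWn (hsumi π), integral_neg, integral_const_mul,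
        integral_finsetSum _ fun j _ => hsum1 π j]
      congr 1
      have : ∀ j : Fin M, ∫ y, γ * u (y j) ∂π = γ * I := by
        intro j
        rw [integral_const_mul, ← hui,
          ← (measurePreserving_eval (fun _ : Fin M => ν) j).map_eq,
          integral_map (measurable_pi_apply j).aemeasurable hum.aestronglyMeasurable]
      simp [this]
    rw [e1]
    have : β * ∫ y, W y ∂π ≤ β * ((M : ℝ) ^ 2 * I / 2) :=
      mul_le_mul_of_nonneg_left (by linarith) hβ
    linarith
  -- the mean of `D` under the Gibbs measure
  set b := β * M with hb
  have hb0 : 0 ≤ b := by positivity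
  set δ := tailBound n s L T with hδ
  set G := (truncBound n s T).toReal with hG
  -- Completing the square with the truncated kernel. Replacing `γ` by `b = βM` costs `|γ - b| B`
  -- per particle, truncating the potential costs `b δ` per particle, and the self-energies absent
  -- from the pair sum contribute `bG/2`.
  have hpt : ∀ᵐ y ∂P, D y ≤ -(β / 2) * discrepancy s T (empirical y) ν M
      + ((b / 2) * (M * gram s T ν ν + G) + M * (|γ - b| * B + b * δ)) := by
    filter_upwards [hPac.ae_le hWfin] with y hy
    have h1 := discrepancy_le_pairEnergy s hs T ν hy
    have h2 : ∑ j, γ * u (y j) ≤ b * ∑ j, truncPotential s T ν (y j)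
        + M * (|γ - b| * B + b * δ) := by
      have : ∀ j, γ * u (y j) ≤ b * truncPotential s T ν (y j) + (|γ - b| * B + b * δ) := by
        intro j
        have h3 := (h.potential_bounds hs hsn hT (y j)).2.2.1
        have h4 : (γ - b) * u (y j) ≤ |γ - b| * B :=
          mul_le_mul (le_abs_self _) (huB _) (hu0 _) (abs_nonneg _)
        have h5 := mul_le_mul_of_nonneg_left h3 hb0
        change b * u (y j) ≤ _ at h5
        linarith
      calc _ ≤ ∑ j, (b * truncPotential s T ν (y j) + (|γ - b| * B + b * δ)) :=
            Finset.sum_le_sum fun j _ => this j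
        _ = _ := by
            rw [Finset.sum_add_distrib, ← Finset.mul_sum]; simp
            ring
    have h6 := mul_le_mul_of_nonneg_left h1 (show 0 ≤ β / 2 by positivity)
    have h7 : β / 2 * (2 * W y) = β * W y := by ring
    rw [h7] at h6
    simp only [D]
    have h8 : β / 2 * (discrepancy s T (empirical y) ν M
        + 2 * M * ∑ j, truncPotential s T ν (y j) - (M : ℝ) ^ 2 * gram s T ν ν - M * G)
        = β / 2 * discrepancy s T (empirical y) ν M + b * ∑ j, truncPotential s T ν (y j)
          - (b / 2) * (M * gram s T ν ν + G) := by rw [hb]; ring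
    rw [h8] at h6
    linarith
  have hdi := integrable_discrepancy s hs T ν M M P
  have hright : ∫ y, D y ∂P ≤ -(β / 2) * ∫ y, discrepancy s T (empirical y) ν M ∂P
      + ((b / 2) * (M * gram s T ν ν + G) + M * (|γ - b| * B + b * δ)) := by
    have hdi' : Integrable (fun y => -(β / 2) * discrepancy s T (empirical y) ν M) P :=
      hdi.const_mul _
    refine (integral_mono_ae hDP (hdi'.add (integrable_const _)) hpt).trans_eq ?_
    simp only [Pi.add_apply]
    rw [integral_add hdi' (integrable_const _), integral_const_mul]
    simp
  -- conclusion
  set X := ∫ y, discrepancy s T (empirical y) ν M ∂P with hX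
  have hM0 : (0 : ℝ) ≤ M := Nat.cast_nonneg M
  have h9 : b / 2 * (M * gram s T ν ν) ≤ b / 2 * (M * I) := by gcongr
  have h10 : (b - γ) * I ≤ |γ - b| * B := by
    rw [abs_sub_comm]
    exact mul_le_mul (le_abs_self _) hIB hI0 (abs_nonneg _)
  have h11 := mul_le_mul_of_nonneg_left h10 hM0
  have h12 : β / 2 * X ≤ M * (2 * (|γ - b| * B) + b * δ) + b / 2 * G := by
    have e : β * ((M : ℝ) ^ 2 * I / 2) = b * M * I / 2 := by rw [hb]; ring
    rw [e] at hleft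
    linarith
  have h13 := mul_le_mul_of_nonneg_left h12 (show 0 ≤ 2 * β by positivity)
  calc β ^ 2 * X = 2 * β * (β / 2 * X) := by ring
    _ ≤ _ := h13
    _ = _ := by rw [hb]; ring

end Discrepancy

/-! ### The mean-field limit of the Boltzmann factor of an added particle. -/

section MeanField

variable {n : ℕ}

lemma abs_exp_neg_sub_exp_neg_le {a b : ℝ} (ha : 0 ≤ a) (hb : 0 ≤ b) :
    |Real.exp (-a) - Real.exp (-b)| ≤ |a - b| := by
  wlog hab : a ≤ b generalizing a b
  · rw [abs_sub_comm, abs_sub_comm a]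
    exact this hb ha (le_of_not_ge hab)
  have h1 : Real.exp (-b) ≤ Real.exp (-a) := Real.exp_le_exp.2 (by linarith)
  rw [abs_of_nonneg (by linarith), abs_of_nonpos (by linarith)]
  have h2 : Real.exp (-b) = Real.exp (-a) * Real.exp (-(b - a)) := by
    rw [← Real.exp_add]; ring_nf
  have h3 := Real.add_one_le_exp (-(b - a))
  have h4 : Real.exp (-a) ≤ 1 := Real.exp_le_one_iff.2 (by linarith)
  have h5 := Real.exp_pos (-a)
  rw [h2]
  nlinarith

lemma measurable_fieldFactor_right (s β : ℝ) {M : ℕ} (x : Space n) :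
    Measurable fun y : Fin M → Space n => fieldFactor s β x y :=
  Measurable.of_uncurry_left (f := fun (x : Space n) (y : Fin M → Space n) => fieldFactor s β x y)
    (measurable_fieldFactor s β)

lemma toReal_fieldFactor_le_one (s β : ℝ) {M : ℕ} (x : Space n) (y : Fin M → Space n) :
    (fieldFactor s β x y).toReal ≤ 1 :=
  ENNReal.toReal_le_of_le_ofReal zero_le_one (by simpa using fieldFactor_le_one s β x y)

lemma integrable_toReal_fieldFactor (s β : ℝ) {M : ℕ} (x : Space n)
    (Q : Measure (Fin M → Space n)) [IsFiniteMeasure Q] :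
    Integrable (fun y => (fieldFactor s β x y).toReal) Q := by
  have hm := measurable_fieldFactor_right s β (M := M) x
  have hm' : Measurable fun y : Fin M → Space n => (fieldFactor s β x y).toReal := by fun_prop
  refine Integrable.of_bound hm'.aestronglyMeasurable 1 (ae_of_all _ fun y => ?_)
  exact (Real.norm_of_nonneg ENNReal.toReal_nonneg).trans_le (toReal_fieldFactor_le_one s β x y)

lemma measurable_tailKernel_eval (s T : ℝ) {M : ℕ} (x : Space n) (j : Fin M) :
    Measurable fun y : Fin M → Space n => tailKernel s T x (y j) :=
  measurable_comp_eval (measurable_tailKernel_right s T x) j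

/-- The mean contribution of the small scales to the field. -/
lemma lintegral_sum_tailKernel_le [NeZero n] {s α β : ℝ} (hs : 0 < s) (hsn : s < n) (hα : 0 < α)
    {M : ℕ} {b : ℝ≥0∞} (hb : ENNReal.ofReal β * M ≤ b) (T : ℝ) (x : Space n) :
    ∫⁻ y, ENNReal.ofReal β * ∑ j, tailKernel s T x (y j) ∂(gibbsMeasure n s α β M)
      ≤ b * ((ratioBound n s α b)⁻¹ * tailMass n s T) := by
  have hm := fun j : Fin M => measurable_tailKernel_eval s T x j
  rw [lintegral_const_mul _ (by fun_prop), lintegral_finsetSum _ fun j _ => hm j]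
  calc _ ≤ ENNReal.ofReal β * ∑ _j : Fin M, ((ratioBound n s α b)⁻¹ * tailMass n s T) := by
        gcongr with j
        refine (lintegral_gibbsMeasure_apply_le hs hsn hα hb j
          (measurable_tailKernel_right s T x)).trans ?_
        gcongr
        simpa using lintegral_tailKernel_le s T x (weightMeasure_le (n := n) α)
    _ = ENNReal.ofReal β * M * ((ratioBound n s α b)⁻¹ * tailMass n s T) := by
        simp [mul_assoc]
    _ ≤ _ := by gcongr

/-- Since `t ↦ e^{-t}` is 1-Lipschitz on `[0, ∞)`, it suffices to compare the field with `γ U(x)`.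
The three groups on the right are the scales beyond `T`, handled by the marginal bound; the
fluctuation at scales up to `T`, handled by the discrepancy at scale `T'`; and the deterministic
error from replacing `βM` by `γ` and truncating `U`. -/
theorem SelfConsistent.integral_fieldFactor_sub_le [NeZero n] {s α γ : ℝ} (hs : 0 < s)
    (hsn : s < n) (hα : 0 < α) (hγ : 0 ≤ γ) {μ : ProbabilityMeasure (Space n)} {L : ℝ}
    (h : SelfConsistent s α γ μ L) {β : ℝ} (hβ : 0 ≤ β) (M : ℕ) {b : ℝ≥0∞}
    (hbt : b ≠ ⊤) (hb : ENNReal.ofReal β * M ≤ b) {T T' : ℝ} (hT : 0 < T) (hT' : T ≤ T')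
    {κ : ℝ} (hκ : 0 < κ) (x : Space n) :
    ∫ y, |(fieldFactor s β x y).toReal - Real.exp (-(γ * realPotential s (μ : Measure (Space n)) x))|
        ∂(gibbsMeasure n s α β M)
      ≤ (b * ((ratioBound n s α b)⁻¹ * tailMass n s T)).toReal + (κ + κ⁻¹ * (truncBound n s T).toReal
          * (β * M * (4 * |γ - β * M| * (meanFieldBound n s L).toReal
            + 2 * (β * M) * tailBound n s L T' + β * (truncBound n s T').toReal)))
        + (|β * M - γ| * (meanFieldBound n s L).toReal + γ * tailBound n s L T) := by
  have hP := isProbabilityMeasure_gibbsMeasure (n := n) β hs hsn hα M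
  set P := gibbsMeasure n s α β M with hPdef
  set ν : Measure (Space n) := (μ : Measure (Space n)) with hν
  set τ : (Fin M → Space n) → ℝ≥0∞ := fun y => ENNReal.ofReal β * ∑ j, tailKernel s T x (y j)
    with hτ
  have hτm : Measurable τ := by
    have hm := fun j : Fin M => measurable_tailKernel_eval s T x j
    fun_prop
  have hτint : ∫⁻ y, τ y ∂P ≤ b * ((ratioBound n s α b)⁻¹ * tailMass n s T) :=
    lintegral_sum_tailKernel_le hs hsn hα hb T x
  have hct : b * ((ratioBound n s α b)⁻¹ * tailMass n s T) ≠ ⊤ :=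
    ENNReal.mul_ne_top hbt (ENNReal.mul_ne_top
      (ENNReal.inv_ne_top.2 (ratioBound_ne_zero hs hsn hα hbt)) (tailMass_ne_top s hs hsn hT))
  have hτt : ∫⁻ y, τ y ∂P ≠ ⊤ := (hτint.trans_lt hct.lt_top).ne
  have hτi : Integrable (fun y => (τ y).toReal) P :=
    integrable_toReal_of_lintegral_ne_top hτm.aemeasurable hτt
  have hτr : ∫ y, (τ y).toReal ∂P ≤ (b * ((ratioBound n s α b)⁻¹ * tailMass n s T)).toReal := by
    rw [integral_toReal hτm.aemeasurable (ae_lt_top hτm hτt)]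
    exact ENNReal.toReal_mono hct hτint
  obtain ⟨hU0, hUU, hUδ, hUB⟩ := h.potential_bounds hs hsn hT x
  set U := realPotential s ν x with hU
  set UT := truncPotential s T ν x with hUT
  set B := (meanFieldBound n s L).toReal with hB
  set δ := tailBound n s L T with hδ
  set G := (truncBound n s T).toReal with hG
  have hG0 : 0 ≤ G := ENNReal.toReal_nonneg
  set X : (Fin M → Space n) → ℝ := fun y => ∑ j, (truncKernel s T x (y j)).toReal - M * UT with hX
  set Dsc : (Fin M → Space n) → ℝ := fun y => discrepancy s T' (empirical y) ν M with hDsc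
  have hDi : Integrable Dsc P := integrable_discrepancy s hs T' ν M M P
  have hXD : ∀ y, β * |X y| ≤ κ + κ⁻¹ * G * β ^ 2 * Dsc y := by
    intro y
    have h1 : X y ^ 2 ≤ G * Dsc y := sq_sum_truncKernel_sub_le s hs hT' ν y x
    -- Young's inequality in place of a square root of the mean discrepancy; `κ` is chosen small
    -- afterwards.
    have h2 : β * |X y| ≤ κ + κ⁻¹ * (β * |X y|) ^ 2 := by
      have h3 : 0 ≤ κ⁻¹ * (κ - β * |X y|) ^ 2 + β * |X y| := by positivity
      have h4 : κ⁻¹ * (κ - β * |X y|) ^ 2 = κ - 2 * (β * |X y|) + κ⁻¹ * (β * |X y|) ^ 2 := by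
        field_simp; ring
      linarith
    have h3 : (β * |X y|) ^ 2 ≤ β ^ 2 * (G * Dsc y) := by
      rw [mul_pow, sq_abs]; gcongr
    calc _ ≤ _ := h2
      _ ≤ κ + κ⁻¹ * (β ^ 2 * (G * Dsc y)) := by gcongr
      _ = _ := by ring
  have hpt : ∀ᵐ y ∂P, |(fieldFactor s β x y).toReal - Real.exp (-(γ * U))|
      ≤ (τ y).toReal + (κ + κ⁻¹ * G * β ^ 2 * Dsc y) + (|β * M - γ| * B + γ * δ) := by
    filter_upwards [ae_lt_top hτm hτt] with y hy
    set S : ℝ := ∑ j, (truncKernel s T x (y j)).toReal with hS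
    have hSt : ∑ j, truncKernel s T x (y j) ≠ ⊤ :=
      ENNReal.sum_ne_top.2 fun j _ => truncKernel_ne_top s hs T _ _
    have e1 : ENNReal.ofReal β * ∑ j, rieszKernel s x (y j)
        = ENNReal.ofReal β * ∑ j, truncKernel s T x (y j) + τ y := by
      simp only [hτ, rieszKernel_eq_trunc_add_tail s hs T, Finset.sum_add_distrib, mul_add]
    have ht1 : ENNReal.ofReal β * ∑ j, truncKernel s T x (y j) ≠ ⊤ :=
      ENNReal.mul_ne_top ENNReal.ofReal_ne_top hSt
    have e2 : (fieldFactor s β x y).toReal = Real.exp (-(β * S + (τ y).toReal)) := by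
      rw [fieldFactor, e1, toReal_expNeg (ENNReal.add_ne_top.2 ⟨ht1, hy.ne⟩),
        ENNReal.toReal_add ht1 hy.ne, ENNReal.toReal_mul, ENNReal.toReal_ofReal hβ,
        ENNReal.toReal_sum fun j _ => truncKernel_ne_top s hs T _ _]
    have hS0 : 0 ≤ S := Finset.sum_nonneg fun j _ => ENNReal.toReal_nonneg
    have hτ0 : 0 ≤ (τ y).toReal := ENNReal.toReal_nonneg
    rw [e2]
    refine (abs_exp_neg_sub_exp_neg_le (add_nonneg (mul_nonneg hβ hS0) hτ0)
      (mul_nonneg hγ (hU0.trans hUU))).trans ?_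
    have e3 : β * S + (τ y).toReal - γ * U
        = (τ y).toReal + β * X y + ((β * M - γ) * UT + γ * (UT - U)) := by
      simp only [hX]; ring
    rw [e3]
    refine (abs_add_le _ _).trans (add_le_add ((abs_add_le _ _).trans (add_le_add ?_ ?_))
      ((abs_add_le _ _).trans (add_le_add ?_ ?_)))
    · rw [abs_of_nonneg hτ0]
    · rw [abs_mul, abs_of_nonneg hβ]; exact hXD y
    · rw [abs_mul, abs_of_nonneg hU0]
      exact mul_le_mul_of_nonneg_left (hUU.trans hUB) (abs_nonneg _)
    · rw [abs_mul, abs_of_nonneg hγ]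
      refine mul_le_mul_of_nonneg_left ?_ hγ
      rw [abs_le]; constructor <;> linarith
  have hFi : Integrable (fun y => |(fieldFactor s β x y).toReal - Real.exp (-(γ * U))|) P := by
    have hF : Integrable (fun y => (fieldFactor s β x y).toReal) P :=
      integrable_toReal_fieldFactor s β x P
    exact (hF.sub (integrable_const _)).abs
  have hDi' : Integrable (fun y => κ⁻¹ * G * β ^ 2 * Dsc y) P := hDi.const_mul _
  have hDi'' : Integrable (fun y => κ + κ⁻¹ * G * β ^ 2 * Dsc y) P := (integrable_const κ).add hDi'
  have hsum : Integrable (fun y => (τ y).toReal + (κ + κ⁻¹ * G * β ^ 2 * Dsc y)) P := hτi.add hDi''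
  refine (integral_mono_ae hFi (hsum.add (integrable_const _)) hpt).trans ?_
  simp only [Pi.add_apply]
  rw [integral_add hsum (integrable_const _), integral_add hτi hDi'',
    integral_add (integrable_const κ) hDi', integral_const_mul]
  simp only [integral_const, probReal_univ, one_smul]
  have hmain := h.integral_discrepancy_le hs hsn hα hγ hβ M (hT.trans_le hT')
  have hfin : κ⁻¹ * G * β ^ 2 * ∫ y, Dsc y ∂P ≤ κ⁻¹ * G * (β * M * (4 * |γ - β * M| * B
      + 2 * (β * M) * tailBound n s L T' + β * (truncBound n s T').toReal)) := by
    rw [mul_assoc (κ⁻¹ * G)]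
    exact mul_le_mul_of_nonneg_left hmain (by positivity)
  linarith

/-- The mean-field limit: along a sequence of gases, the Boltzmann factor of a further particle at
`x` converges in mean to `e^{-γ U(x)}`, uniformly in `x`. -/
theorem SelfConsistent.eventually_integral_fieldFactor_sub_le [NeZero n] {s α γ : ℝ} (hs : 0 < s)
    (hsn : s < n) (hα : 0 < α) (hγ : 0 ≤ γ) {μ : ProbabilityMeasure (Space n)} {L : ℝ}
    (h : SelfConsistent s α γ μ L) {β : ℕ → ℝ} {M : ℕ → ℕ} (hβ : ∀ N, 0 < β N)
    (hβ0 : Tendsto β atTop (𝓝 0)) (hb : Tendsto (fun N => β N * M N) atTop (𝓝 γ)) {ε : ℝ}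
    (hε : 0 < ε) :
    ∀ᶠ N in atTop, ∀ x : Space n,
      ∫ y, |(fieldFactor s (β N) x y).toReal
        - Real.exp (-(γ * realPotential s (μ : Measure (Space n)) x))|
        ∂(gibbsMeasure n s α (β N) (M N)) ≤ ε := by
  set b : ℝ≥0∞ := ENNReal.ofReal (γ + 1) with hbdef
  have hbt : b ≠ ⊤ := ENNReal.ofReal_ne_top
  have hbev : ∀ᶠ N in atTop, ENNReal.ofReal (β N) * M N ≤ b := by
    filter_upwards [hb.eventually (gt_mem_nhds (show γ < γ + 1 by linarith))] with N hN
    rw [← ENNReal.ofReal_natCast, ← ENNReal.ofReal_mul (hβ N).le]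
    exact ENNReal.ofReal_le_ofReal hN.le
  -- first choose the truncation scale
  have hlim1 : Tendsto (fun T => (b * ((ratioBound n s α b)⁻¹ * tailMass n s T)).toReal
      + γ * tailBound n s L T) atTop (𝓝 0) := by
    have h1 : Tendsto (fun T => b * ((ratioBound n s α b)⁻¹ * tailMass n s T)) atTop
        (𝓝 (b * ((ratioBound n s α b)⁻¹ * 0))) :=
      ENNReal.Tendsto.const_mul (ENNReal.Tendsto.const_mul (tendsto_tailMass s hs hsn)
        (Or.inr (ENNReal.inv_ne_top.2 (ratioBound_ne_zero hs hsn hα hbt)))) (Or.inr hbt)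
    have h2 := (ENNReal.tendsto_toReal (by simp)).comp h1
    have h3 := (tendsto_tailBound (n := n) hs hsn h.1).const_mul γ
    simpa using h2.add h3
  obtain ⟨T, hT, hTε⟩ := ((eventually_gt_atTop (0 : ℝ)).and
    (hlim1.eventually (gt_mem_nhds (show (0 : ℝ) < ε / 3 by positivity)))).exists
  set κ : ℝ := ε / 9 with hκdef
  have hκ : 0 < κ := by positivity
  have hlim2 : Tendsto (fun T' => κ⁻¹ * (truncBound n s T).toReal
      * (γ * (2 * γ * tailBound n s L T'))) atTop (𝓝 0) := by
    simpa using (((tendsto_tailBound (n := n) hs hsn h.1).const_mul (2 * γ)).const_mul γ).const_mul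
      (κ⁻¹ * (truncBound n s T).toReal)
  -- `T'` is chosen after `T` and `κ`: the error contains `truncBound` at `T` times `tailBound` at
  -- `T'`. With a single scale this product is of order `T^{s - n/2}` and need not vanish.
  obtain ⟨T', hT', hTε'⟩ := ((eventually_ge_atTop T).and
    (hlim2.eventually (gt_mem_nhds (show (0 : ℝ) < ε / 9 by positivity)))).exists
  set B := (meanFieldBound n s L).toReal
  have hlim3 : Tendsto (fun N => κ⁻¹ * (truncBound n s T).toReal
      * (β N * M N * (4 * |γ - β N * M N| * B
        + 2 * (β N * M N) * tailBound n s L T' + β N * (truncBound n s T').toReal))) atTop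
      (𝓝 (κ⁻¹ * (truncBound n s T).toReal * (γ * (2 * γ * tailBound n s L T')))) := by
    have h1 : Tendsto (fun N => |γ - β N * M N|) atTop (𝓝 0) := by
      simpa using ((tendsto_const_nhds (x := γ)).sub hb).abs
    have h2 := (hb.mul ((((h1.const_mul 4).mul_const B).add
      ((hb.const_mul 2).mul_const (tailBound n s L T'))).add
      (hβ0.mul_const (truncBound n s T').toReal))).const_mul (κ⁻¹ * (truncBound n s T).toReal)
    simpa using h2
  have hlim4 : Tendsto (fun N => |β N * M N - γ| * B) atTop (𝓝 0) := by
    have h1 : Tendsto (fun N => |β N * M N - γ|) atTop (𝓝 0) := by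
      simpa using (hb.sub (tendsto_const_nhds (x := γ))).abs
    simpa using h1.mul_const B
  filter_upwards [hbev, hlim3.eventually (gt_mem_nhds hTε'),
    hlim4.eventually (gt_mem_nhds (show (0 : ℝ) < ε / 3 by positivity))] with N h1 h2 h3 x
  have h4 := h.integral_fieldFactor_sub_le hs hsn hα hγ (hβ N).le (M N) hbt h1 hT hT' hκ x
  linarith

end MeanField

/-! ### Second-order expansion of powers near one. -/

section Asymptotics

/-- The derivative `p((1+v)^{p-1} - 1)` is `O(v)`, and the mean value inequality gains one more
power. -/
lemma isBigO_one_add_rpow_sub (p : ℝ) :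
    (fun u : ℝ => (1 + u) ^ p - 1 - p * u) =O[𝓝 0] fun u => u ^ 2 := by
  have hd : ∀ q u : ℝ, -1 < u → HasDerivAt (fun u : ℝ => (1 + u) ^ q) (q * (1 + u) ^ (q - 1)) u := by
    intro q u hu
    have h1 : HasDerivAt (fun u : ℝ => 1 + u) 1 u := (hasDerivAt_id u).const_add 1
    simpa using h1.rpow_const (p := q) (Or.inl (by linarith : (1 + u : ℝ) ≠ 0))
  have hO := (hd (p - 1) 0 (by norm_num)).isBigO_sub
  obtain ⟨C, hC⟩ := hO.bound
  rw [Metric.eventually_nhds_iff] at hC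
  obtain ⟨δ, hδ, hC⟩ := hC
  rw [Asymptotics.isBigO_iff]
  refine ⟨|p| * C, ?_⟩
  rw [Metric.eventually_nhds_iff]
  refine ⟨min δ 1, by positivity, fun u hu => ?_⟩
  rw [Real.dist_eq, sub_zero] at hu
  have hmem : ∀ v ∈ Set.uIcc 0 u, |v| ≤ |u| := fun v hv => by
    simpa using Set.abs_sub_left_of_mem_uIcc hv
  have hC0 : 0 ≤ |p| * C * |u| := by
    have h1 := hC (y := u) (by rw [Real.dist_eq, sub_zero]; exact hu.trans_le (min_le_left _ _))
    have h2 : 0 ≤ C * |u| := by simpa using (norm_nonneg _).trans h1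
    rw [mul_assoc]; positivity
  have key := Convex.norm_image_sub_le_of_norm_hasDerivWithin_le (𝕜 := ℝ)
    (f := fun u : ℝ => (1 + u) ^ p - 1 - p * u) (f' := fun u => p * ((1 + u) ^ (p - 1) - 1))
    (s := Set.uIcc 0 u) (C := |p| * C * |u|) (x := 0) (y := u) ?_ ?_ (convex_uIcc 0 u)
    Set.left_mem_uIcc Set.right_mem_uIcc
  · simp only [add_zero, Real.one_rpow, sub_self, mul_zero, sub_zero] at key
    refine key.trans_eq ?_
    rw [norm_pow, Real.norm_eq_abs]; ring
  · intro v hv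
    have hv1 : |v| < 1 := (hmem v hv).trans_lt (hu.trans_le (min_le_right _ _))
    have h1 : HasDerivAt (fun u : ℝ => (1 + u) ^ p - 1 - p * u)
        (p * (1 + v) ^ (p - 1) - p * 1) v :=
      ((hd p v (abs_lt.1 hv1).1).sub_const 1).sub ((hasDerivAt_id v).const_mul p)
    exact (h1.congr_deriv (by ring)).hasDerivWithinAt
  · intro v hv
    have hvd : dist v 0 < δ := by
      rw [Real.dist_eq, sub_zero]; exact (hmem v hv).trans_lt (hu.trans_le (min_le_left _ _))
    have h1 := hC hvd
    simp only [add_zero, Real.one_rpow, sub_zero, Real.norm_eq_abs] at h1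
    rw [norm_mul, Real.norm_eq_abs, Real.norm_eq_abs, mul_assoc]
    refine mul_le_mul_of_nonneg_left (h1.trans ?_) (abs_nonneg p)
    rcases le_or_gt 0 C with hC' | hC'
    · exact mul_le_mul_of_nonneg_left (hmem v hv) hC'
    · have h2 : 0 ≤ C * |v| := (abs_nonneg _).trans h1
      have h3 : |v| = 0 := by
        by_contra h
        have := mul_neg_of_neg_of_pos hC' (lt_of_le_of_ne (abs_nonneg v) (Ne.symm h))
        linarith
      have h4 : 0 ≤ C * |u| := by
        have h1 := hC (y := u) (by rw [Real.dist_eq, sub_zero]; exact hu.trans_le (min_le_left _ _))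
        simpa using (norm_nonneg _).trans h1
      rw [h3, mul_zero]; exact h4

/-- Used with `a` growing like `log N` or `η^α`: the linear term of the expansion survives and the
remainder vanishes as soon as `a u² → 0`. -/
lemma tendsto_mul_one_add_rpow_sub {ι : Type*} {l : Filter ι} {a u : ι → ℝ} (p : ℝ)
    (hu : Tendsto u l (𝓝 0)) (hau : Tendsto (fun i => a i * u i ^ 2) l (𝓝 0)) :
    Tendsto (fun i => a i * ((1 + u i) ^ p - 1 - p * u i)) l (𝓝 0) := by
  have h1 : (fun i => a i * ((1 + u i) ^ p - 1 - p * u i)) =O[l] fun i => a i * u i ^ 2 :=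
    (Asymptotics.isBigO_refl a l).mul ((isBigO_one_add_rpow_sub p).comp_tendsto hu)
  exact h1.trans_tendsto hau

end Asymptotics

/-! ### Asymptotics of the radius `η_N`. -/

section Edge

lemma tendsto_log_natCast : Tendsto (fun N : ℕ => Real.log N) atTop atTop :=
  Real.tendsto_log_atTop.comp tendsto_natCast_atTop_atTop

lemma tendsto_log_pow_div (k : ℕ) : Tendsto (fun x : ℝ => Real.log x ^ k / x) atTop (𝓝 0) := by
  simpa using (Real.isLittleO_pow_log_id_atTop (n := k)).tendsto_div_nhds_zero

/-- The correction `u_N` in `η_N = (log N)^{1/α} (1 + u_N)`. -/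
noncomputable def edgeCorrection (n : ℕ) (α L : ℝ) (N : ℕ) : ℝ :=
  -((n * (α - 1) / α ^ 2) * (Real.log (Real.log N) / Real.log N)
      + Real.log (α ^ n * L) / (α * Real.log N))

lemma edgeRadius_eq (n : ℕ) (α L : ℝ) (N : ℕ) :
    edgeRadius n α L N = Real.log N ^ (1 / α) * (1 + edgeCorrection n α L N) := by
  rw [edgeRadius, edgeCorrection]; ring

lemma edgeCorrection_eq (n : ℕ) {α : ℝ} (hα : 0 < α) (L : ℝ) (N : ℕ) :
    edgeCorrection n α L N = -(((n * (α - 1) / α ^ 2) * Real.log (Real.log N)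
      + Real.log (α ^ n * L) / α) / Real.log N) := by
  rw [edgeCorrection]
  rcases eq_or_ne (Real.log N) 0 with h | h
  · simp [h]
  · field_simp

/-- The correction is of order `log log N / log N`, so its square still vanishes after
multiplication by `log N`, the condition of `tendsto_mul_one_add_rpow_sub`. -/
lemma tendsto_edgeCorrection (n : ℕ) {α : ℝ} (hα : 0 < α) (L : ℝ) :
    Tendsto (edgeCorrection n α L) atTop (𝓝 0) ∧
    Tendsto (fun N : ℕ => Real.log N * edgeCorrection n α L N ^ 2) atTop (𝓝 0) := by
  set a : ℝ := n * (α - 1) / α ^ 2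
  set c : ℝ := Real.log (α ^ n * L) / α
  have h0 : Tendsto (fun x : ℝ => 1 / x) atTop (𝓝 0) := by simpa using tendsto_log_pow_div 0
  have h1 : Tendsto (fun x : ℝ => Real.log x / x) atTop (𝓝 0) := by
    simpa using tendsto_log_pow_div 1
  have h2 := tendsto_log_pow_div 2
  constructor
  · have h3 : Tendsto (fun x : ℝ => -(a * (Real.log x / x) + c * (1 / x))) atTop (𝓝 0) := by
      simpa using ((h1.const_mul a).add (h0.const_mul c)).neg
    refine (h3.comp tendsto_log_natCast).congr fun N => ?_
    rw [edgeCorrection_eq n hα]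
    simp only [Function.comp_apply]
    ring
  · have h3 : Tendsto (fun x : ℝ => a ^ 2 * (Real.log x ^ 2 / x) + 2 * a * c * (Real.log x / x)
        + c ^ 2 * (1 / x)) atTop (𝓝 0) := by
      simpa using ((h2.const_mul (a ^ 2)).add (h1.const_mul (2 * a * c))).add
        (h0.const_mul (c ^ 2))
    refine (h3.comp tendsto_log_natCast).congr' ?_
    filter_upwards [tendsto_log_natCast.eventually_gt_atTop 0] with N hN
    rw [edgeCorrection_eq n hα]
    simp only [Function.comp_apply]
    change _ = Real.log N * (-((a * Real.log (Real.log N) + c) / Real.log N)) ^ 2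
    field_simp
    ring

lemma tendsto_edgeRadius (n : ℕ) {α : ℝ} (hα : 0 < α) (L : ℝ) :
    Tendsto (edgeRadius n α L) atTop atTop := by
  have h1 : Tendsto (fun N : ℕ => Real.log N ^ (1 / α)) atTop atTop :=
    (tendsto_rpow_atTop (by positivity)).comp tendsto_log_natCast
  have h2 : Tendsto (fun N => 1 + edgeCorrection n α L N) atTop (𝓝 1) := by
    simpa using (tendsto_edgeCorrection n hα L).1.const_add 1
  exact (h1.atTop_mul_pos one_pos h2).congr fun N => (edgeRadius_eq n α L N).symm

lemma eventually_edgeRadius_rpow (n : ℕ) {α : ℝ} (hα : 0 < α) (L : ℝ) :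
    ∀ᶠ N in atTop, edgeRadius n α L N ^ α = Real.log N * (1 + edgeCorrection n α L N) ^ α := by
  have h2 : Tendsto (fun N => 1 + edgeCorrection n α L N) atTop (𝓝 1) := by
    simpa using (tendsto_edgeCorrection n hα L).1.const_add 1
  filter_upwards [tendsto_log_natCast.eventually_gt_atTop 0, h2.eventually (lt_mem_nhds one_pos)]
    with N hN hu
  rw [edgeRadius_eq, Real.mul_rpow (by positivity) hu.le, ← Real.rpow_mul hN.le]
  field_simp
  simp

/-- `η_N^α = log N - (n(α-1)/α) log log N - log(αⁿ L) + o(1)`. -/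
lemma tendsto_edgeRadius_rpow_sub (n : ℕ) {α : ℝ} (hα : 0 < α) (L : ℝ) :
    Tendsto (fun N : ℕ => edgeRadius n α L N ^ α - Real.log N
      + n * (α - 1) / α * Real.log (Real.log N)) atTop (𝓝 (-Real.log (α ^ n * L))) := by
  obtain ⟨h1, h2⟩ := tendsto_edgeCorrection n hα L
  have h3 := (tendsto_mul_one_add_rpow_sub α h1 h2).add_const (-Real.log (α ^ n * L))
  rw [zero_add] at h3
  refine h3.congr' ?_
  filter_upwards [eventually_edgeRadius_rpow n hα L, tendsto_log_natCast.eventually_gt_atTop 0]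
    with N hN hl
  rw [hN]
  have : Real.log N * edgeCorrection n α L N = -((n * (α - 1) / α ^ 2) * Real.log (Real.log N)
      + Real.log (α ^ n * L) / α) := by
    rw [edgeCorrection_eq n hα]; field_simp
  calc _ = Real.log N * (1 + edgeCorrection n α L N) ^ α - Real.log N
        - α * (Real.log N * edgeCorrection n α L N) + -Real.log (α ^ n * L) := by ring
    _ = _ := by rw [this]; field_simp; ring

/-- The scaling constant of the edge map. -/
noncomputable def edgeScale (α η : ℝ) : ℝ := α⁻¹ * η ^ (1 - α)

lemma edgeScale_pos {α η : ℝ} (hα : 0 < α) (hη : 0 < η) : 0 < edgeScale α η := by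
  unfold edgeScale; positivity

/-- `N (η_N^{1-α}/α)ⁿ e^{-η_N^α} → L`. -/
lemma tendsto_edgeRadius_weight (n : ℕ) {α L : ℝ} (hα : 0 < α) (hL : 0 < L) :
    Tendsto (fun N : ℕ => N * (edgeScale α (edgeRadius n α L N) ^ n
      * Real.exp (-(edgeRadius n α L N ^ α)))) atTop (𝓝 L) := by
  have h1 := tendsto_edgeRadius_rpow_sub n hα L
  have h2 : Tendsto (fun N => 1 + edgeCorrection n α L N) atTop (𝓝 1) := by
    simpa using (tendsto_edgeCorrection n hα L).1.const_add 1
  have h3 : Tendsto (fun N => ((1 + edgeCorrection n α L N) ^ (1 - α)) ^ n) atTop (𝓝 1) := by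
    have := (h2.rpow_const (p := 1 - α) (Or.inl one_ne_zero)).pow n
    simpa using this
  -- `e^{-η^α}` carries `αⁿ L (log N)^{n(α-1)/α} / N` and the Jacobian carries `α⁻ⁿ (log
  -- N)^{-n(α-1)/α}`, so only `L` is left.
  have h4 := (h1.neg.rexp.mul h3).const_mul ((α⁻¹) ^ n)
  rw [neg_neg, Real.exp_log (by positivity), mul_one, ← mul_assoc, ← mul_pow,
    inv_mul_cancel₀ hα.ne', one_pow, one_mul] at h4
  refine h4.congr' ?_
  filter_upwards [tendsto_log_natCast.eventually_gt_atTop 0, h2.eventually (lt_mem_nhds one_pos),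
    eventually_gt_atTop 0] with N hN hu hN0
  have hN0' : (0 : ℝ) < N := by exact_mod_cast hN0
  have e1 : edgeScale α (edgeRadius n α L N) ^ n = α⁻¹ ^ n
      * (Real.exp ((1 - α) * n / α * Real.log (Real.log N))
        * ((1 + edgeCorrection n α L N) ^ (1 - α)) ^ n) := by
    rw [edgeScale, mul_pow, edgeRadius_eq, Real.mul_rpow (by positivity) hu.le, mul_pow,
      ← Real.rpow_mul hN.le, ← Real.rpow_natCast (Real.log N ^ _), ← Real.rpow_mul hN.le,
      Real.rpow_def_of_pos hN]
    congr 3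
    field_simp
  have e2 : Real.exp (-(edgeRadius n α L N ^ α - Real.log N
      + n * (α - 1) / α * Real.log (Real.log N)))
      = N * Real.exp (-(edgeRadius n α L N ^ α))
        * Real.exp ((1 - α) * n / α * Real.log (Real.log N)) := by
    nth_rw 3 [← Real.exp_log hN0']
    rw [← Real.exp_add, ← Real.exp_add]
    congr 1; field_simp; ring
  rw [e2, e1]; ring

end Edge

/-! ### The edge map, its inverse and its change of variables. -/

section EdgeMap

variable {n : ℕ}

lemma edgeMap_eq {α η : ℝ} (hη : 0 < η) (υ : Space n) (ψ : Space n ≃ₗᵢ[ℝ] Space n) (y : Space n) :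
    edgeMap α η υ ψ y = η • υ + edgeScale α η • ψ y := by
  have h : η * (α⁻¹ * η ^ (-α)) = edgeScale α η := by
    rw [edgeScale, sub_eq_add_neg, Real.rpow_add hη, Real.rpow_one]; ring
  rw [edgeMap, smul_add, smul_smul, h]

/-- The inverse of the edge map. -/
noncomputable def edgeMapInv (α η : ℝ) (υ : Space n) (ψ : Space n ≃ₗᵢ[ℝ] Space n) (x : Space n) :
    Space n := ψ.symm ((edgeScale α η)⁻¹ • (x - η • υ))

lemma edgeMapInv_edgeMap {α η : ℝ} (hα : 0 < α) (hη : 0 < η) (υ : Space n)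
    (ψ : Space n ≃ₗᵢ[ℝ] Space n) (y : Space n) :
    edgeMapInv α η υ ψ (edgeMap α η υ ψ y) = y := by
  rw [edgeMapInv, edgeMap_eq hη, add_sub_cancel_left, inv_smul_smul₀ (edgeScale_pos hα hη).ne',
    LinearIsometryEquiv.symm_apply_apply]

lemma edgeMap_edgeMapInv {α η : ℝ} (hα : 0 < α) (hη : 0 < η) (υ : Space n)
    (ψ : Space n ≃ₗᵢ[ℝ] Space n) (x : Space n) :
    edgeMap α η υ ψ (edgeMapInv α η υ ψ x) = x := by
  rw [edgeMapInv, edgeMap_eq hη, LinearIsometryEquiv.apply_symm_apply,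
    smul_inv_smul₀ (edgeScale_pos hα hη).ne', add_sub_cancel]

lemma invFun_edgeMap {α η : ℝ} (hα : 0 < α) (hη : 0 < η) (υ : Space n)
    (ψ : Space n ≃ₗᵢ[ℝ] Space n) :
    Function.invFun (edgeMap α η υ ψ) = edgeMapInv α η υ ψ :=
  Function.invFun_eq_of_injective_of_rightInverse
    (Function.LeftInverse.injective (edgeMapInv_edgeMap hα hη υ ψ)) (edgeMap_edgeMapInv hα hη υ ψ)

lemma continuous_edgeMapInv (α η : ℝ) (υ : Space n) (ψ : Space n ≃ₗᵢ[ℝ] Space n) :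
    Continuous (edgeMapInv α η υ ψ) :=
  ψ.symm.continuous.comp (by fun_prop)

/-- Change of variables along the edge map. -/
lemma integral_comp_edgeMap {α η : ℝ} (hα : 0 < α) (hη : 0 < η) (υ : Space n)
    (ψ : Space n ≃ₗᵢ[ℝ] Space n) (G : Space n → ℝ) :
    ∫ x, G x = edgeScale α η ^ n * ∫ y, G (edgeMap α η υ ψ y) := by
  have hc := edgeScale_pos hα hη
  simp_rw [edgeMap_eq hη]
  have h1 := ψ.measurePreserving.integral_comp' (f := ψ.toHomeomorph.toMeasurableEquiv)
    (fun z => G (η • υ + edgeScale α η • z))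
  have h2 : ∫ y, G (η • υ + edgeScale α η • ψ y) = ∫ z, G (η • υ + edgeScale α η • z) := h1
  rw [h2, Measure.integral_comp_smul volume (fun z => G (η • υ + z)),
    integral_add_left_eq_self (fun z => G z), finrank_euclideanSpace_fin,
    abs_of_pos (by positivity), smul_eq_mul, ← mul_assoc, mul_inv_cancel₀ (by positivity), one_mul]

/-- Since `ψ` is orthogonal and sends `e₁` to `υ`, the radial component of the displacement is `y₁`,
for every such `ψ`. -/
lemma norm_edgeMap_sq [NeZero n] {α η : ℝ} (hη : 0 < η) {υ : Space n} (hυ : ‖υ‖ = 1)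
    {ψ : Space n ≃ₗᵢ[ℝ] Space n} (hψ : ψ (e₁ n) = υ) (y : Space n) :
    ‖edgeMap α η υ ψ y‖ ^ 2 = η ^ 2 * (1 + (2 * (α⁻¹ * η ^ (-α)) * inner ℝ (e₁ n) y
      + (α⁻¹ * η ^ (-α)) ^ 2 * ‖y‖ ^ 2)) := by
  rw [edgeMap, norm_smul, mul_pow, Real.norm_of_nonneg hη.le, norm_add_sq_real, hυ, norm_smul,
    inner_smul_right, ← hψ, ψ.inner_map_map, ψ.norm_map, mul_pow, Real.norm_eq_abs, sq_abs]
  ring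

lemma le_norm_edgeMap {α η : ℝ} (hα : 0 < α) (hη : 0 < η) {υ : Space n} (hυ : ‖υ‖ = 1)
    (ψ : Space n ≃ₗᵢ[ℝ] Space n) {y : Space n} {R : ℝ} (hy : ‖y‖ ≤ R) :
    η * (1 + -(α⁻¹ * η ^ (-α) * R)) ≤ ‖edgeMap α η υ ψ y‖ := by
  rw [edgeMap, norm_smul, Real.norm_of_nonneg hη.le]
  refine mul_le_mul_of_nonneg_left ?_ hη.le
  have h1 := norm_sub_le_norm_add υ ((α⁻¹ * η ^ (-α)) • ψ y)
  have h2 : α⁻¹ * η ^ (-α) * ‖y‖ ≤ α⁻¹ * η ^ (-α) * R := by gcongr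
  rw [norm_smul, ψ.norm_map, Real.norm_of_nonneg (by positivity), hυ] at h1
  linarith

lemma integral_weightMeasure (α : ℝ) (G : Space n → ℝ) :
    ∫ x, G x ∂(weightMeasure n α) = ∫ x, Real.exp (-‖x‖ ^ α) * G x := by
  have h : weightMeasure n α = volume.withDensity fun x : Space n =>
      ENNReal.ofReal (Real.exp (-‖x‖ ^ α)) := by
    rw [weightMeasure]; simp_rw [expNeg_potential]
  rw [h, integral_withDensity_eq_integral_toReal_smul (by fun_prop)
    (ae_of_all _ fun x => ENNReal.ofReal_lt_top)]
  simp [ENNReal.toReal_ofReal (Real.exp_nonneg _)]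

end EdgeMap

/-! ### The weight `e^{-|x|^α} dx` seen through the edge map. -/

section EdgeLimit

variable {n : ℕ} [NeZero n] {α : ℝ} {η : ℕ → ℝ}

lemma tendsto_rpow_neg_of_tendsto_atTop (hα : 0 < α) (hη : Tendsto η atTop atTop) :
    Tendsto (fun N => η N ^ (-α)) atTop (𝓝 0) :=
  (tendsto_rpow_neg_atTop hα).comp hη

/-- `|φ_N(y)|^α = η_N^α + y₁ + o(1)`. -/
lemma tendsto_norm_edgeMap_rpow_sub (hα : 0 < α) (hη : Tendsto η atTop atTop) {υ : Space n}
    (hυ : ‖υ‖ = 1) {ψ : Space n ≃ₗᵢ[ℝ] Space n} (hψ : ψ (e₁ n) = υ) (y : Space n) :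
    Tendsto (fun N => ‖edgeMap α (η N) υ ψ y‖ ^ α - η N ^ α) atTop (𝓝 (inner ℝ (e₁ n) y)) := by
  set t : ℝ := inner ℝ (e₁ n) y with ht
  set c : ℕ → ℝ := fun N => η N ^ (-α) with hc
  have hc0 : Tendsto c atTop (𝓝 0) := tendsto_rpow_neg_of_tendsto_atTop hα hη
  set w : ℕ → ℝ := fun N => 2 * (α⁻¹ * c N) * t + (α⁻¹ * c N) ^ 2 * ‖y‖ ^ 2 with hw
  have hac : ∀ᶠ N in atTop, η N ^ α * c N = 1 := by
    filter_upwards [hη.eventually_gt_atTop 0] with N hN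
    simp only [hc]
    rw [← Real.rpow_add hN, add_neg_cancel, Real.rpow_zero]
  have hw0 : Tendsto w atTop (𝓝 0) := by
    simpa using (((hc0.const_mul α⁻¹).const_mul 2).mul_const t).add
      (((hc0.const_mul α⁻¹).pow 2).mul_const (‖y‖ ^ 2))
  have haw : Tendsto (fun N => η N ^ α * w N) atTop (𝓝 (2 * α⁻¹ * t)) := by
    have h1 : Tendsto (fun N => 2 * α⁻¹ * t + α⁻¹ ^ 2 * ‖y‖ ^ 2 * c N) atTop
        (𝓝 (2 * α⁻¹ * t)) := by
      have h0 := (hc0.const_mul (α⁻¹ ^ 2 * ‖y‖ ^ 2)).const_add (2 * α⁻¹ * t)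
      rwa [mul_zero, add_zero] at h0
    refine h1.congr' ?_
    filter_upwards [hac] with N hN
    calc _ = 2 * α⁻¹ * t * 1 + α⁻¹ ^ 2 * ‖y‖ ^ 2 * (c N * 1) := by ring
      _ = _ := by rw [← hN]; simp only [hw]; ring
  have haw2 : Tendsto (fun N => η N ^ α * w N ^ 2) atTop (𝓝 0) := by
    have := haw.mul hw0
    rw [mul_zero] at this
    exact this.congr fun N => by ring
  -- `|φ_N(y)|^α = η^α (1+w)^{α/2}` with `η^α w → 2y₁/α`; the first-order term therefore tends to
  -- `y₁`. This is the reason for the scaling `α⁻¹ η^{-α}`.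
  have h2 := (tendsto_mul_one_add_rpow_sub (α / 2) hw0 haw2).add (haw.const_mul (α / 2))
  have e : 0 + α / 2 * (2 * α⁻¹ * t) = t := by field_simp; ring
  rw [e] at h2
  refine h2.congr' ?_
  have hw1 : ∀ᶠ N in atTop, -1 < w N := hw0.eventually (lt_mem_nhds (by norm_num))
  filter_upwards [hη.eventually_gt_atTop 0, hw1] with N hN hN1
  have h3 : ‖edgeMap α (η N) υ ψ y‖ ^ α = η N ^ α * (1 + w N) ^ (α / 2) := by
    have e1 : ‖edgeMap α (η N) υ ψ y‖ ^ α = (‖edgeMap α (η N) υ ψ y‖ ^ 2) ^ (α / 2) := by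
      rw [← Real.rpow_natCast, ← Real.rpow_mul (norm_nonneg _)]
      congr 1; push_cast; ring
    rw [e1, norm_edgeMap_sq hN hυ hψ, Real.mul_rpow (by positivity) (by linarith),
      ← Real.rpow_natCast, ← Real.rpow_mul hN.le]
    congr 2; push_cast; ring
  rw [h3]; ring

omit [NeZero n] in
-- A version uniform over `‖y‖ ≤ R`, from the triangle inequality alone; the extra `1` absorbs the
-- second-order error. The first bound sends the window to infinity, the second supplies the
-- domination for `tendsto_integral_edgeMapInv`.
lemma eventually_norm_edgeMap_ge (hα : 0 < α) (hη : Tendsto η atTop atTop) {υ : Space n}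
    (hυ : ‖υ‖ = 1) (ψ : Space n ≃ₗᵢ[ℝ] Space n) (R : ℝ) :
    ∀ᶠ N in atTop, ∀ y : Space n, ‖y‖ ≤ R →
      η N / 2 ≤ ‖edgeMap α (η N) υ ψ y‖ ∧ η N ^ α - (R + 1) ≤ ‖edgeMap α (η N) υ ψ y‖ ^ α := by
  set c : ℕ → ℝ := fun N => η N ^ (-α) with hc
  have hc0 : Tendsto c atTop (𝓝 0) := tendsto_rpow_neg_of_tendsto_atTop hα hη
  set u : ℕ → ℝ := fun N => -(α⁻¹ * c N * R) with hu
  have hu0 : Tendsto u atTop (𝓝 0) := by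
    simpa using ((hc0.const_mul α⁻¹).mul_const R).neg
  have hac : ∀ᶠ N in atTop, η N ^ α * c N = 1 := by
    filter_upwards [hη.eventually_gt_atTop 0] with N hN
    simp only [hc]
    rw [← Real.rpow_add hN, add_neg_cancel, Real.rpow_zero]
  have hau : ∀ᶠ N in atTop, η N ^ α * u N = -(α⁻¹ * R) := by
    filter_upwards [hac] with N hN
    calc _ = -(α⁻¹ * (η N ^ α * c N) * R) := by simp only [hu]; ring
      _ = _ := by rw [hN, mul_one]
  have hau2 : Tendsto (fun N => η N ^ α * u N ^ 2) atTop (𝓝 0) := by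
    have h1 : Tendsto (fun N => -(α⁻¹ * R) * u N) atTop (𝓝 0) := by
      simpa using hu0.const_mul (-(α⁻¹ * R))
    refine h1.congr' ?_
    filter_upwards [hau] with N hN
    rw [← hN]; ring
  have h2 := tendsto_mul_one_add_rpow_sub α hu0 hau2
  filter_upwards [hη.eventually_gt_atTop 0, hau, h2.eventually (lt_mem_nhds neg_one_lt_zero),
    hu0.eventually (lt_mem_nhds (show -(1 / 2 : ℝ) < 0 by norm_num))] with N hN h3 h4 h5 y hy
  have h6 := le_norm_edgeMap hα hN hυ ψ hy
  change η N * (1 + u N) ≤ _ at h6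
  refine ⟨?_, ?_⟩
  · refine le_trans ?_ h6
    nlinarith
  · have h7 : (η N * (1 + u N)) ^ α ≤ ‖edgeMap α (η N) υ ψ y‖ ^ α :=
      Real.rpow_le_rpow (mul_nonneg hN.le (by linarith)) h6 hα.le
    rw [Real.mul_rpow hN.le (by linarith)] at h7
    have h8 : η N ^ α * ((1 + u N) ^ α - 1 - α * u N)
        = η N ^ α * (1 + u N) ^ α - η N ^ α - α * (η N ^ α * u N) := by ring
    rw [h8, h3] at h4
    have h9 : α * -(α⁻¹ * R) = -R := by field_simp
    rw [h9] at h4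
    linarith

/-- The rescaled intensity of independent particles at the edge. -/
theorem tendsto_integral_edgeMapInv {L : ℝ} (hα : 0 < α) (hL : 0 < L) {υ : Space n}
    (hυ : ‖υ‖ = 1) {ψ : Space n ≃ₗᵢ[ℝ] Space n} (hψ : ψ (e₁ n) = υ) {H : Space n → ℝ}
    (hH : Measurable H) (hH1 : ∀ y, |H y| ≤ 1) {R : ℝ} (hHR : ∀ y, R < ‖y‖ → H y = 0) :
    Tendsto (fun N : ℕ => N * ∫ x, H (edgeMapInv α (edgeRadius n α L N) υ ψ x)
      ∂(weightMeasure n α)) atTop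
      (𝓝 (L * ∫ y, H y * Real.exp (-(inner ℝ (e₁ n) y)))) := by
  set η := edgeRadius n α L with hηdef
  have hη : Tendsto η atTop atTop := tendsto_edgeRadius n hα L
  have hwt := tendsto_edgeRadius_weight n hα hL
  set a : ℕ → ℝ := fun N => N * (edgeScale α (η N) ^ n * Real.exp (-(η N ^ α))) with ha
  -- The integrand after the change of variables, with `e^{-η^α}` moved into `a N` so that both
  -- factors have a limit.
  set F : ℕ → Space n → ℝ := fun N y =>
    a N * Real.exp (-(‖edgeMap α (η N) υ ψ y‖ ^ α - η N ^ α)) * H y with hF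
  have hlim : Tendsto (fun N => ∫ y, F N y) atTop
      (𝓝 (∫ y, L * (H y * Real.exp (-(inner ℝ (e₁ n) y))))) := by
    have hmeas : ∀ N, Measurable (F N) := fun N => by
      have h1 : Measurable fun y => edgeMap α (η N) υ ψ y := by
        unfold edgeMap
        have := ψ.continuous.measurable
        fun_prop
      have h2 : Measurable fun y => ‖edgeMap α (η N) υ ψ y‖ ^ α := h1.norm.pow_const α
      fun_prop
    refine tendsto_integral_filter_of_dominated_convergence
      ((Metric.closedBall (0 : Space n) R).indicator fun _ => (L + 1) * Real.exp (R + 1))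
      (Eventually.of_forall fun N => (hmeas N).aestronglyMeasurable) ?_ ?_ (ae_of_all _ fun y => ?_)
    · filter_upwards [eventually_norm_edgeMap_ge hα hη hυ ψ R,
        hwt.eventually (gt_mem_nhds (show L < L + 1 by linarith)), hη.eventually_gt_atTop 0]
        with N h1 h2 h3
      refine ae_of_all _ fun y => ?_
      have ha0 : 0 ≤ a N := by
        have := edgeScale_pos hα h3
        positivity
      rcases le_or_gt ‖y‖ R with hy | hy
      · rw [Set.indicator_of_mem (by simpa using hy)]
        simp only [hF]
        rw [norm_mul, norm_mul, Real.norm_of_nonneg ha0, Real.norm_of_nonneg (Real.exp_nonneg _)]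
        calc _ ≤ a N * Real.exp (-(‖edgeMap α (η N) υ ψ y‖ ^ α - η N ^ α)) * 1 :=
              mul_le_mul_of_nonneg_left (hH1 y) (by positivity)
          _ ≤ (L + 1) * Real.exp (R + 1) := by
              rw [mul_one]
              refine mul_le_mul h2.le (Real.exp_le_exp.2 ?_) (Real.exp_nonneg _) (by linarith)
              linarith [(h1 y hy).2]
      · rw [Set.indicator_of_notMem (by simpa using hy)]
        simp [hF, hHR y hy]
    · exact (integrable_indicator_iff measurableSet_closedBall).2
        (integrableOn_const (measure_closedBall_lt_top.ne))
    · have h1 := ((tendsto_norm_edgeMap_rpow_sub hα hη hυ hψ y).neg.rexp)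
      have h2 := (hwt.mul h1).mul_const (H y)
      have e : L * (H y * Real.exp (-(inner ℝ (e₁ n) y)))
          = L * Real.exp (-(inner ℝ (e₁ n) y)) * H y := by ring
      rw [e]
      exact h2
  rw [integral_const_mul] at hlim
  refine hlim.congr' ?_
  filter_upwards [hη.eventually_gt_atTop 0] with N hN
  rw [integral_weightMeasure, integral_comp_edgeMap hα hN υ ψ
    fun x => Real.exp (-‖x‖ ^ α) * H (edgeMapInv α (η N) υ ψ x)]
  simp_rw [edgeMapInv_edgeMap hα hN]
  rw [← mul_assoc, ← integral_const_mul]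
  congr 1
  ext y
  simp only [hF, ha]
  have : Real.exp (-‖edgeMap α (η N) υ ψ y‖ ^ α) = Real.exp (-(η N ^ α))
      * Real.exp (-(‖edgeMap α (η N) υ ψ y‖ ^ α - η N ^ α)) := by
    rw [← Real.exp_add]; congr 1; ring
  rw [this]; ring

/-- The potential generated by the reference weight vanishes at the edge. -/
lemma eventually_generatedPotential_edgeMap_le {s : ℝ} (hs : 0 < s) (hsn : s < n) (hα : 0 < α)
    (hη : Tendsto η atTop atTop) {υ : Space n} (hυ : ‖υ‖ = 1) (ψ : Space n ≃ₗᵢ[ℝ] Space n) (R : ℝ)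
    {ε : ℝ≥0∞} (hε : 0 < ε) :
    ∀ᶠ N in atTop, ∀ y : Space n, ‖y‖ ≤ R →
      generatedPotential s (weightMeasure n α) (edgeMap α (η N) υ ψ y) ≤ ε := by
  have := isFiniteMeasure_weightMeasure (n := n) hα
  have h1 := tendsto_generatedPotential_cocompact (n := n) s hs hsn ENNReal.one_ne_top
    (weightMeasure_le α)
  have h2 := h1.eventually (ge_mem_nhds hε)
  rw [← Metric.cobounded_eq_cocompact, ← comap_norm_atTop, eventually_comap] at h2
  obtain ⟨r, hr⟩ := eventually_atTop.1 h2
  filter_upwards [eventually_norm_edgeMap_ge hα hη hυ ψ R, hη.eventually_ge_atTop (2 * r)]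
    with N h3 h4 y hy
  exact hr _ (by linarith [(h3 y hy).1]) _ rfl

end EdgeLimit

/-! ### Gronwall estimate. -/

section Calculus

/-- A Gronwall estimate for the equation `Λ' = -Θ Λ`. -/
lemma abs_sub_exp_neg_le {Λ Λ' : ℝ → ℝ} {Θ E : ℝ} (hΘ : 0 ≤ Θ)
    (hd : ∀ t, HasDerivAt Λ (Λ' t) t) (h0 : Λ 0 = 1)
    (hE : ∀ t ∈ Set.Icc (0 : ℝ) 1, |Λ' t + Θ * Λ t| ≤ E) :
    |Λ 1 - Real.exp (-Θ)| ≤ E := by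
  have hE0 : 0 ≤ E := (abs_nonneg _).trans (hE 0 ⟨le_rfl, zero_le_one⟩)
  -- Integrating factor: on `[0, 1]` the derivative is at most `e^Θ E`, and this `e^Θ` cancels when
  -- the endpoint estimate is divided by it.
  have hm : ∀ t, HasDerivAt (fun t => Real.exp (Θ * t) * Λ t)
      (Real.exp (Θ * t) * (Λ' t + Θ * Λ t)) t := by
    intro t
    have h1 : HasDerivAt (fun t => Real.exp (Θ * t)) (Real.exp (Θ * t) * (Θ * 1)) t :=
      ((hasDerivAt_id t).const_mul Θ).exp
    exact (h1.mul (hd t)).congr_deriv (by ring)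
  have h1 := norm_image_sub_le_of_norm_deriv_le_segment_01' (C := Real.exp Θ * E)
    (fun t _ => (hm t).hasDerivWithinAt) (fun t ht => by
      rw [norm_mul, Real.norm_of_nonneg (Real.exp_nonneg _), Real.norm_eq_abs]
      refine mul_le_mul (Real.exp_le_exp.2 ?_) (hE t ⟨ht.1, ht.2.le⟩) (abs_nonneg _)
        (Real.exp_nonneg _)
      nlinarith [ht.1, ht.2])
  simp only [mul_one, mul_zero, Real.exp_zero, h0, Real.norm_eq_abs] at h1
  have h2 : Real.exp Θ * Λ 1 - 1 = Real.exp Θ * (Λ 1 - Real.exp (-Θ)) := by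
    rw [mul_sub, ← Real.exp_add]; simp
  rw [h2, abs_mul, abs_of_pos (Real.exp_pos _)] at h1
  exact le_of_mul_le_mul_left h1 (Real.exp_pos _)

end Calculus

/-! ### The interpolating product and its derivative. -/

section Thinning

variable {n : ℕ}

/-- The product `∏_j (1 - t h(y_j))`. -/
noncomputable def thinProd (h : Space n → ℝ) (t : ℝ) {M : ℕ} (y : Fin M → Space n) : ℝ :=
  ∏ j, (1 - t * h (y j))

lemma thinProd_insertNth (h : Space n → ℝ) (t : ℝ) {M : ℕ} (i : Fin (M + 1)) (x : Space n)
    (y : Fin M → Space n) : thinProd h t (i.insertNth x y : Fin (M + 1) → Space n)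
      = (1 - t * h x) * thinProd h t y := by
  rw [thinProd, Fin.prod_univ_succAbove _ i]
  simp [thinProd]

lemma thinProd_removeNth_insertNth (h : Space n → ℝ) (t : ℝ) {M : ℕ} (i : Fin (M + 1))
    (x : Space n) (y : Fin M → Space n) :
    thinProd h t (i.removeNth (i.insertNth x y : Fin (M + 1) → Space n)) = thinProd h t y := by
  rw [Fin.removeNth_insertNth]

lemma measurable_thinProd {h : Space n → ℝ} (hh : Measurable h) (t : ℝ) {M : ℕ} :
    Measurable (thinProd h t (M := M)) := by
  have h1 := fun j : Fin M => measurable_comp_eval hh j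
  unfold thinProd
  fun_prop

lemma measurable_thinProd_removeNth {h : Space n → ℝ} (hh : Measurable h) (t : ℝ) {M : ℕ}
    (i : Fin (M + 1)) :
    Measurable fun x : Fin (M + 1) → Space n => thinProd h t (i.removeNth x) := by
  have h1 := fun j : Fin (M + 1) => measurable_comp_eval hh j
  unfold thinProd Fin.removeNth
  fun_prop

lemma thinProd_mem_Icc {h : Space n → ℝ} (h0 : ∀ x, 0 ≤ h x) (h1 : ∀ x, h x ≤ 1) {t : ℝ}
    (ht : t ∈ Set.Icc (0 : ℝ) 1) {M : ℕ} (y : Fin M → Space n) :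
    thinProd h t y ∈ Set.Icc (0 : ℝ) 1 := by
  have h2 : ∀ x, 0 ≤ 1 - t * h x ∧ 1 - t * h x ≤ 1 := fun x => by
    have := mul_nonneg ht.1 (h0 x)
    have := mul_le_one₀ ht.2 (h0 x) (h1 x)
    constructor <;> linarith
  exact ⟨Finset.prod_nonneg fun j _ => (h2 _).1, Finset.prod_le_one (fun j _ => (h2 _).1)
    fun j _ => (h2 _).2⟩

lemma abs_thinProd_le {h : Space n → ℝ} (h0 : ∀ x, 0 ≤ h x) (h1 : ∀ x, h x ≤ 1) {t C : ℝ}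
    (ht : 1 + |t| ≤ C) {M : ℕ} (y : Fin M → Space n) : |thinProd h t y| ≤ C ^ M := by
  rw [thinProd, Finset.abs_prod]
  calc ∏ j, |1 - t * h (y j)| ≤ ∏ _j : Fin M, C := by
        refine Finset.prod_le_prod (fun _ _ => abs_nonneg _) fun j _ => ?_
        refine (abs_sub _ _).trans ?_
        rw [abs_one, abs_mul, abs_of_nonneg (h0 _)]
        have : |t| * h (y j) ≤ |t| * 1 := mul_le_mul_of_nonneg_left (h1 _) (abs_nonneg _)
        linarith
    _ = C ^ M := by simp

/-- Leibniz rule; the factor left after differentiating the `i`-th one is the same product for the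
configuration without particle `i`, ready for peeling. -/
lemma hasDerivAt_thinProd (h : Space n → ℝ) (t : ℝ) {M : ℕ} (x : Fin (M + 1) → Space n) :
    HasDerivAt (fun t => thinProd h t x) (-∑ i, h (x i) * thinProd h t (i.removeNth x)) t := by
  have h1 : ∀ i ∈ Finset.univ, HasDerivAt (fun t : ℝ => 1 - t * h (x i)) (-(h (x i))) t :=
    fun i _ => by simpa using ((hasDerivAt_id t).mul_const (h (x i))).const_sub 1
  have h2 := HasDerivAt.fun_finsetProd h1
  refine h2.congr_deriv ?_
  rw [← Finset.sum_neg_distrib]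
  refine Finset.sum_congr rfl fun i _ => ?_
  have e : Finset.univ.erase i = Finset.univ.map i.succAboveEmb := by
    rw [Fin.univ_succAbove M i, Finset.erase_cons]
  rw [e, Finset.prod_map, smul_eq_mul]
  simp only [thinProd, Fin.removeNth, Fin.coe_succAboveEmb]
  ring

/-- Domination is needed on a neighbourhood of `t`, where `1 - t h` may leave `[0, 1]`; the crude
bound `|1 - t h| ≤ 1 + |t|` suffices because `M` is fixed. -/
lemma hasDerivAt_integral_thinProd {h : Space n → ℝ} (hh : Measurable h) (h0 : ∀ x, 0 ≤ h x)
    (h1 : ∀ x, h x ≤ 1) {M : ℕ} (P : Measure (Fin (M + 1) → Space n)) [IsFiniteMeasure P] (t : ℝ) :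
    HasDerivAt (fun t => ∫ x, thinProd h t x ∂P)
      (-∑ i, ∫ x, h (x i) * thinProd h t (i.removeNth x) ∂P) t := by
  have hm : ∀ (t : ℝ) (i : Fin (M + 1)), Measurable fun x : Fin (M + 1) → Space n =>
      h (x i) * thinProd h t (i.removeNth x) := fun t i =>
    (measurable_comp_eval hh i).mul (measurable_thinProd_removeNth hh t i)
  have hb : ∀ (t C : ℝ), 1 + |t| ≤ C → ∀ (i : Fin (M + 1)) (x : Fin (M + 1) → Space n),
      ‖h (x i) * thinProd h t (i.removeNth x)‖ ≤ C ^ M := fun t C hC i x => by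
    rw [norm_mul, Real.norm_of_nonneg (h0 _), Real.norm_eq_abs]
    calc _ ≤ 1 * |thinProd h t (i.removeNth x)| :=
          mul_le_mul_of_nonneg_right (h1 _) (abs_nonneg _)
      _ ≤ _ := by rw [one_mul]; exact abs_thinProd_le h0 h1 hC _
  have key := hasDerivAt_integral_of_dominated_loc_of_deriv_le (μ := P) (𝕜 := ℝ)
    (F := fun t x => thinProd h t x)
    (F' := fun t x => -∑ i, h (x i) * thinProd h t (i.removeNth x)) (x₀ := t)
    (s := Metric.ball t 1) (bound := fun _ => (M + 1) * (2 + |t|) ^ M)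
    (Metric.ball_mem_nhds t one_pos)
    (Eventually.of_forall fun u => (measurable_thinProd hh u).aestronglyMeasurable)
    (Integrable.of_bound (measurable_thinProd hh t).aestronglyMeasurable ((1 + |t|) ^ (M + 1))
      (ae_of_all _ fun x => abs_thinProd_le h0 h1 le_rfl x))
    (Finset.measurable_fun_sum _ fun i _ => hm t i).neg.aestronglyMeasurable
    (ae_of_all _ fun x u hu => ?_) (integrable_const _)
    (ae_of_all _ fun x u _ => hasDerivAt_thinProd h u x)
  · refine key.2.congr_deriv ?_
    rw [integral_neg, integral_finsetSum _ fun i _ => ?_]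
    exact Integrable.of_bound (hm t i).aestronglyMeasurable _ (ae_of_all _ (hb t _ le_rfl i))
  · rw [Metric.mem_ball, Real.dist_eq] at hu
    have hu2 : 1 + |u| ≤ 2 + |t| := by
      have := abs_sub_abs_le_abs_sub u t
      linarith
    rw [norm_neg]
    refine (norm_sum_le _ _).trans ((Finset.sum_le_sum fun i _ => hb u _ hu2 i x).trans_eq ?_)
    simp

lemma measurable_exp_neg_realPotential (s γ : ℝ) (μ : Measure (Space n)) [SFinite μ] :
    Measurable fun x => Real.exp (-(γ * realPotential s μ x)) := by
  have := measurable_realPotential (n := n) s μ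
  fun_prop

end Thinning

/-! ### Removing a particle: signed observables and remote particles. -/

section Peeling

variable {n : ℕ} [NeZero n] {s α : ℝ}

lemma integral_gibbsMeasure_succ (β : ℝ) (hs : 0 < s) (hsn : s < n) (hα : 0 < α) {M : ℕ}
    (i : Fin (M + 1)) {G : (Fin (M + 1) → Space n) → ℝ} (hG : Measurable G) :
    ∫ z, G z ∂(gibbsMeasure n s α β (M + 1)) = (partitionRatio n s α β M).toReal⁻¹
      * ∫ q : Space n × (Fin M → Space n), (fieldFactor s β q.1 q.2).toReal
        * G (i.insertNth q.1 q.2) ∂((weightMeasure n α).prod (gibbsMeasure n s α β M)) := by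
  have hP := isProbabilityMeasure_gibbsMeasure (n := n) β hs hsn hα M
  have hins : Measurable fun q : Space n × (Fin M → Space n) =>
      (i.insertNth q.1 q.2 : Fin (M + 1) → Space n) := measurable_insertNth i
  have hF := measurable_fieldFactor (n := n) s β (M := M)
  have hmap : gibbsMeasure n s α β (M + 1) = ((partitionRatio n s α β M)⁻¹ •
      ((weightMeasure n α).prod (gibbsMeasure n s α β M)).withDensity
        fun q => fieldFactor s β q.1 q.2).map
      fun q => (i.insertNth q.1 q.2 : Fin (M + 1) → Space n) := by
    refine Measure.ext_of_lintegral _ fun f hf => ?_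
    have hfi : Measurable fun q : Space n × (Fin M → Space n) =>
      f (i.insertNth q.1 q.2 : Fin (M + 1) → Space n) := hf.comp hins
    rw [lintegral_gibbsMeasure_succ β hs hsn hα i hf, lintegral_map hf hins,
      lintegral_smul_measure, lintegral_withDensity_eq_lintegral_mul _ hF hfi,
      lintegral_prod _ (hF.mul hfi).aemeasurable]
    rfl
  rw [hmap, integral_map hins.aemeasurable hG.aestronglyMeasurable, integral_smul_measure,
    integral_withDensity_eq_integral_toReal_smul hF (ae_of_all _ fun q =>
      (fieldFactor_le_one s β q.1 q.2).trans_lt ENNReal.one_lt_top), ENNReal.toReal_inv]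
  rfl

lemma lintegral_sum_rieszKernel_le {β : ℝ} (hs : 0 < s) (hsn : s < n) (hα : 0 < α)
    {M : ℕ} {b : ℝ≥0∞} (hb : ENNReal.ofReal β * M ≤ b) (x : Space n) :
    ∫⁻ y, ENNReal.ofReal β * ∑ j, rieszKernel s x (y j) ∂(gibbsMeasure n s α β M)
      ≤ b * ((ratioBound n s α b)⁻¹ * generatedPotential s (weightMeasure n α) x) := by
  have hk : Measurable fun z : Space n => rieszKernel s x z :=
    measurable_const.rieszKernel s measurable_id
  have hm := fun j : Fin M => measurable_comp_eval hk j
  rw [lintegral_const_mul _ (by fun_prop), lintegral_finsetSum _ fun j _ => hm j]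
  calc _ ≤ ENNReal.ofReal β * ∑ _j : Fin M, ((ratioBound n s α b)⁻¹
        * generatedPotential s (weightMeasure n α) x) := by
        gcongr with j
        exact lintegral_gibbsMeasure_apply_le hs hsn hα hb j hk
    _ = ENNReal.ofReal β * M * ((ratioBound n s α b)⁻¹
        * generatedPotential s (weightMeasure n α) x) := by simp [mul_assoc]
    _ ≤ _ := by gcongr

/-- A particle placed where the weight generates a small potential barely feels the gas. -/
lemma one_sub_integral_fieldFactor_le {β : ℝ} (hs : 0 < s) (hsn : s < n) (hα : 0 < α)
    {M : ℕ} {b : ℝ≥0∞} (hbt : b ≠ ⊤) (hb : ENNReal.ofReal β * M ≤ b) {x : Space n} {ε : ℝ≥0∞}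
    (hεt : ε ≠ ⊤) (hx : generatedPotential s (weightMeasure n α) x ≤ ε) :
    1 - ∫ y, (fieldFactor s β x y).toReal ∂(gibbsMeasure n s α β M)
      ≤ (b * ((ratioBound n s α b)⁻¹ * ε)).toReal := by
  have hP := isProbabilityMeasure_gibbsMeasure (n := n) β hs hsn hα M
  have hF := measurable_fieldFactor_right s β (M := M) x
  have hc : b * ((ratioBound n s α b)⁻¹ * ε) ≠ ⊤ := ENNReal.mul_ne_top hbt
    (ENNReal.mul_ne_top (ENNReal.inv_ne_top.2 (ratioBound_ne_zero hs hsn hα hbt)) hεt)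
  have h1 : (1 : ℝ≥0∞) ≤ ∫⁻ y, fieldFactor s β x y ∂(gibbsMeasure n s α β M)
      + b * ((ratioBound n s α b)⁻¹ * ε) := by
    calc (1 : ℝ≥0∞) = ∫⁻ _y, 1 ∂(gibbsMeasure n s α β M) := by simp
      _ ≤ ∫⁻ y, (fieldFactor s β x y + ENNReal.ofReal β * ∑ j, rieszKernel s x (y j))
          ∂(gibbsMeasure n s α β M) := lintegral_mono fun y => one_le_expNeg_add _
      _ = ∫⁻ y, fieldFactor s β x y ∂(gibbsMeasure n s α β M)
          + ∫⁻ y, ENNReal.ofReal β * ∑ j, rieszKernel s x (y j) ∂(gibbsMeasure n s α β M) :=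
          lintegral_add_left hF _
      _ ≤ _ := by
          gcongr
          refine (lintegral_sum_rieszKernel_le hs hsn hα hb x).trans ?_
          gcongr
  have h2 : ∫⁻ y, fieldFactor s β x y ∂(gibbsMeasure n s α β M) ≠ ⊤ := by
    refine ((lintegral_mono fun y => fieldFactor_le_one s β x y).trans_lt ?_).ne
    simp
  rw [integral_toReal hF.aemeasurable
    (ae_of_all _ fun y => (fieldFactor_le_one s β x y).trans_lt ENNReal.one_lt_top)]
  have h3 := ENNReal.toReal_mono (ENNReal.add_ne_top.2 ⟨h2, hc⟩) h1
  rw [ENNReal.toReal_add h2 hc, ENNReal.toReal_one] at h3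
  linarith

/-- The total mass of the self-consistent equation; it identifies the limit of `Z_{M+1}/Z_M`. -/
lemma SelfConsistent.integral_exp_eq {γ : ℝ} (hs : 0 < s) (hsn : s < n) (hγ : 0 ≤ γ)
    {μ : ProbabilityMeasure (Space n)} {L : ℝ} (h : SelfConsistent s α γ μ L) :
    ∫ x, Real.exp (-(γ * realPotential s (μ : Measure (Space n)) x)) ∂(weightMeasure n α) = L := by
  have hU := measurable_generatedPotential (n := n) s (μ : Measure (Space n))
  have hUe : Measurable fun x =>
      expNeg (ENNReal.ofReal γ * generatedPotential s (μ : Measure (Space n)) x) :=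
    measurable_expNeg.comp (hU.const_mul _)
  have hUt := fun x => h.generatedPotential_ne_top hs hsn x
  have h1 : ∫⁻ x, expNeg (ENNReal.ofReal γ * generatedPotential s (μ : Measure (Space n)) x)
      ∂(weightMeasure n α) = ENNReal.ofReal L := by
    have h2 : (μ : Measure (Space n)) Set.univ = 1 := measure_univ
    rw [h.2, Measure.smul_apply, withDensity_apply _ MeasurableSet.univ, setLIntegral_univ,
      smul_eq_mul, mul_comm, ← div_eq_mul_inv, ENNReal.div_eq_one_iff
        (by simpa using h.1) ENNReal.ofReal_ne_top] at h2
    rw [← h2, weightMeasure, lintegral_withDensity_eq_lintegral_mul _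
      (measurable_expNeg_potential α) hUe]
    refine lintegral_congr fun x => ?_
    rw [expNeg_add, mul_comm]
    rfl
  have h3 : ∀ x, Real.exp (-(γ * realPotential s (μ : Measure (Space n)) x))
      = (expNeg (ENNReal.ofReal γ * generatedPotential s (μ : Measure (Space n)) x)).toReal := by
    intro x
    rw [toReal_expNeg (ENNReal.mul_ne_top ENNReal.ofReal_ne_top (hUt x)), ENNReal.toReal_mul,
      ENNReal.toReal_ofReal hγ]
    rfl
  simp_rw [h3]
  rw [integral_toReal hUe.aemeasurable
    (ae_of_all _ fun x => (expNeg_le_one _).trans_lt ENNReal.one_lt_top), h1,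
    ENNReal.toReal_ofReal h.1.le]

end Peeling

/-! ### Quantitative Poisson approximation. -/

section PoissonLimit

variable {n : ℕ} [NeZero n] {s α : ℝ}

lemma partitionRatio_toReal_eq (hs : 0 < s) (hsn : s < n) (hα : 0 < α) (β : ℝ) (M : ℕ) :
    (partitionRatio n s α β M).toReal = ∫ q : Space n × (Fin M → Space n),
      (fieldFactor s β q.1 q.2).toReal ∂((weightMeasure n α).prod (gibbsMeasure n s α β M)) := by
  have hP := isProbabilityMeasure_gibbsMeasure (n := n) β hs hsn hα M
  have hF := measurable_fieldFactor (n := n) s β (M := M)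
  rw [integral_toReal hF.aemeasurable (ae_of_all _ fun q =>
      (fieldFactor_le_one s β q.1 q.2).trans_lt ENNReal.one_lt_top),
    partitionRatio_eq_lintegral, lintegral_prod _ hF.aemeasurable]

variable {γ L : ℝ} {μ : ProbabilityMeasure (Space n)}

lemma integral_prod_abs_fieldFactor_sub_le (hs : 0 < s) (hsn : s < n) (hα : 0 < α)
    (hγ : 0 ≤ γ) {β : ℝ} {M : ℕ} {ε : ℝ}
    (hε : ∀ x : Space n, ∫ y, |(fieldFactor s β x y).toReal
        - Real.exp (-(γ * realPotential s (μ : Measure (Space n)) x))|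
        ∂(gibbsMeasure n s α β M) ≤ ε) :
    Integrable (fun q : Space n × (Fin M → Space n) => |(fieldFactor s β q.1 q.2).toReal
      - Real.exp (-(γ * realPotential s (μ : Measure (Space n)) q.1))|)
      ((weightMeasure n α).prod (gibbsMeasure n s α β M)) ∧
    ∫ q : Space n × (Fin M → Space n), |(fieldFactor s β q.1 q.2).toReal
      - Real.exp (-(γ * realPotential s (μ : Measure (Space n)) q.1))|
      ∂((weightMeasure n α).prod (gibbsMeasure n s α β M)) ≤ ε * (weightMeasure n α).real Set.univ := by
  have hP := isProbabilityMeasure_gibbsMeasure (n := n) β hs hsn hα M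
  have := isFiniteMeasure_weightMeasure (n := n) hα
  have hF : Measurable fun q : Space n × (Fin M → Space n) => (fieldFactor s β q.1 q.2).toReal :=
    (measurable_fieldFactor s β).ennreal_toReal
  have hU := measurable_exp_neg_realPotential s γ (μ : Measure (Space n))
  have hm : Measurable fun q : Space n × (Fin M → Space n) => (fieldFactor s β q.1 q.2).toReal
      - Real.exp (-(γ * realPotential s (μ : Measure (Space n)) q.1)) :=
    hF.sub (hU.comp measurable_fst)
  have hi : Integrable (fun q : Space n × (Fin M → Space n) => |(fieldFactor s β q.1 q.2).toReal
      - Real.exp (-(γ * realPotential s (μ : Measure (Space n)) q.1))|)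
      ((weightMeasure n α).prod (gibbsMeasure n s α β M)) := by
    refine (Integrable.of_bound hm.aestronglyMeasurable 1 (ae_of_all _ fun q => ?_)).abs
    have h1 := toReal_fieldFactor_le_one s β q.1 q.2
    have h2 : 0 ≤ (fieldFactor s β q.1 q.2).toReal := ENNReal.toReal_nonneg
    have h3 : Real.exp (-(γ * realPotential s (μ : Measure (Space n)) q.1)) ≤ 1 :=
      Real.exp_le_one_iff.2 (neg_nonpos.2 (mul_nonneg hγ ENNReal.toReal_nonneg))
    have h4 := Real.exp_pos (-(γ * realPotential s (μ : Measure (Space n)) q.1))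
    rw [Real.norm_eq_abs, abs_le]; constructor <;> linarith
  refine ⟨hi, ?_⟩
  rw [integral_prod _ hi]
  refine (integral_mono hi.integral_prod_left (integrable_const ε) hε).trans_eq ?_
  simp [mul_comm]

/-- The ratio is the mean Boltzmann factor of an added particle integrated against `e^{-|x|^α} dx`;
the mean-field limit replaces that factor by `e^{-γU}`, whose integral is `L`. -/
lemma SelfConsistent.abs_partitionRatio_sub_le (hs : 0 < s) (hsn : s < n) (hα : 0 < α)
    (hγ : 0 ≤ γ) (h : SelfConsistent s α γ μ L) {β : ℝ} {M : ℕ} {ε : ℝ}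
    (hε : ∀ x : Space n, ∫ y, |(fieldFactor s β x y).toReal
        - Real.exp (-(γ * realPotential s (μ : Measure (Space n)) x))|
        ∂(gibbsMeasure n s α β M) ≤ ε) :
    |(partitionRatio n s α β M).toReal - L| ≤ ε * (weightMeasure n α).real Set.univ := by
  have hP := isProbabilityMeasure_gibbsMeasure (n := n) β hs hsn hα M
  have hfin := isFiniteMeasure_weightMeasure (n := n) hα
  obtain ⟨-, hΔ⟩ := integral_prod_abs_fieldFactor_sub_le hs hsn hα hγ hε
  set e : Space n → ℝ := fun x => Real.exp (-(γ * realPotential s (μ : Measure (Space n)) x)) with he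
  have hem : Measurable e := measurable_exp_neg_realPotential s γ (μ : Measure (Space n))
  have hFm : Measurable fun q : Space n × (Fin M → Space n) => (fieldFactor s β q.1 q.2).toReal :=
    (measurable_fieldFactor s β).ennreal_toReal
  have hem' : Measurable fun q : Space n × (Fin M → Space n) => e q.1 := hem.comp measurable_fst
  have h1 : ∫ q : Space n × (Fin M → Space n), e q.1
      ∂((weightMeasure n α).prod (gibbsMeasure n s α β M)) = L := by
    have := integral_prod_mul (μ := weightMeasure n α) (ν := gibbsMeasure n s α β M) e
      fun _ => (1 : ℝ)
    simpa [he, h.integral_exp_eq hs hsn hγ] using this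
  rw [partitionRatio_toReal_eq hs hsn hα, ← h1, ← integral_sub]
  · exact abs_integral_le_integral_abs.trans hΔ
  · exact Integrable.of_bound hFm.aestronglyMeasurable 1 (ae_of_all _ fun q => by
      rw [Real.norm_of_nonneg ENNReal.toReal_nonneg]; exact toReal_fieldFactor_le_one s β q.1 q.2)
  · refine Integrable.of_bound hem'.aestronglyMeasurable 1 (ae_of_all _ fun q => ?_)
    rw [Real.norm_of_nonneg (Real.exp_nonneg _)]
    exact Real.exp_le_one_iff.2 (neg_nonpos.2 (mul_nonneg hγ ENNReal.toReal_nonneg))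

/-- The error in the Poisson limit of a thinned gas. -/
theorem SelfConsistent.abs_integral_thinProd_sub_le (hs : 0 < s) (hsn : s < n) (hα : 0 < α)
    (hγ : 0 ≤ γ) (h : SelfConsistent s α γ μ L) {β : ℝ} {M : ℕ} {p : Space n → ℝ}
    (hp : Measurable p) (hp0 : ∀ x, 0 ≤ p x) (hp1 : ∀ x, p x ≤ 1) {ε₁ ε₂ r H K Θ : ℝ}
    (hΘ : 0 ≤ Θ) (hε₁ : ∀ x, p x ≠ 0 →
      1 - ∫ y, (fieldFactor s β x y).toReal ∂(gibbsMeasure n s α β M) ≤ ε₁)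
    (hε₂ : ∀ x : Space n, ∫ y, |(fieldFactor s β x y).toReal
        - Real.exp (-(γ * realPotential s (μ : Measure (Space n)) x))|
        ∂(gibbsMeasure n s α β M) ≤ ε₂)
    (hr : r = (partitionRatio n s α β M).toReal) (hr0 : 0 < r)
    (hH : H = ∫ x, p x ∂(weightMeasure n α)) (hK : K = r⁻¹ * ((M + 1) * H)) :
    |∫ x, thinProd p 1 x ∂(gibbsMeasure n s α β (M + 1)) - Real.exp (-Θ)|
      ≤ K * ε₁ + |K - Θ| + Θ * (r⁻¹ * (2 * (ε₂ * (weightMeasure n α).real Set.univ) + H)) := by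
  have hP := isProbabilityMeasure_gibbsMeasure (n := n) β hs hsn hα M
  have hP' := isProbabilityMeasure_gibbsMeasure (n := n) β hs hsn hα (M + 1)
  have hfin := isFiniteMeasure_weightMeasure (n := n) hα
  obtain ⟨hΔi, hΔ⟩ := integral_prod_abs_fieldFactor_sub_le hs hsn hα hγ hε₂
  have hLint := h.integral_exp_eq hs hsn hγ
  set P := gibbsMeasure n s α β M with hPdef
  set lam := weightMeasure n α with hlam
  set m := lam.real Set.univ with hm
  set F : Space n × (Fin M → Space n) → ℝ := fun q => (fieldFactor s β q.1 q.2).toReal with hF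
  have hFm : Measurable F := (measurable_fieldFactor s β).ennreal_toReal
  have hF0 : ∀ q, 0 ≤ F q := fun q => ENNReal.toReal_nonneg
  have hF1 : ∀ q, F q ≤ 1 := fun q => toReal_fieldFactor_le_one s β q.1 q.2
  set e : Space n → ℝ := fun x => Real.exp (-(γ * realPotential s (μ : Measure (Space n)) x)) with he
  have hem : Measurable e := measurable_exp_neg_realPotential s γ (μ : Measure (Space n))
  have he0 : ∀ x, 0 ≤ e x := fun x => Real.exp_nonneg _
  have he1 : ∀ x, e x ≤ 1 := fun x =>
    Real.exp_le_one_iff.2 (neg_nonpos.2 (mul_nonneg hγ ENNReal.toReal_nonneg))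
  have hpm : Measurable fun q : Space n × (Fin M → Space n) => p q.1 := hp.comp measurable_fst
  have hem' : Measurable fun q : Space n × (Fin M → Space n) => e q.1 := hem.comp measurable_fst
  have hbd : ∀ {G : Space n × (Fin M → Space n) → ℝ}, Measurable G → (∀ q, 0 ≤ G q) →
      (∀ q, G q ≤ 1) → Integrable G (lam.prod P) := fun {G} hG h0 h1 =>
    Integrable.of_bound hG.aestronglyMeasurable 1
      (ae_of_all _ fun q => by rw [Real.norm_of_nonneg (h0 q)]; exact h1 q)
  have hpi : Integrable p lam := Integrable.of_bound hp.aestronglyMeasurable 1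
    (ae_of_all _ fun x => by rw [Real.norm_of_nonneg (hp0 x)]; exact hp1 x)
  have hH0 : 0 ≤ H := by rw [hH]; exact integral_nonneg hp0
  have hK0 : 0 ≤ K := by rw [hK]; positivity
  have hpπ : ∫ q : Space n × (Fin M → Space n), p q.1 ∂(lam.prod P) = H := by
    have := integral_prod_mul (μ := lam) (ν := P) p fun _ => (1 : ℝ)
    simpa [← hH] using this
  have hrL : |r - L| ≤ ε₂ * m := by
    rw [hr]; exact h.abs_partitionRatio_sub_le hs hsn hα hγ hε₂
  -- a particle in the support of `p` does not feel the gas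
  have hsmall : ∫ q, (1 - F q) * p q.1 ∂(lam.prod P) ≤ ε₁ * H := by
    have hi : Integrable (fun q => (1 - F q) * p q.1) (lam.prod P) :=
      hbd ((measurable_const.sub hFm).mul hpm)
        (fun q => mul_nonneg (sub_nonneg.2 (hF1 q)) (hp0 _))
        (fun q => mul_le_one₀ (by linarith [hF0 q]) (hp0 _) (hp1 _))
    rw [integral_prod _ hi, hH, ← integral_const_mul]
    refine integral_mono hi.integral_prod_left (hpi.const_mul _) fun x => ?_
    simp only
    rw [integral_mul_const]
    have hFx : Integrable (fun y => F (x, y)) P := integrable_toReal_fieldFactor s β x P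
    rw [integral_sub (integrable_const _) hFx]
    simp only [integral_const, probReal_univ, one_smul]
    rcases eq_or_ne (p x) 0 with h0 | h0
    · simp [h0]
    · exact mul_le_mul_of_nonneg_right (hε₁ x h0) (hp0 x)
  refine abs_sub_exp_neg_le (Λ := fun t => ∫ x, thinProd p t x ∂(gibbsMeasure n s α β (M + 1)))
    (Λ' := fun t => -∑ i, ∫ x, p (x i) * thinProd p t (i.removeNth x)
      ∂(gibbsMeasure n s α β (M + 1))) hΘ
    (fun t => hasDerivAt_integral_thinProd hp hp0 hp1 _ t) (by simp [thinProd]) fun t ht => ?_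
  set Q : (Fin M → Space n) → ℝ := thinProd p t with hQ
  have hQm : Measurable Q := measurable_thinProd hp t
  have hQ01 : ∀ y, Q y ∈ Set.Icc (0 : ℝ) 1 := fun y => thinProd_mem_Icc hp0 hp1 ht y
  have hQm' : Measurable fun q : Space n × (Fin M → Space n) => Q q.2 := hQm.comp measurable_snd
  set B := ∫ y, Q y ∂P with hB
  have hQi : Integrable Q P := Integrable.of_bound hQm.aestronglyMeasurable 1
    (ae_of_all _ fun y => by rw [Real.norm_of_nonneg (hQ01 y).1]; exact (hQ01 y).2)
  have hB0 : 0 ≤ B := integral_nonneg fun y => (hQ01 y).1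
  have hB1 : B ≤ 1 := by
    simpa using integral_mono hQi (integrable_const (1 : ℝ)) fun y => (hQ01 y).2
  set A := ∫ q, F q * (p q.1 * Q q.2) ∂(lam.prod P) with hA
  have hpQ : Measurable fun q : Space n × (Fin M → Space n) => p q.1 * Q q.2 := hpm.mul hQm'
  have hpQ0 : ∀ q : Space n × (Fin M → Space n), 0 ≤ p q.1 * Q q.2 :=
    fun q => mul_nonneg (hp0 _) (hQ01 _).1
  have hpQ1 : ∀ q : Space n × (Fin M → Space n), p q.1 * Q q.2 ≤ 1 :=
    fun q => mul_le_one₀ (hp1 _) (hQ01 _).1 (hQ01 _).2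
  -- On the support of `p` the field factor is close to `1` in mean, so the removed particle
  -- decouples from the others and the integral factorises.
  have hAH : |A - H * B| ≤ ε₁ * H := by
    have h1 : ∫ q : Space n × (Fin M → Space n), p q.1 * Q q.2 ∂(lam.prod P) = H * B := by
      rw [hH]; exact integral_prod_mul p Q
    have hi1 : Integrable (fun q => F q * (p q.1 * Q q.2)) (lam.prod P) :=
      hbd (hFm.mul hpQ) (fun q => mul_nonneg (hF0 q) (hpQ0 q))
        fun q => mul_le_one₀ (hF1 q) (hpQ0 q) (hpQ1 q)
    rw [← h1, hA, ← integral_sub hi1 (hbd hpQ hpQ0 hpQ1)]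
    refine abs_integral_le_integral_abs.trans (le_trans ?_ hsmall)
    refine integral_mono (hi1.sub (hbd hpQ hpQ0 hpQ1)).abs
      (hbd ((measurable_const.sub hFm).mul hpm)
        (fun q => mul_nonneg (sub_nonneg.2 (hF1 q)) (hp0 _))
        (fun q => mul_le_one₀ (by linarith [hF0 q]) (hp0 _) (hp1 _))) fun q => ?_
    have h2 : F q * (p q.1 * Q q.2) - p q.1 * Q q.2 = -((1 - F q) * p q.1 * Q q.2) := by ring
    simp only
    rw [h2, abs_neg, abs_of_nonneg (mul_nonneg (mul_nonneg (sub_nonneg.2 (hF1 q)) (hp0 _))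
      (hQ01 _).1)]
    exact mul_le_of_le_one_right (mul_nonneg (sub_nonneg.2 (hF1 q)) (hp0 _)) (hQ01 _).2
  -- the derivative
  have hder : ∀ i : Fin (M + 1), ∫ x, p (x i) * thinProd p t (i.removeNth x)
      ∂(gibbsMeasure n s α β (M + 1)) = r⁻¹ * A := by
    intro i
    have hmi : Measurable fun x : Fin (M + 1) → Space n =>
        p (x i) * thinProd p t (i.removeNth x) :=
      (measurable_comp_eval hp i).mul (measurable_thinProd_removeNth hp t i)
    rw [integral_gibbsMeasure_succ β hs hsn hα i hmi, ← hr]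
    congr 1
    refine integral_congr_ae (ae_of_all _ fun q => ?_)
    simp only [Fin.insertNth_apply_same, thinProd_removeNth_insertNth, hF, hQ]
  beta_reduce
  rw [Finset.sum_congr rfl fun i _ => hder i]
  -- the function itself
  have hΛ : ∫ x, thinProd p t x ∂(gibbsMeasure n s α β (M + 1))
      = r⁻¹ * ∫ q, F q * ((1 - t * p q.1) * Q q.2) ∂(lam.prod P) := by
    rw [integral_gibbsMeasure_succ β hs hsn hα 0 (measurable_thinProd hp t), ← hr]
    simp only [thinProd_insertNth, hF, hQ]
    rfl
  set Z := ∫ q, F q * ((1 - t * p q.1) * Q q.2) ∂(lam.prod P) with hZ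
  -- For the undifferentiated product the removed particle is generic: its field factor is replaced
  -- by `e^{-γU}`, and its own factor `1 - t p` differs from `1` by at most `p`, of total weight
  -- `H`.
  have hZL : |Z - L * B| ≤ ε₂ * m + H := by
    have h1 : ∫ q : Space n × (Fin M → Space n), e q.1 * Q q.2 ∂(lam.prod P) = L * B := by
      rw [← hLint]; exact integral_prod_mul e Q
    have htp : ∀ x, 0 ≤ t * p x ∧ t * p x ≤ 1 ∧ t * p x ≤ p x := fun x =>
      ⟨mul_nonneg ht.1 (hp0 x), mul_le_one₀ ht.2 (hp0 x) (hp1 x),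
        mul_le_of_le_one_left (hp0 x) ht.2⟩
    have hG0 : ∀ q : Space n × (Fin M → Space n), 0 ≤ (1 - t * p q.1) * Q q.2 := fun q =>
      mul_nonneg (sub_nonneg.2 (htp _).2.1) (hQ01 _).1
    have hG1 : ∀ q : Space n × (Fin M → Space n), (1 - t * p q.1) * Q q.2 ≤ 1 := fun q =>
      mul_le_one₀ (by linarith [(htp q.1).1]) (hQ01 _).1 (hQ01 _).2
    have hGm : Measurable fun q : Space n × (Fin M → Space n) => (1 - t * p q.1) * Q q.2 :=
      (measurable_const.sub (hpm.const_mul t)).mul hQm'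
    have hi1 : Integrable (fun q => F q * ((1 - t * p q.1) * Q q.2)) (lam.prod P) :=
      hbd (hFm.mul hGm) (fun q => mul_nonneg (hF0 q) (hG0 q))
        fun q => mul_le_one₀ (hF1 q) (hG0 q) (hG1 q)
    have hi2 : Integrable (fun q : Space n × (Fin M → Space n) => e q.1 * Q q.2) (lam.prod P) :=
      hbd (hem'.mul hQm') (fun q => mul_nonneg (he0 _) (hQ01 _).1)
        fun q => mul_le_one₀ (he1 _) (hQ01 _).1 (hQ01 _).2
    have hi3 : Integrable (fun q : Space n × (Fin M → Space n) => p q.1) (lam.prod P) :=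
      hbd hpm (fun q => hp0 _) fun q => hp1 _
    rw [← h1, hZ, ← integral_sub hi1 hi2]
    refine abs_integral_le_integral_abs.trans ?_
    have h3 : ∫ q : Space n × (Fin M → Space n), (|F q - e q.1| + p q.1) ∂(lam.prod P)
        ≤ ε₂ * m + H := by
      rw [integral_add hΔi hi3, hpπ]
      exact add_le_add_left hΔ _
    refine le_trans (integral_mono (hi1.sub hi2).abs (hΔi.add hi3) fun q => ?_) h3
    have h4 : F q * ((1 - t * p q.1) * Q q.2) - e q.1 * Q q.2
        = (F q - e q.1) * Q q.2 - F q * (t * p q.1) * Q q.2 := by ring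
    change |F q * ((1 - t * p q.1) * Q q.2) - e q.1 * Q q.2| ≤ |F q - e q.1| + p q.1
    rw [h4]
    refine (abs_sub _ _).trans (add_le_add ?_ ?_)
    · rw [abs_mul, abs_of_nonneg (hQ01 q.2).1]
      exact mul_le_of_le_one_right (abs_nonneg _) (hQ01 _).2
    · have h5 : 0 ≤ F q * (t * p q.1) := mul_nonneg (hF0 q) (htp _).1
      rw [abs_of_nonneg (mul_nonneg h5 (hQ01 _).1)]
      exact (mul_le_of_le_one_right h5 (hQ01 _).2).trans
        ((mul_le_of_le_one_left (htp _).1 (hF1 q)).trans (htp _).2.2)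
  have hΛB : |B - r⁻¹ * Z| ≤ r⁻¹ * (2 * (ε₂ * m) + H) := by
    have h1 : B - r⁻¹ * Z = r⁻¹ * ((r - L) * B - (Z - L * B)) := by
      field_simp; ring
    rw [h1, abs_mul, abs_of_pos (inv_pos.2 hr0)]
    refine mul_le_mul_of_nonneg_left ((abs_sub _ _).trans ?_) (inv_pos.2 hr0).le
    have h2 : |(r - L) * B| ≤ ε₂ * m := by
      rw [abs_mul, abs_of_nonneg hB0]
      exact (mul_le_of_le_one_right (abs_nonneg _) hB1).trans hrL
    linarith
  rw [hΛ]
  -- Both `Λ'` and `Λ` are compared with `B`, the mean over the remaining `M` particles: `Λ' ≈ -K B`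
  -- and `Λ ≈ B`, with `K ≈ Θ`. The three summands are these three errors.
  have hdec : -∑ _i : Fin (M + 1), r⁻¹ * A + Θ * (r⁻¹ * Z)
      = -(r⁻¹ * (M + 1) * (A - H * B)) + -((K - Θ) * B) + -(Θ * (B - r⁻¹ * Z)) := by
    rw [hK]; simp; ring
  rw [hdec]
  refine (abs_add_three _ _ _).trans (add_le_add (add_le_add ?_ ?_) ?_)
  · rw [abs_neg, abs_mul, abs_of_nonneg (by positivity)]
    calc _ ≤ r⁻¹ * (M + 1) * (ε₁ * H) := mul_le_mul_of_nonneg_left hAH (by positivity)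
      _ = _ := by rw [hK]; ring
  · rw [abs_neg, abs_mul, abs_of_nonneg hB0]
    exact mul_le_of_le_one_right (abs_nonneg _) hB1
  · rw [abs_neg, abs_mul, abs_of_nonneg hΘ]
    exact mul_le_mul_of_nonneg_left hΛB hΘ

end PoissonLimit

/-! ### Laplace functional of the edge process as a mean product. -/

section EdgeProcess

variable {n : ℕ}

/-- The probability `1 - e^{-f}` in the Laplace functional. -/
noncomputable def laplaceWeight (f : Space n → ℝ≥0) (x : Space n) : ℝ := 1 - Real.exp (-(f x : ℝ))

lemma laplaceWeight_nonneg (f : Space n → ℝ≥0) (x : Space n) : 0 ≤ laplaceWeight f x :=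
  sub_nonneg.2 (Real.exp_le_one_iff.2 (neg_nonpos.2 (f x).2))

lemma laplaceWeight_le_one (f : Space n → ℝ≥0) (x : Space n) : laplaceWeight f x ≤ 1 := by
  have := Real.exp_pos (-(f x : ℝ))
  rw [laplaceWeight]; linarith

lemma measurable_laplaceWeight {f : Space n → ℝ≥0} (hf : Measurable f) :
    Measurable (laplaceWeight f) := by
  unfold laplaceWeight; fun_prop

/-- `e^{-Ξ(f)}` is the product of the `e^{-f(φ⁻¹(x_j))} = 1 - p(x_j)`, that is, the thinning product
at `t = 1`. -/
lemma laplaceFunctional_edgeProcess {α η : ℝ} (hα : 0 < α) (hη : 0 < η) (υ : Space n)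
    (ψ : Space n ≃ₗᵢ[ℝ] Space n) {N : ℕ} (P : Measure (Fin N → Space n)) [IsFiniteMeasure P]
    {f : Space n → ℝ≥0} (hf : Measurable f) :
    laplaceFunctional P (edgeProcess (edgeMap α η υ ψ)) f
      = ENNReal.ofReal (∫ x, thinProd (fun z => laplaceWeight f (edgeMapInv α η υ ψ z)) 1 x ∂P) := by
  have hp : Measurable fun z => laplaceWeight f (edgeMapInv α η υ ψ z) :=
    (measurable_laplaceWeight hf).comp (continuous_edgeMapInv α η υ ψ).measurable
  have h01 := fun x : Fin N → Space n => thinProd_mem_Icc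
    (h := fun z => laplaceWeight f (edgeMapInv α η υ ψ z))
    (fun z => laplaceWeight_nonneg f _) (fun z => laplaceWeight_le_one f _)
    (t := 1) (Set.right_mem_Icc.2 zero_le_one) x
  rw [laplaceFunctional, ofReal_integral_eq_lintegral_ofReal
    (Integrable.of_bound (measurable_thinProd hp 1).aestronglyMeasurable 1
      (ae_of_all _ fun x => by rw [Real.norm_of_nonneg (h01 x).1]; exact (h01 x).2))
    (ae_of_all _ fun x => (h01 x).1)]
  refine lintegral_congr fun x => ?_
  rw [edgeProcess, lintegral_finsetSum_measure, expNeg_sum, thinProd,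
    ENNReal.ofReal_prod_of_nonneg]
  · refine Finset.prod_congr rfl fun j _ => ?_
    rw [lintegral_dirac' _ hf.coe_nnreal_ennreal, invFun_edgeMap hα hη, expNeg_coe, laplaceWeight]
    congr 1; ring
  · intro j _
    have := laplaceWeight_le_one f (edgeMapInv α η υ ψ (x j))
    linarith

end EdgeProcess

/-! ### Convergence of the Laplace functionals. -/

section Convergence

variable {n : ℕ} [NeZero n] {s α γ L : ℝ} {μ : ProbabilityMeasure (Space n)}

/-- Convergence of the Laplace functionals at the edge. -/
theorem SelfConsistent.tendsto_integral_thinProd (hs : 0 < s) (hsn : s < n) (hα : 0 < α)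
    (hγ : 0 ≤ γ) (h : SelfConsistent s α γ μ L) {β : ℕ → ℝ} (hβ : ∀ N, 0 < β N)
    (hβγ : Tendsto (fun N => β N * N) atTop (𝓝 γ)) {υ : Space n} (hυ : ‖υ‖ = 1)
    {ψ : Space n ≃ₗᵢ[ℝ] Space n} (hψ : ψ (e₁ n) = υ) {p : Space n → ℝ} (hp : Measurable p)
    (hp0 : ∀ x, 0 ≤ p x) (hp1 : ∀ x, p x ≤ 1) {R : ℝ} (hpR : ∀ y, R < ‖y‖ → p y = 0) :
    Tendsto (fun M => ∫ x, thinProd (fun z => p (edgeMapInv α (edgeRadius n α L (M + 1)) υ ψ z)) 1 x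
      ∂(gibbsMeasure n s α (β (M + 1)) (M + 1))) atTop
      (𝓝 (Real.exp (-∫ y, p y * Real.exp (-(inner ℝ (e₁ n) y))))) := by
  have hfin := isFiniteMeasure_weightMeasure (n := n) hα
  set Θ := ∫ y, p y * Real.exp (-(inner ℝ (e₁ n) y)) with hΘdef
  have hΘ : 0 ≤ Θ := integral_nonneg fun y => mul_nonneg (hp0 y) (Real.exp_nonneg _)
  have hL := h.1
  set m := (weightMeasure n α).real Set.univ with hm
  have hm0 : 0 ≤ m := measureReal_nonneg
  -- the sequence of temperatures
  set b : ℕ → ℝ := fun M => β (M + 1) with hb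
  have hb1 : Tendsto (fun M : ℕ => b M * (M + 1)) atTop (𝓝 γ) := by
    refine (hβγ.comp (tendsto_add_atTop_nat 1)).congr fun M => ?_
    simp [hb]
  have hb0 : Tendsto b atTop (𝓝 0) := by
    have h1 := hb1.mul (tendsto_one_div_add_atTop_nhds_zero_nat (𝕜 := ℝ))
    rw [mul_zero] at h1
    refine h1.congr fun M => ?_
    have : (M : ℝ) + 1 ≠ 0 := by positivity
    field_simp
  -- The `M` particles left after peeling keep the coupling `β_{M+1}` of the original gas; since it
  -- tends to zero, losing one particle does not change the limit `γ`.
  have hbM : Tendsto (fun M : ℕ => b M * M) atTop (𝓝 γ) := by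
    have h1 := hb1.sub hb0
    rw [sub_zero] at h1
    exact h1.congr fun M => by ring
  -- the sequence of radii
  set η : ℕ → ℝ := fun M => edgeRadius n α L (M + 1) with hη
  have hηt : Tendsto η atTop atTop := (tendsto_edgeRadius n hα L).comp (tendsto_add_atTop_nat 1)
  set q : ℕ → Space n → ℝ := fun M z => p (edgeMapInv α (η M) υ ψ z) with hq
  have hqm : ∀ M, Measurable (q M) := fun M => hp.comp (continuous_edgeMapInv α _ υ ψ).measurable
  set H : ℕ → ℝ := fun M => ∫ z, q M z ∂(weightMeasure n α) with hH
  have hHt : Tendsto (fun M : ℕ => ((M : ℝ) + 1) * H M) atTop (𝓝 (L * Θ)) := by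
    have h1 := (tendsto_integral_edgeMapInv hα hL hυ hψ hp
      (fun y => by rw [abs_of_nonneg (hp0 y)]; exact hp1 y) hpR).comp (tendsto_add_atTop_nat 1)
    refine h1.congr fun M => ?_
    simp only [Function.comp_apply, hH, hq, hη]
    push_cast
    rfl
  have hH0 : Tendsto H atTop (𝓝 0) := by
    have h1 := hHt.mul (tendsto_one_div_add_atTop_nhds_zero_nat (𝕜 := ℝ))
    rw [mul_zero] at h1
    refine h1.congr fun M => ?_
    have : (M : ℝ) + 1 ≠ 0 := by positivity
    field_simp
  have hMF := fun {ε : ℝ} (hε : 0 < ε) =>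
    h.eventually_integral_fieldFactor_sub_le hs hsn hα hγ (β := b) (M := fun M => M)
      (fun M => hβ (M + 1)) hb0 hbM hε
  set r : ℕ → ℝ := fun M => (partitionRatio n s α (b M) M).toReal with hr
  have hrt : Tendsto r atTop (𝓝 L) := by
    rw [Metric.tendsto_nhds]
    intro ε hε
    filter_upwards [hMF (show 0 < ε / (m + 1) by positivity)] with M hM
    rw [Real.dist_eq]
    refine (h.abs_partitionRatio_sub_le hs hsn hα hγ hM).trans_lt ?_
    rw [← hm, div_mul_eq_mul_div, div_lt_iff₀ (by positivity)]
    nlinarith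
  set K : ℕ → ℝ := fun M => (r M)⁻¹ * ((M + 1) * H M) with hK
  -- The two occurrences of `L` meet: `(M+1) H → LΘ` by the choice of `η_N`, while the ratio of
  -- partition functions tends to `L`.
  have hKt : Tendsto K atTop (𝓝 Θ) := by
    have h1 := (hrt.inv₀ hL.ne').mul hHt
    rwa [← mul_assoc, inv_mul_cancel₀ hL.ne', one_mul] at h1
  -- particles at the edge do not feel the gas
  set c : ℝ≥0∞ := ENNReal.ofReal (γ + 1) with hc
  have hbc : ∀ᶠ M : ℕ in atTop, ENNReal.ofReal (b M) * M ≤ c := by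
    filter_upwards [hbM.eventually (gt_mem_nhds (show γ < γ + 1 by linarith))] with M hM
    rw [← ENNReal.ofReal_natCast, ← ENNReal.ofReal_mul (hβ _).le]
    exact ENNReal.ofReal_le_ofReal hM.le
  set a : ℝ≥0∞ := c * (ratioBound n s α c)⁻¹ with ha
  have hedge : ∀ {ε : ℝ}, 0 < ε → ∀ᶠ M : ℕ in atTop, ∀ x, q M x ≠ 0 →
      1 - ∫ y, (fieldFactor s (b M) x y).toReal ∂(gibbsMeasure n s α (b M) M) ≤ ε := by
    intro ε hε
    have ha0 : 0 ≤ a.toReal := ENNReal.toReal_nonneg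
    have hδ : 0 < ε / (a.toReal + 1) := by positivity
    filter_upwards [hbc, eventually_generatedPotential_edgeMap_le hs hsn hα hηt hυ ψ R
      (ENNReal.ofReal_pos.2 hδ), hηt.eventually_gt_atTop 0] with M h1 h2 h3 x hx
    have h4 : ‖edgeMapInv α (η M) υ ψ x‖ ≤ R := by
      by_contra h5
      exact hx (hpR _ (not_le.1 h5))
    have h5 := h2 _ h4
    rw [edgeMap_edgeMapInv hα h3] at h5
    refine (one_sub_integral_fieldFactor_le hs hsn hα ENNReal.ofReal_ne_top h1
      ENNReal.ofReal_ne_top h5).trans ?_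
    rw [← mul_assoc, ENNReal.toReal_mul, ENNReal.toReal_ofReal hδ.le, ← mul_div_assoc,
      div_le_iff₀ (by positivity)]
    change a.toReal * ε ≤ _
    nlinarith
  -- conclusion
  rw [Metric.tendsto_nhds]
  intro ε hε
  -- With both error parameters equal to `ε'`, the bound tends to `D ε'`; taking `ε' = ε/(D+1)`
  -- makes it less than `ε`.
  set D : ℝ := Θ + Θ * (L⁻¹ * (2 * m)) with hD
  have hD0 : 0 ≤ D := by positivity
  set ε' : ℝ := ε / (D + 1) with hε'def
  have hε' : 0 < ε' := by positivity
  have hlim : Tendsto (fun M => K M * ε' + |K M - Θ| + Θ * ((r M)⁻¹ * (2 * (ε' * m) + H M))) atTop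
      (𝓝 (D * ε')) := by
    have h1 := ((hKt.mul_const ε').add (hKt.sub_const Θ).abs).add
      (((hrt.inv₀ hL.ne').mul (hH0.const_add (2 * (ε' * m)))).const_mul Θ)
    have e : Θ * ε' + |Θ - Θ| + Θ * (L⁻¹ * (2 * (ε' * m) + 0)) = D * ε' := by
      rw [sub_self, abs_zero, hD]; ring
    rwa [e] at h1
  have hlt : D * ε' < ε := by
    rw [hε'def, ← mul_div_assoc, div_lt_iff₀ (by positivity)]
    nlinarith
  filter_upwards [hlim.eventually (gt_mem_nhds hlt), hMF hε', hedge hε',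
    hrt.eventually (lt_mem_nhds hL)] with M h1 h2 h3 h4
  rw [Real.dist_eq]
  exact (h.abs_integral_thinProd_sub_le hs hsn hα hγ (hqm M) (fun _ => hp0 _) (fun _ => hp1 _)
    hΘ h3 h2 rfl h4 rfl rfl).trans_lt h1

/-- The Laplace functionals of the edge process converge to those of a Poisson process. -/
theorem SelfConsistent.tendsto_laplaceFunctional_edgeProcess (hs : 0 < s) (hsn : s < n)
    (hα : 0 < α) (hγ : 0 ≤ γ) (h : SelfConsistent s α γ μ L) {β : ℕ → ℝ} (hβ : ∀ N, 0 < β N)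
    (hβγ : Tendsto (fun N => β N * N) atTop (𝓝 γ)) {υ : Space n} (hυ : ‖υ‖ = 1)
    {ψ : Space n ≃ₗᵢ[ℝ] Space n} (hψ : ψ (e₁ n) = υ) {f : Space n → ℝ≥0} (hf : Continuous f)
    (hfc : HasCompactSupport f) :
    Tendsto (fun N => laplaceFunctional (gibbsMeasure n s α (β N) N)
      (edgeProcess (edgeMap α (edgeRadius n α L N) υ ψ)) f) atTop
      (𝓝 (expNeg (∫⁻ x, (1 - expNeg (f x)) ∂(edgeIntensity n)))) := by
  obtain ⟨R, hR⟩ := hfc.isCompact.isBounded.subset_closedBall (0 : Space n)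
  have hfR : ∀ y, R < ‖y‖ → f y = 0 := fun y hy => by
    by_contra h0
    have := hR (subset_tsupport _ (Function.mem_support.2 h0))
    rw [mem_closedBall_zero_iff] at this
    linarith
  have hpR : ∀ y, R < ‖y‖ → laplaceWeight f y = 0 := fun y hy => by
    simp [laplaceWeight, hfR y hy]
  have hpm := measurable_laplaceWeight hf.measurable
  have hcont : Continuous fun y => laplaceWeight f y * Real.exp (-(inner ℝ (e₁ n) y)) := by
    unfold laplaceWeight; fun_prop
  have hint : Integrable fun y => laplaceWeight f y * Real.exp (-(inner ℝ (e₁ n) y)) := by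
    refine hcont.integrable_of_hasCompactSupport
      (HasCompactSupport.intro (isCompact_closedBall (0 : Space n) R) fun y hy => ?_)
    rw [hpR y (by simpa using hy), zero_mul]
  have hlim : expNeg (∫⁻ x, (1 - expNeg (f x)) ∂(edgeIntensity n))
      = ENNReal.ofReal (Real.exp (-∫ y, laplaceWeight f y * Real.exp (-(inner ℝ (e₁ n) y)))) := by
    have h1 : ∫⁻ x, (1 - expNeg (f x)) ∂(edgeIntensity n)
        = ENNReal.ofReal (∫ y, laplaceWeight f y * Real.exp (-(inner ℝ (e₁ n) y))) := by
      have hm1 : Measurable fun x => 1 - expNeg (f x : ℝ≥0∞) :=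
        measurable_const.sub (measurable_expNeg.comp hf.measurable.coe_nnreal_ennreal)
      rw [edgeIntensity, lintegral_withDensity_eq_lintegral_mul _ (by fun_prop) hm1,
        ofReal_integral_eq_lintegral_ofReal hint
        (ae_of_all _ fun y => mul_nonneg (laplaceWeight_nonneg f y) (Real.exp_nonneg _))]
      refine lintegral_congr fun y => ?_
      rw [Pi.mul_apply, expNeg_coe, ENNReal.ofReal_mul (laplaceWeight_nonneg f y), mul_comm,
        laplaceWeight, ENNReal.ofReal_sub _ (Real.exp_nonneg _), ENNReal.ofReal_one]
    rw [h1, expNeg_ofReal]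
    exact integral_nonneg fun y => mul_nonneg (laplaceWeight_nonneg f y) (Real.exp_nonneg _)
  -- Peeling requires at least one particle, so the limit is taken along `N = M + 1`.
  rw [hlim, ← tendsto_add_atTop_iff_nat 1]
  have key := (ENNReal.continuous_ofReal.tendsto _).comp
    (h.tendsto_integral_thinProd hs hsn hα hγ hβ hβγ hυ hψ hpm (laplaceWeight_nonneg f)
      (laplaceWeight_le_one f) hpR)
  refine key.congr' ?_
  have hηt : Tendsto (fun M => edgeRadius n α L (M + 1)) atTop atTop :=
    (tendsto_edgeRadius n hα L).comp (tendsto_add_atTop_nat 1)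
  filter_upwards [hηt.eventually_gt_atTop 0] with M hM
  have hP := isProbabilityMeasure_gibbsMeasure (n := n) (β (M + 1)) hs hsn hα (M + 1)
  rw [laplaceFunctional_edgeProcess hα hM υ ψ _ hf.measurable]
  rfl

end Convergence

/-! ### Construction of Poisson processes. -/

section Poisson

open ProbabilityTheory

variable {n : ℕ}

/-- The point configuration consisting of the first `q.1` points of the sequence `q.2`. -/
noncomputable def cluster (q : ℕ × (ℕ → Space n)) : Measure (Space n) :=
  ∑ j ∈ Finset.range q.1, Measure.dirac (q.2 j)

lemma lintegral_cluster (q : ℕ × (ℕ → Space n)) {f : Space n → ℝ≥0∞} (hf : Measurable f) :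
    ∫⁻ x, f x ∂(cluster q) = ∑ j ∈ Finset.range q.1, f (q.2 j) := by
  rw [cluster, lintegral_finsetSum_measure]
  exact Finset.sum_congr rfl fun j _ => lintegral_dirac' _ hf

lemma measurable_lintegral_cluster {f : Space n → ℝ≥0∞} (hf : Measurable f) :
    Measurable fun q : ℕ × (ℕ → Space n) => ∫⁻ x, f x ∂(cluster q) := by
  simp_rw [lintegral_cluster _ hf]
  refine measurable_from_prod_countable_right fun m => ?_
  simp only
  fun_prop

lemma cluster_apply_eq_natCast (q : ℕ × (ℕ → Space n)) {B : Set (Space n)} (hB : MeasurableSet B) :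
    ∃ k : ℕ, cluster q B = k := by
  classical
  refine ⟨∑ j ∈ Finset.range q.1, if q.2 j ∈ B then 1 else 0, ?_⟩
  rw [cluster, Measure.finsetSum_apply, Nat.cast_sum]
  refine Finset.sum_congr rfl fun j _ => ?_
  rw [Measure.dirac_apply' _ hB]
  by_cases h : q.2 j ∈ B <;> simp [h]

/-- The law of a Poisson number of independent points with common law `κ`. -/
noncomputable def clusterLaw (c : ℝ≥0) (κ : Measure (Space n)) [IsProbabilityMeasure κ] :
    Measure (ℕ × (ℕ → Space n)) :=
  (poissonMeasure c).prod (Measure.infinitePi fun _ : ℕ => κ)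

instance isProbabilityMeasure_clusterLaw (c : ℝ≥0) (κ : Measure (Space n)) [IsProbabilityMeasure κ] :
    IsProbabilityMeasure (clusterLaw c κ) := by
  unfold clusterLaw; infer_instance

lemma lintegral_infinitePi_prod {ι : Type*} {X : ι → Type*} [∀ i, MeasurableSpace (X i)]
    (P : ∀ i, Measure (X i)) [∀ i, IsProbabilityMeasure (P i)] (s : Finset ι)
    {g : ∀ i, X i → ℝ≥0∞} (hg : ∀ i, Measurable (g i)) :
    ∫⁻ x, ∏ j ∈ s, g j (x j) ∂(Measure.infinitePi P) = ∏ j ∈ s, ∫⁻ z, g j z ∂(P j) := by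
  rw [lintegral_prod_eq_prod_lintegral_of_indepFun s (fun i (x : ∀ i, X i) => g i (x i))
    (iIndepFun_infinitePi hg) fun i => (hg i).comp (measurable_pi_apply i)]
  exact Finset.prod_congr rfl fun i _ => (measurePreserving_eval_infinitePi P i).lintegral_comp (hg i)

lemma lintegral_pow_poissonMeasure (c : ℝ≥0) {G : ℝ} (hG : 0 ≤ G) :
    ∫⁻ m, ENNReal.ofReal G ^ m ∂(poissonMeasure c) = ENNReal.ofReal (Real.exp (c * (G - 1))) := by
  rw [lintegral_countable']
  simp_rw [poissonMeasure_singleton]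
  have h1 : HasSum (fun m : ℕ => G ^ m * (Real.exp (-c) * c ^ m / m.factorial))
      (Real.exp (c * (G - 1))) := by
    have h2 := (NormedSpace.expSeries_div_hasSum_exp (𝔸 := ℝ) (c * G)).mul_left (Real.exp (-c))
    rw [← Real.exp_eq_exp_ℝ, ← Real.exp_add] at h2
    have e : -(c : ℝ) + c * G = c * (G - 1) := by ring
    rw [e] at h2
    have e' : (fun m : ℕ => G ^ m * (Real.exp (-c) * c ^ m / m.factorial))
        = fun m : ℕ => Real.exp (-c) * ((c * G) ^ m / m.factorial) := by
      ext m; rw [mul_pow]; ring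
    rwa [e']
  have h0 : ∀ m : ℕ, 0 ≤ G ^ m * (Real.exp (-c) * c ^ m / m.factorial) := fun m => by positivity
  rw [← h1.tsum_eq, ENNReal.ofReal_tsum_of_nonneg h0 h1.summable]
  refine tsum_congr fun m => ?_
  rw [ENNReal.ofReal_mul (by positivity), ENNReal.ofReal_pow hG]

/-- Given the number of points `m`, independence gives `G^m`; averaging over a Poisson number gives
`e^{c(G-1)}`, and `c(1-G)` is the integral of `1 - e^{-f}` against `c κ`. -/
lemma lintegral_expNeg_cluster (c : ℝ≥0) (κ : Measure (Space n)) [IsProbabilityMeasure κ]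
    {f : Space n → ℝ≥0∞} (hf : Measurable f) :
    ∫⁻ q, expNeg (∫⁻ x, f x ∂(cluster q)) ∂(clusterLaw c κ)
      = expNeg (∫⁻ x, (1 - expNeg (f x)) ∂((c : ℝ≥0∞) • κ)) := by
  have hg : Measurable fun x => expNeg (f x) := measurable_expNeg.comp hf
  have hm : Measurable fun q : ℕ × (ℕ → Space n) => expNeg (∫⁻ x, f x ∂(cluster q)) :=
    measurable_expNeg.comp (measurable_lintegral_cluster hf)
  set G := ∫⁻ x, expNeg (f x) ∂κ with hG
  have hG1 : G ≤ 1 := by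
    simpa using lintegral_mono (μ := κ) fun x => expNeg_le_one (f x)
  have hGt : G ≠ ⊤ := (hG1.trans_lt ENNReal.one_lt_top).ne
  rw [clusterLaw, lintegral_prod _ hm.aemeasurable]
  have h1 : ∀ m : ℕ, ∫⁻ y, expNeg (∫⁻ x, f x ∂(cluster (m, y)))
      ∂(Measure.infinitePi fun _ : ℕ => κ) = G ^ m := by
    intro m
    simp_rw [lintegral_cluster _ hf, expNeg_sum]
    rw [lintegral_infinitePi_prod (fun _ : ℕ => κ) (Finset.range m)
      (g := fun _ x => expNeg (f x)) fun _ => hg]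
    simp [hG]
  simp_rw [h1]
  have h2 : ∫⁻ x, (1 - expNeg (f x)) ∂((c : ℝ≥0∞) • κ) = ENNReal.ofReal (c * (1 - G.toReal)) := by
    rw [lintegral_smul_measure, lintegral_sub hg hGt (ae_of_all _ fun x => expNeg_le_one _), ← hG,
      ENNReal.ofReal_mul (by positivity), ENNReal.ofReal_sub _ ENNReal.toReal_nonneg,
      ENNReal.ofReal_toReal hGt]
    simp
  have h3 : G.toReal ≤ 1 := by simpa using ENNReal.toReal_mono ENNReal.one_ne_top hG1
  rw [h2, expNeg_ofReal (mul_nonneg (NNReal.coe_nonneg c) (sub_nonneg.2 h3)), ← ENNReal.ofReal_toReal hGt,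
    lintegral_pow_poissonMeasure c ENNReal.toReal_nonneg, ENNReal.toReal_ofReal ENNReal.toReal_nonneg]
  congr 2; ring

/-- A superposition of independent clusters. -/
noncomputable def superposition (ω : ℕ → ℕ × (ℕ → Space n)) : Measure (Space n) :=
  Measure.sum fun k => cluster (ω k)

lemma measurable_superposition : Measurable (superposition (n := n)) := by
  refine Measure.measurable_of_measurable_coe _ fun B hB => ?_
  simp_rw [superposition, Measure.sum_apply _ hB]
  refine Measurable.tsum fun k => ?_
  have h1 : Measurable fun q : ℕ × (ℕ → Space n) => cluster q B := by
    have := measurable_lintegral_cluster (n := n) (f := B.indicator 1)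
      (measurable_const.indicator hB)
    simpa [lintegral_indicator_one hB] using this
  exact h1.comp (measurable_pi_apply k)

/-- A convergent series of natural numbers has finitely many nonzero terms. -/
lemma superposition_apply_eq_natCast (ω : ℕ → ℕ × (ℕ → Space n)) {B : Set (Space n)}
    (hB : MeasurableSet B) (h : superposition ω B ≠ ⊤) : ∃ k : ℕ, superposition ω B = k := by
  rw [superposition, Measure.sum_apply _ hB] at h ⊢
  choose a ha using fun k => cluster_apply_eq_natCast (ω k) hB
  simp_rw [ha] at h ⊢
  have h1 : ∀ᶠ k in cofinite, ((a k : ℕ) : ℝ≥0∞) < 1 :=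
    (ENNReal.tendsto_cofinite_zero_of_tsum_ne_top h).eventually (gt_mem_nhds one_pos)
  have h2 : {k | a k ≠ 0}.Finite := by
    refine h1.subset fun k hk => ?_
    simp only [Set.mem_compl_iff, Set.mem_ofPred_eq, not_lt]
    exact_mod_cast Nat.one_le_iff_ne_zero.2 hk
  refine ⟨∑ k ∈ h2.toFinset, a k, ?_⟩
  rw [Nat.cast_sum]
  refine tsum_eq_sum fun k hk => ?_
  simpa using hk

variable (c : ℕ → ℝ≥0) (κ : ℕ → Measure (Space n)) [∀ k, IsProbabilityMeasure (κ k)]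

/-- The law of a sequence of independent Poisson clusters. -/
noncomputable def superpositionLaw : Measure (ℕ → ℕ × (ℕ → Space n)) :=
  Measure.infinitePi fun k => clusterLaw (c k) (κ k)

instance isProbabilityMeasure_superpositionLaw : IsProbabilityMeasure (superpositionLaw c κ) := by
  unfold superpositionLaw; infer_instance

/-- Independence of the clusters turns finite sums into products; dominated convergence passes to
the infinite sum, including where it equals `∞`, because `expNeg` is continuous there. -/
lemma lintegral_expNeg_superposition {f : Space n → ℝ≥0∞} (hf : Measurable f) :
    ∫⁻ ω, expNeg (∫⁻ x, f x ∂(superposition ω)) ∂(superpositionLaw c κ)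
      = expNeg (∫⁻ x, (1 - expNeg (f x)) ∂(Measure.sum fun k => (c k : ℝ≥0∞) • κ k)) := by
  set S : ℕ → (ℕ × (ℕ → Space n)) → ℝ≥0∞ := fun _ q => ∫⁻ x, f x ∂(cluster q) with hS
  have hSm : Measurable fun q : ℕ × (ℕ → Space n) => ∫⁻ x, f x ∂(cluster q) :=
    measurable_lintegral_cluster hf
  have hem : Measurable fun q : ℕ × (ℕ → Space n) => expNeg (∫⁻ x, f x ∂(cluster q)) :=
    measurable_expNeg.comp hSm
  have hfin : ∀ K : ℕ, ∫⁻ ω, expNeg (∑ k ∈ Finset.range K, ∫⁻ x, f x ∂(cluster (ω k)))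
      ∂(superpositionLaw c κ)
      = expNeg (∑ k ∈ Finset.range K, ∫⁻ x, (1 - expNeg (f x)) ∂((c k : ℝ≥0∞) • κ k)) := by
    intro K
    simp_rw [expNeg_sum]
    rw [superpositionLaw, lintegral_infinitePi_prod (fun k => clusterLaw (c k) (κ k))
      (Finset.range K) (g := fun _ q => expNeg (∫⁻ x, f x ∂(cluster q))) fun _ => hem]
    exact Finset.prod_congr rfl fun k _ => lintegral_expNeg_cluster (c k) (κ k) hf
  simp_rw [superposition, lintegral_sum_measure]
  have hR := (continuous_expNeg.tendsto _).comp
    (ENNReal.summable.hasSum (f := fun k =>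
      ∫⁻ x, (1 - expNeg (f x)) ∂((c k : ℝ≥0∞) • κ k))).tendsto_sum_nat
  refine tendsto_nhds_unique ?_ hR
  refine Tendsto.congr hfin ?_
  refine tendsto_lintegral_of_dominated_convergence (fun _ => 1) (fun K => ?_)
    (fun K => ae_of_all _ fun ω => expNeg_le_one _) (by simp) (ae_of_all _ fun ω => ?_)
  · have h1 : ∀ k : ℕ, Measurable fun ω : ℕ → ℕ × (ℕ → Space n) => ∫⁻ x, f x ∂(cluster (ω k)) :=
      fun k => hSm.comp (measurable_pi_apply k)
    exact measurable_expNeg.comp (Finset.measurable_fun_sum _ fun k _ => h1 k)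
  · exact (continuous_expNeg.tendsto _).comp
      (ENNReal.summable.hasSum (f := fun k => ∫⁻ x, f x ∂(cluster (ω k)))).tendsto_sum_nat

/-- Where `Ξ(B) = ∞`, `e^{-tΞ(B)}` vanishes for every `t > 0`. The Laplace functional at `t · 1_B`
therefore bounds the probability of `Ξ(B) < ∞` from below by `exp(-(1-e^{-t}) θ(B))`, which tends to
`1` as `t → 0`. -/
lemma ae_superposition_ne_top {B : Set (Space n)} (hB : MeasurableSet B)
    (h : (Measure.sum fun k => (c k : ℝ≥0∞) • κ k) B ≠ ⊤) :
    ∀ᵐ ω ∂(superpositionLaw c κ), superposition ω B ≠ ⊤ := by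
  set θ := Measure.sum fun k => (c k : ℝ≥0∞) • κ k with hθ
  have hmB : Measurable fun ω : ℕ → ℕ × (ℕ → Space n) => superposition ω B :=
    (Measure.measurable_coe hB).comp measurable_superposition
  have hA : MeasurableSet {ω : ℕ → ℕ × (ℕ → Space n) | superposition ω B ≠ ⊤} :=
    hmB (measurableSet_singleton ⊤).compl
  have hle : ∀ t : ℝ≥0, 0 < t → expNeg ((1 - expNeg t) * θ B)
      ≤ superpositionLaw c κ {ω | superposition ω B ≠ ⊤} := by
    intro t ht
    have h1 := lintegral_expNeg_superposition c κ (f := B.indicator fun _ => (t : ℝ≥0∞))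
      (measurable_const.indicator hB)
    have h2 : ∫⁻ x, (1 - expNeg (B.indicator (fun _ => (t : ℝ≥0∞)) x)) ∂θ
        = (1 - expNeg t) * θ B := by
      rw [← lintegral_indicator_const hB]
      refine lintegral_congr fun x => ?_
      by_cases hx : x ∈ B <;> simp [hx]
    rw [h2] at h1
    simp_rw [lintegral_indicator_const hB] at h1
    rw [← h1, ← lintegral_indicator_one hA]
    refine lintegral_mono fun ω => ?_
    by_cases hω : superposition ω B = ⊤
    · have : (t : ℝ≥0∞) * superposition ω B = ⊤ := by
        rw [hω, ENNReal.mul_top (by exact_mod_cast ht.ne')]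
      rw [this, expNeg_top]
      exact zero_le
    · rw [Set.indicator_of_mem (by exact hω)]
      exact expNeg_le_one _
  have hlim : Tendsto (fun t : ℝ≥0 => expNeg ((1 - expNeg t) * θ B)) (𝓝[>] 0) (𝓝 1) := by
    have h1 : Tendsto (fun t : ℝ≥0 => 1 - expNeg (t : ℝ≥0∞)) (𝓝[>] 0) (𝓝 (1 - expNeg 0)) := by
      refine ENNReal.Tendsto.sub tendsto_const_nhds ?_ (Or.inl ENNReal.one_ne_top)
      refine (continuous_expNeg.tendsto 0).comp ?_
      exact ((ENNReal.continuous_coe.tendsto 0).mono_left nhdsWithin_le_nhds)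
    have h2 := (continuous_expNeg.tendsto _).comp (ENNReal.Tendsto.mul_const h1 (Or.inr h))
    rw [expNeg_zero, tsub_self, zero_mul, expNeg_zero] at h2
    exact h2
  have h1 : 1 ≤ superpositionLaw c κ {ω | superposition ω B ≠ ⊤} :=
    le_of_tendsto hlim (eventually_mem_nhdsWithin.mono fun t ht => hle t ht)
  exact (prob_compl_eq_zero_iff hA).2 (le_antisymm prob_le_one h1)

/-- Poisson processes exist for every s-finite intensity which is finite on bounded sets. -/
theorem exists_isPoissonPointProcess (θ : Measure (Space n)) [SFinite θ]
    (hθ : ∀ r : ℕ, θ (Metric.ball 0 r) ≠ ⊤) :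
    ∃ (Ω : Type) (_ : MeasurableSpace Ω) (P : Measure Ω) (Ξ : Ω → Measure (Space n)),
      IsPoissonPointProcess P Ξ θ := by
  classical
  -- A zero piece cannot be normalised; an arbitrary Dirac mass stands in, with rate `c k = 0`.
  set κ : ℕ → Measure (Space n) := fun k =>
    if sfiniteSeq θ k = 0 then Measure.dirac 0
    else (sfiniteSeq θ k Set.univ)⁻¹ • sfiniteSeq θ k with hκ
  have hκp : ∀ k, IsProbabilityMeasure (κ k) := by
    intro k
    by_cases h : sfiniteSeq θ k = 0
    · simp only [hκ, if_pos h]; infer_instance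
    · simp only [hκ, if_neg h]
      have : NeZero (sfiniteSeq θ k) := ⟨h⟩
      infer_instance
  set c : ℕ → ℝ≥0 := fun k => (sfiniteSeq θ k Set.univ).toNNReal with hc
  have hck : ∀ k, (c k : ℝ≥0∞) • κ k = sfiniteSeq θ k := by
    intro k
    rw [hc, ENNReal.coe_toNNReal (measure_ne_top _ _)]
    by_cases h : sfiniteSeq θ k = 0
    · simp [h]
    · simp only [hκ, if_neg h]
      rw [smul_smul, ENNReal.mul_inv_cancel (by simpa using h) (measure_ne_top _ _), one_smul]
  have hsum : (Measure.sum fun k => (c k : ℝ≥0∞) • κ k) = θ := by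
    simp_rw [hck]; exact sum_sfiniteSeq θ
  refine ⟨ℕ → ℕ × (ℕ → Space n), inferInstance, superpositionLaw c κ, superposition,
    inferInstance, ⟨measurable_superposition, ?_⟩, fun f hf => ?_⟩
  · have h1 : ∀ᵐ ω ∂(superpositionLaw c κ), ∀ r : ℕ, superposition ω (Metric.ball 0 r) ≠ ⊤ :=
      ae_all_iff.2 fun r => ae_superposition_ne_top c κ measurableSet_ball (by rw [hsum]; exact hθ r)
    filter_upwards [h1] with ω hω B hB hBb
    obtain ⟨r, hr⟩ := hBb.subset_ball (0 : Space n)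
    obtain ⟨k, hk⟩ := exists_nat_gt r
    refine superposition_apply_eq_natCast ω hB ((measure_mono ?_).trans_lt (hω k).lt_top).ne
    exact hr.trans (Metric.ball_subset_ball hk.le)
  · rw [laplaceFunctional, lintegral_expNeg_superposition c κ hf.coe_nnreal_ennreal, hsum]

end Poisson

/-! ### Local finiteness of the limiting intensity. -/

section EdgeIntensity

instance sigmaFinite_edgeIntensity (n : ℕ) [NeZero n] : SigmaFinite (edgeIntensity n) := by
  unfold edgeIntensity
  exact SigmaFinite.withDensity_of_ne_top (ae_of_all _ fun x => ENNReal.ofReal_ne_top)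

lemma edgeIntensity_ball_ne_top (n : ℕ) [NeZero n] (r : ℕ) :
    edgeIntensity n (Metric.ball 0 r) ≠ ⊤ := by
  have hc : Continuous fun x : Space n => Real.exp (-(inner ℝ (e₁ n) x)) := by fun_prop
  have hi : IntegrableOn (fun x : Space n => Real.exp (-(inner ℝ (e₁ n) x)))
      (Metric.closedBall 0 r) := hc.continuousOn.integrableOn_compact (isCompact_closedBall _ _)
  rw [edgeIntensity, withDensity_apply _ measurableSet_ball]
  exact (((lintegral_mono_set Metric.ball_subset_closedBall).trans
    (lintegral_ofReal_le_lintegral_enorm _)).trans_lt hi.2).ne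

end EdgeIntensity

end RieszGas

/-- The equilibrium measure, its constant and the Poisson process are fixed before `υ`, `ψ` and the
sequence `β`: the limit depends on none of the latter. -/
theorem mainTheorem4 (n : ℕ) [NeZero n] (s α γ : ℝ) (hs : 0 < s) (hsn : s < n)
    (hα : 0 < α) (hγ : 0 ≤ γ) :
    ∃ (μ : ProbabilityMeasure (RieszGas.Space n)) (L : ℝ),
      RieszGas.IsEquilibriumMeasure s α γ μ ∧ RieszGas.SelfConsistent s α γ μ L ∧
      ∃ (Ω : Type) (_ : MeasurableSpace Ω) (P : Measure Ω) (Ξ : Ω → Measure (RieszGas.Space n)),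
        RieszGas.IsPoissonPointProcess P Ξ (RieszGas.edgeIntensity n) ∧
        ∀ υ : RieszGas.Space n, ‖υ‖ = 1 →
          ∀ ψ : RieszGas.Space n ≃ₗᵢ[ℝ] RieszGas.Space n, ψ (RieszGas.e₁ n) = υ →
            ∀ β : ℕ → ℝ, (∀ N, 0 < β N) → Tendsto (fun N => β N * N) atTop (𝓝 γ) →
              RieszGas.ConvergesInDistribution
                (fun N => RieszGas.gibbsMeasure n s α (β N) N)
                (fun N => RieszGas.edgeProcess
                  (RieszGas.edgeMap α (RieszGas.edgeRadius n α L N) υ ψ))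
                P Ξ := by
  obtain ⟨μ, L, hμ, hL⟩ := RieszGas.exists_equilibriumMeasure n γ hs hsn hα
  obtain ⟨Ω, mΩ, P, Ξ, hΞ⟩ := RieszGas.exists_isPoissonPointProcess (RieszGas.edgeIntensity n)
    (RieszGas.edgeIntensity_ball_ne_top n)
  refine ⟨μ, L, hμ, hL, Ω, mΩ, P, Ξ, hΞ, fun υ hυ ψ hψ β hβ hβγ f hf hfc => ?_⟩
  rw [hΞ.2.2 f hf.measurable]
  exact hL.tendsto_laplaceFunctional_edgeProcess hs hsn hα hγ hβ hβγ hυ hψ hf hfc
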